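/- Let $X=\mathbb C$ with coordinate $x$ and let $\phi$ be the Berk–Nevins–Roberts spectral cover $\Sigma=\{(x,p): p^3-3p+x=0\}\to X$, with branch points $x=\pm2$; locally away from $\pm 2$ write $\phi_i=p_i\,dx$ for its three sheets. *Spectral network.* A trajectory with label $(p,q)$ is a curve $\gamma$ in $X$ with two lifts $p(t)\ne q(t)$ to $\Sigma$ such that $(p-q)\,dx$ takes values in $i\mathbb R_{>0}$ on $\gamma'$. The lines of the network $\mathcal W_{\mathrm{bnr}}$ are generated as follows: the trajectories starting at the branch points, with the two lifts coming together there, and, whenever a line labelled $(p,r)$ and a line labelled $(r,q)$ meet at a point (a collision point), the $(p,q)$-trajectory starting there. $\mathcal W_{\mathrm{bnr}}$ is the union of the lines and the branch points. The extended network $\mathcal W^{\mathrm{ext}}_{\mathrm{bnr}}$ is the union of $\mathcal W_{\mathrm{bnr}}$ and the backward collision line, i.e. the (vertical) segment joining the two collision points. *Building.* Let $\mathcal B^8=\bigcup_n G_n$, where $G_0$ is the octagon with bipartite vertices $b_0,w_0,b_1,w_1,b_2,w_2,b_3,w_3$ in cyclic order, and $G_{n+1}$ arises from $G_n$ by gluing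 in one new pair of edges (one new vertex of the opposite colour) between any two vertices that are the ends of a path of four edges not contained in a hexagon. Let $\mathcal B^\phi=\mathrm{Cone}(\mathcal B^8)$, with one $60^\circ$ sector for each edge of $\mathcal B^8$. Its apartments are the cones over the hexagons of $\mathcal B^8$, each identified with the plane $\{u\in\mathbb R^3:u_1+u_2+u_3=0\}$ of type $A_2$ (a ray on which the largest coordinate is single and the two others agree corresponds to a white vertex, a ray on which the smallest coordinate is single and the two others agree to a black one), and its topology is given by the distance computed in apartments. A point of $\mathcal B^\phi$ is singular if no neighbourhood of it is contained in a single apartment. *Maps.* A harmonic $\phi$-map $h:X\to\mathcal B^\phi$ is a continuous map such that every point outside some closed discrete set has a neighbourhood that is mapped into a single apartment, in whose coordinates $dh=(\mathrm{Re}\,\phi_1,\mathrm{Re}\,\phi_2,\mathrm{Re}\,\phi_3)$ for an ordering of the sheets. The universal map $h^\phi:X\to\mathcal B^\phi$ is the following one. Let $m$ be the vertex added between $b_0$ and $b_2$ in $G_1$. On the upper (lower) closed half plane order the sheets by decreasing real part of $p$ and let $D=(\mathrm{Re}\int\phi_1,\mathrm{Re}\int\phi_2,\mathrm{Re}\int\phi_3)$,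 the integrals starting at the collision point in that half plane (equivalently $D_i=\mathrm{Re}(\tfrac32p_i^2-\tfrac34p_i^4+\tfrac32)$); then $h^\phi$ is $D$ followed by the chart of the apartment of the hexagon $b_0w_0b_1w_1b_2m$ (resp. $b_0w_3b_3w_2b_2m$) in which the first, second and third coordinates are the single largest one on the rays of $w_0,m,w_1$ (resp. $w_3,m,w_2$), and the single smallest one on the rays of $b_2,b_1,b_0$ (resp. $b_2,b_3,b_0$). **Proposition.** $h^\phi$ is a harmonic $\phi$-map, and 1. the inverse image under $h^\phi$ of the singular set of $\mathcal B^\phi$ contains $\mathcal W_{\mathrm{bnr}}$; 2. the inverse image under $h^\phi$ of the singular set of $\mathcal B^\phi$ equals $\mathcal W^{\mathrm{ext}}_{\mathrm{bnr}}$. Moreover (1) and (2) hold for every harmonic $\phi$-map $h:X\to\mathcal B^\phi$ in place of $h^\phi$. -/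

import Mathlib

open Topology

noncomputable section

namespace BNR

/-! ## The spectral cover `p ^ 3 - 3 p + x = 0` of the complex line -/

/-- `p` lies over `x`: the point `(x, p)` belongs to the spectral curve. -/
def Over (x p : ℂ) : Prop := p ^ 3 - 3 * p + x = 0

/-- Points `x` over which the spectral polynomial has a multiple root. -/
def branchPoints : Set ℂ := {x | ∃ p, Over x p ∧ 3 * p ^ 2 - 3 = 0}

/-- `s` lists the three roots over `x`, with multiplicity. -/
def IsFibre (x : ℂ) (s : Fin 3 → ℂ) : Prop :=
  ∀ p : ℂ, p ^ 3 - 3 * p + x = (p - s 0) * (p - s 1) * (p - s 2)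

/-! ## The spectral network of phase `π / 2` -/

/-- A trajectory of phase `π / 2` with label `(p, q)`: a curve `γ` on `[0, T]` with two continuous
lifts `p`, `q` to the spectral curve which are distinct after time `0`, such that the 1-form
`(p - q) dx` takes values in `i ℝ_{>0}` on the velocity of `γ`. -/
structure IsTrajectory (γ p q : ℝ → ℂ) (T : ℝ) : Prop where
  pos : 0 < T
  cont : ContinuousOn γ (Set.Icc 0 T)
  cont_p : ContinuousOn p (Set.Icc 0 T)
  cont_q : ContinuousOn q (Set.Icc 0 T)
  over_p : ∀ t ∈ Set.Icc 0 T, Over (γ t) (p t)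
  over_q : ∀ t ∈ Set.Icc 0 T, Over (γ t) (q t)
  ne : ∀ t ∈ Set.Ioc 0 T, p t ≠ q t
  phase : ∀ t ∈ Set.Ioo 0 T, ∃ v : ℂ, ∃ m : ℝ,
    HasDerivAt γ v t ∧ 0 < m ∧ (p t - q t) * v = m * Complex.I

/-- `Supports x p q`: a line of the network with label `(p, q)` passes through `x`. Lines are
trajectories emitted by the branch points (where the two lifts come together) and, inductively,
`(p, q)`-trajectories emitted by a point at which a `(p, r)`-line and an `(r, q)`-line meet. -/
inductive Supports : ℂ → ℂ → ℂ → Prop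
  | primary (γ p q : ℝ → ℂ) (T : ℝ) (hγ : IsTrajectory γ p q T)
      (h0 : γ 0 ∈ branchPoints) (hpq : p 0 = q 0) :
      Supports (γ T) (p T) (q T)
  | collision (γ p q : ℝ → ℂ) (T : ℝ) (r : ℂ) (hγ : IsTrajectory γ p q T)
      (h1 : Supports (γ 0) (p 0) r) (h2 : Supports (γ 0) r (q 0)) :
      Supports (γ T) (p T) (q T)

/-- The spectral network: the branch points and all the lines. -/
def spectralNetwork : Set ℂ := branchPoints ∪ {x | ∃ p q, Supports x p q}

/-- Points where two lines of the network with composable labels meet. -/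
def collisionPoints : Set ℂ := {x | ∃ p r q, Supports x p r ∧ Supports x r q}

/-- The segments joining collision points. -/
def backwardCollisionLine : Set ℂ :=
  {x | ∃ c ∈ collisionPoints, ∃ c' ∈ collisionPoints, x ∈ segment ℝ c c'}

/-- The network together with the backward collision line. -/
def extendedNetwork : Set ℂ := spectralNetwork ∪ backwardCollisionLine

/-! ## Bipartite graphs and the free completion of the octagon -/

/-- A bipartite graph. -/
structure BipGraph where
  White : Type
  Black : Type
  Adj : White → Black → Prop

namespace BipGraph

/-- Exchange the two colours. -/
def swap (G : BipGraph) : BipGraph := ⟨G.Black, G.White, fun b w => G.Adj w b⟩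

/-- There is a path `a - l - c - m - b` of four edges between the white vertices `a` and `b` which
is not contained in a hexagon `a - l - c - m - b - n - a`. -/
def OpenChain (G : BipGraph) (a b : G.White) : Prop :=
  ∃ (c : G.White) (l m : G.Black), a ≠ b ∧ a ≠ c ∧ c ≠ b ∧ l ≠ m ∧
    G.Adj a l ∧ G.Adj c l ∧ G.Adj c m ∧ G.Adj b m ∧
    ¬ ∃ n : G.Black, n ≠ l ∧ n ≠ m ∧ G.Adj a n ∧ G.Adj b n

/-- The unordered pairs of white vertices which are the ends of such a path. -/
def OpenPair (G : BipGraph) : Type :=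
  {s : Sym2 G.White // ∃ a b, s = s(a, b) ∧ G.OpenChain a b}

/-- One completion step: for every pair of vertices joined by a path of four edges that lies in no
hexagon, glue in one new pair of edges, that is, one new vertex adjacent to the two ends. -/
def complete (G : BipGraph) : BipGraph where
  White := G.White ⊕ G.swap.OpenPair
  Black := G.Black ⊕ G.OpenPair
  Adj
    | .inl w, .inl b => G.Adj w b
    | .inl w, .inr s => w ∈ s.1
    | .inr s, .inl b => b ∈ s.1
    | .inr _, .inr _ => False

end BipGraph

/-- The octagon: `w_k` is adjacent to `b_k` and `b_{k+1}`, indices modulo `4`. -/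
def octagon : BipGraph := ⟨Fin 4, Fin 4, fun w b => b = w ∨ b = w + 1⟩

/-- The `n`-th stage of the completion of the octagon. -/
def stage : ℕ → BipGraph
  | 0 => octagon
  | n + 1 => (stage n).complete

/-- The white vertices that appear for the first time at stage `n`. -/
def NewWhite : ℕ → Type
  | 0 => octagon.White
  | n + 1 => (stage n).swap.OpenPair

/-- The black vertices that appear for the first time at stage `n`. -/
def NewBlack : ℕ → Type
  | 0 => octagon.Black
  | n + 1 => (stage n).OpenPair

/-- The white vertices of stage `n` as vertices of the union of all stages. -/
def embWhite : (n : ℕ) → (stage n).White → Σ k, NewWhite k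
  | 0, w => ⟨0, w⟩
  | n + 1, .inl w => embWhite n w
  | n + 1, .inr s => ⟨n + 1, s⟩

/-- The black vertices of stage `n` as vertices of the union of all stages. -/
def embBlack : (n : ℕ) → (stage n).Black → Σ k, NewBlack k
  | 0, b => ⟨0, b⟩
  | n + 1, .inl b => embBlack n b
  | n + 1, .inr s => ⟨n + 1, s⟩

/-- The spherical building `𝓑⁸`: the union of all the stages. -/
def B8 : BipGraph where
  White := Σ k, NewWhite k
  Black := Σ k, NewBlack k
  Adj w b := ∃ (n : ℕ) (w' : (stage n).White) (b' : (stage n).Black),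
    embWhite n w' = w ∧ embBlack n b' = b ∧ (stage n).Adj w' b'

/-! ## The cone over a bipartite graph, its apartments and its topology -/

/-- The standard apartment of type `A₂`: the plane `u 0 + u 1 + u 2 = 0`, whose walls are the lines
`u i - u j = const`. -/
abbrev Apt : Type := {u : EuclideanSpace ℝ (Fin 3) // u 0 + u 1 + u 2 = 0}

/-- The hexagons (cycles of six edges) of a bipartite graph: `white i` and `black j` are adjacent
for `i ≠ j`, so `white i` is opposite to `black i`. -/
structure Hexagon (G : BipGraph) where
  white : Fin 3 → G.White
  black : Fin 3 → G.Black
  white_inj : Function.Injective white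
  black_inj : Function.Injective black
  adj : ∀ i j, i ≠ j → G.Adj (white i) (black j)

/-- The cone over a bipartite graph, with one sector for every edge: its points are the formal
combinations of vertices with nonnegative coefficients, supported on a vertex or on an edge (or
zero, the apex). -/
@[ext] structure Cone (G : BipGraph) where
  white : G.White → ℝ
  black : G.Black → ℝ
  white_nonneg : ∀ w, 0 ≤ white w
  black_nonneg : ∀ b, 0 ≤ black b
  white_unique : ∀ w w', white w ≠ 0 → white w' ≠ 0 → w = w'
  black_unique : ∀ b b', black b ≠ 0 → black b' ≠ 0 → b = b'
  adj : ∀ w b, white w ≠ 0 → black b ≠ 0 → G.Adj w b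

/-- How much the coordinate `u i` exceeds the two other ones (zero if it is not the largest). -/
def topExcess (u : Fin 3 → ℝ) (i : Fin 3) : ℝ :=
  max 0 (min (u i - u (i + 1)) (u i - u (i + 2)))

/-- How far the coordinate `u j` is below the two other ones (zero if it is not the smallest). -/
def bottomExcess (u : Fin 3 → ℝ) (j : Fin 3) : ℝ :=
  max 0 (min (u (j + 1) - u j) (u (j + 2) - u j))

theorem topExcess_unique (u : Fin 3 → ℝ) (i i' : Fin 3) (h : topExcess u i ≠ 0)
    (h' : topExcess u i' ≠ 0) : i = i' := by
  unfold topExcess at h h'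
  have h1 := lt_of_le_of_ne (le_max_left _ _) h.symm
  have h2 := lt_of_le_of_ne (le_max_left _ _) h'.symm
  simp only [lt_max_iff, lt_self_iff_false, false_or, lt_min_iff] at h1 h2
  fin_cases i <;> fin_cases i' <;> simp at h1 h2 ⊢ <;> linarith [h1.1, h1.2, h2.1, h2.2]

theorem bottomExcess_unique (u : Fin 3 → ℝ) (i i' : Fin 3) (h : bottomExcess u i ≠ 0)
    (h' : bottomExcess u i' ≠ 0) : i = i' := by
  unfold bottomExcess at h h'
  have h1 := lt_of_le_of_ne (le_max_left _ _) h.symm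
  have h2 := lt_of_le_of_ne (le_max_left _ _) h'.symm
  simp only [lt_max_iff, lt_self_iff_false, false_or, lt_min_iff] at h1 h2
  fin_cases i <;> fin_cases i' <;> simp at h1 h2 ⊢ <;> linarith [h1.1, h1.2, h2.1, h2.2]

theorem top_ne_bottom (u : Fin 3 → ℝ) (i j : Fin 3) (h : topExcess u i ≠ 0)
    (h' : bottomExcess u j ≠ 0) : i ≠ j := by
  rintro rfl
  unfold topExcess at h
  unfold bottomExcess at h'
  have h1 := lt_of_le_of_ne (le_max_left _ _) h.symm
  have h2 := lt_of_le_of_ne (le_max_left _ _) h'.symm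
  simp only [lt_max_iff, lt_self_iff_false, false_or, lt_min_iff] at h1 h2
  linarith [h1.1, h2.1]

open Classical in
/-- The chart of the apartment given by a hexagon: the sector in which the `i`-th coordinate is the
largest and the `j`-th one the smallest goes to the sector of the edge `white i - black j`. The ray
on which the `i`-th coordinate is the largest and the two other ones agree goes to the ray of
`white i`, and similarly for `black j`. -/
def Hexagon.chart {G : BipGraph} (H : Hexagon G) (u : Apt) : Cone G where
  white w := ∑ i, if H.white i = w then topExcess u.1 i else 0
  black b := ∑ j, if H.black j = b then bottomExcess u.1 j else 0
  white_nonneg w := Finset.sum_nonneg fun i _ => by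
    split_ifs
    · exact le_max_left _ _
    · exact le_rfl
  black_nonneg b := Finset.sum_nonneg fun i _ => by
    split_ifs
    · exact le_max_left _ _
    · exact le_rfl
  white_unique w w' h h' := by
    obtain ⟨i, -, hi⟩ := Finset.exists_ne_zero_of_sum_ne_zero h
    obtain ⟨i', -, hi'⟩ := Finset.exists_ne_zero_of_sum_ne_zero h'
    simp only [ne_eq, ite_eq_right_iff, Classical.not_imp] at hi hi'
    rw [← hi.1, ← hi'.1, topExcess_unique u.1 i i' hi.2 hi'.2]
  black_unique b b' h h' := by
    obtain ⟨i, -, hi⟩ := Finset.exists_ne_zero_of_sum_ne_zero h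
    obtain ⟨i', -, hi'⟩ := Finset.exists_ne_zero_of_sum_ne_zero h'
    simp only [ne_eq, ite_eq_right_iff, Classical.not_imp] at hi hi'
    rw [← hi.1, ← hi'.1, bottomExcess_unique u.1 i i' hi.2 hi'.2]
  adj w b h h' := by
    obtain ⟨i, -, hi⟩ := Finset.exists_ne_zero_of_sum_ne_zero h
    obtain ⟨j, -, hj⟩ := Finset.exists_ne_zero_of_sum_ne_zero h'
    simp only [ne_eq, ite_eq_right_iff, Classical.not_imp] at hi hj
    rw [← hi.1, ← hj.1]
    exact H.adj i j (top_ne_bottom u.1 i j hi.2 hj.2)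

/-- The apartment given by a hexagon: the cone over it. -/
def Hexagon.apartment {G : BipGraph} (H : Hexagon G) : Set (Cone G) := Set.range H.chart

/-- The distance from `z` to `z'`, computed in an apartment that contains both, is below `ε`. -/
def Near {G : BipGraph} (ε : ℝ) (z z' : Cone G) : Prop :=
  ∃ (H : Hexagon G) (u u' : Apt), H.chart u = z ∧ H.chart u' = z' ∧ dist u u' < ε

/-- The topology given by the distance computed in apartments. -/
instance (G : BipGraph) : TopologicalSpace (Cone G) where
  IsOpen U := ∀ z ∈ U, ∃ ε > 0, ∀ z', Near ε z z' → z' ∈ U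
  isOpen_univ := fun _ _ => ⟨1, one_pos, fun _ _ => trivial⟩
  isOpen_inter := by
    rintro U V hU hV z ⟨hzU, hzV⟩
    obtain ⟨ε, hε, h⟩ := hU z hzU
    obtain ⟨δ, hδ, h'⟩ := hV z hzV
    refine ⟨min ε δ, lt_min hε hδ, ?_⟩
    rintro z' ⟨H, u, u', h1, h2, h3⟩
    exact ⟨h z' ⟨H, u, u', h1, h2, h3.trans_le (min_le_left _ _)⟩,
      h' z' ⟨H, u, u', h1, h2, h3.trans_le (min_le_right _ _)⟩⟩
  isOpen_sUnion := by
    rintro S hS z ⟨U, hU, hz⟩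
    obtain ⟨ε, hε, h⟩ := hS U hU z hz
    exact ⟨ε, hε, fun z' hz' => ⟨U, hU, h z' hz'⟩⟩

/-- The points no neighbourhood of which is contained in a single apartment. -/
def singularSet (G : BipGraph) : Set (Cone G) :=
  {z | ¬ ∃ (H : Hexagon G), ∃ U ∈ 𝓝 z, U ⊆ H.apartment}

/-- The building `𝓑^φ`. -/
abbrev UniversalBuilding : Type := Cone B8

/-! ## Harmonic `φ`-maps and the map `h^φ` -/

/-- A harmonic `φ`-map to the cone: a continuous map such that every point outside a closed discrete
set has a neighbourhood which is mapped to a single apartment, in whose coordinates the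
differential of the map is `(Re φ₀, Re φ₁, Re φ₂)`, where `φᵢ = sᵢ dx` for the three sections `sᵢ`
of the spectral cover over the neighbourhood. -/
def IsHarmonicPhiMap {G : BipGraph} (h : ℂ → Cone G) : Prop :=
  Continuous h ∧ ∃ N : Set ℂ, (∀ x, ∃ V ∈ 𝓝 x, (V ∩ N).Finite) ∧
    ∀ x ∉ N, ∃ U ∈ 𝓝 x, ∃ (H : Hexagon G) (g : ℂ → Apt) (s θ : Fin 3 → ℂ → ℂ),
      (∀ y ∈ U, h y = H.chart (g y)) ∧
      (∀ i, ContinuousOn (s i) U) ∧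
      (∀ y ∈ U, IsFibre y (fun i => s i y)) ∧
      (∀ i, ∀ y ∈ U, HasDerivAt (θ i) (s i y) y) ∧
      (∀ i, ∀ y ∈ U, (g y).1 i = (θ i y).re)

theorem exists_sheets (x : ℂ) :
    ∃ s : Fin 3 → ℂ, IsFibre x s ∧ (s 1).re ≤ (s 0).re ∧ (s 2).re ≤ (s 1).re := by
  obtain ⟨a, ha⟩ : ∃ a : ℂ, a ^ 3 - 3 * a + x = 0 := by
    have hd : (Polynomial.X ^ 3 - 3 * Polynomial.X + Polynomial.C x : Polynomial ℂ).degree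
        ≠ 0 := by
      have : (Polynomial.X ^ 3 - 3 * Polynomial.X + Polynomial.C x : Polynomial ℂ).degree
          = 3 := by
        have h3 : (3 : Polynomial ℂ) = Polynomial.C 3 := rfl
        rw [h3]
        compute_degree!
      rw [this]; decide
    obtain ⟨a, ha⟩ := IsAlgClosed.exists_root _ hd
    exact ⟨a, by simpa [Polynomial.IsRoot] using ha⟩
  obtain ⟨d, hd⟩ := IsAlgClosed.exists_pow_nat_eq (12 - 3 * a ^ 2) (n := 2) (by norm_num)
  have key : ∀ p : ℂ,
      p ^ 3 - 3 * p + x = (p - a) * (p - (-a + d) / 2) * (p - (-a - d) / 2) := by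
    intro p
    linear_combination ha + (p - a) / 4 * hd
  set b := (-a + d) / 2
  set c := (-a - d) / 2
  rcases le_total a.re b.re with h1 | h1 <;> rcases le_total b.re c.re with h2 | h2 <;>
    rcases le_total a.re c.re with h3 | h3
  · exact ⟨![c, b, a], fun p => by rw [key p]; simp only [Matrix.cons_val]; ring, by simpa using h2, by simpa using h1⟩
  · exact ⟨![c, b, a], fun p => by rw [key p]; simp only [Matrix.cons_val]; ring, by simpa using h2, by simpa using h1⟩
  · exact ⟨![b, c, a], fun p => by rw [key p]; simp only [Matrix.cons_val]; ring, by simpa using h2, by simpa using h3⟩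
  · exact ⟨![b, a, c], fun p => by rw [key p]; simp only [Matrix.cons_val]; ring, by simpa using h1, by simpa using h3⟩
  · exact ⟨![c, a, b], fun p => by rw [key p]; simp only [Matrix.cons_val]; ring, by simpa using h3, by simpa using h1⟩
  · exact ⟨![a, c, b], fun p => by rw [key p]; simp only [Matrix.cons_val]; ring, by simpa using h3, by simpa using h2⟩
  · exact ⟨![a, b, c], fun p => by rw [key p]; simp only [Matrix.cons_val], by simpa using h1, by simpa using h2⟩
  · exact ⟨![a, b, c], fun p => by rw [key p]; simp only [Matrix.cons_val], by simpa using h1, by simpa using h2⟩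

/-- The three roots over `x`, by decreasing real part. Two roots have the same real part only if `x`
is real with `|x| ≥ 2`, so these are three sections of the spectral cover over each of the two open
half planes. -/
def sheet (x : ℂ) : Fin 3 → ℂ := (exists_sheets x).choose

/-- The primitive `∫ p dx` of the tautological form on the spectral curve, `x = 3 p - p ^ 3`, that
has mean value zero on the fibres; its real part vanishes over the collision points. -/
def primitive (p : ℂ) : ℂ := 3 / 2 * p ^ 2 - 3 / 4 * p ^ 4 + 3 / 2

theorem primitive_sheet_sum (x : ℂ) :
    primitive (sheet x 0) + primitive (sheet x 1) + primitive (sheet x 2) = 0 := by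
  have h : IsFibre x (sheet x) := (exists_sheets x).choose_spec.1
  generalize sheet x = s at h
  unfold IsFibre at h
  have h0 := h 0
  have h1 := h 1
  have h2 := h (-1)
  have e1 : s 0 + s 1 + s 2 = 0 := by linear_combination (h1 + h2 - 2 * h0) / 2
  have e2 : s 0 * s 1 + s 0 * s 2 + s 1 * s 2 = -3 := by linear_combination (h2 - h1) / 2
  have e : s 2 = -s 0 - s 1 := by linear_combination e1
  rw [e] at e2 ⊢
  unfold primitive
  linear_combination
    (-3 / 2 * (-(s 0) ^ 2 - s 0 * s 1 - (s 1) ^ 2) + 3 / 2) * e2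

/-- The developing map `x ↦ (Re ∫ φ₀, Re ∫ φ₁, Re ∫ φ₂)`, based at the collision point, on each of
the two closed half planes. -/
def develop (x : ℂ) : Apt :=
  ⟨!₂[(primitive (sheet x 0)).re, (primitive (sheet x 1)).re, (primitive (sheet x 2)).re], by
    simpa using congrArg Complex.re (primitive_sheet_sum x)⟩

/-- The vertex of the octagon with the given colour and index. -/
def octWhite (k : Fin 4) : B8.White := ⟨0, k⟩

/-- The vertex of the octagon with the given colour and index. -/
def octBlack (k : Fin 4) : B8.Black := ⟨0, k⟩

theorem openChain_octagon : octagon.swap.OpenChain (0 : Fin 4) (2 : Fin 4) := by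
  refine ⟨(1 : Fin 4), (0 : Fin 4), (1 : Fin 4), ?_⟩
  simp only [octagon, BipGraph.swap]
  decide

/-- The vertex added at the first step between the opposite black vertices `b_0`, `b_2` of the
octagon. The two new edges complete the upper path `b_0 w_0 b_1 w_1 b_2` and the lower path
`b_0 w_3 b_3 w_2 b_2` of the octagon to two hexagons. -/
def middle : B8.White := ⟨1, ⟨s((0 : Fin 4), (2 : Fin 4)), _, _, rfl, openChain_octagon⟩⟩

theorem octAdj (w b : Fin 4) (h : b = w ∨ b = w + 1) : B8.Adj (octWhite w) (octBlack b) :=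
  ⟨0, w, b, rfl, rfl, h⟩

theorem middleAdj (b : Fin 4) (h : b = 0 ∨ b = 2) : B8.Adj middle (octBlack b) :=
  ⟨1, .inr ⟨s((0 : Fin 4), (2 : Fin 4)), _, _, rfl, openChain_octagon⟩, .inl b, rfl, rfl,
    Sym2.mem_iff.mpr h⟩

theorem octWhite_inj {k l : Fin 4} (h : octWhite k = octWhite l) : k = l := by
  exact @sigma_mk_injective ℕ NewWhite 0 k l h

theorem octBlack_inj {k l : Fin 4} (h : octBlack k = octBlack l) : k = l := by
  exact @sigma_mk_injective ℕ NewBlack 0 k l h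

theorem octWhite_ne_middle (k : Fin 4) : octWhite k ≠ middle := by
  intro h
  have := congrArg Sigma.fst h
  simp [octWhite, middle] at this

/-- The hexagon `b_2 - m - b_0 - w - b - w' - b_2`. -/
def mkHexagon (w w' b : Fin 4) (h : w ≠ w') (hb0 : b ≠ 0) (hb2 : b ≠ 2)
    (h0 : (0 : Fin 4) = w ∨ (0 : Fin 4) = w + 1) (h1 : b = w ∨ b = w + 1)
    (h2 : b = w' ∨ b = w' + 1) (h3 : (2 : Fin 4) = w' ∨ (2 : Fin 4) = w' + 1) : Hexagon B8 where
  white := ![octWhite w, middle, octWhite w']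
  black := ![octBlack 2, octBlack b, octBlack 0]
  white_inj := by
    intro i j hij
    fin_cases i <;> fin_cases j <;> simp at hij ⊢
    · exact octWhite_ne_middle _ hij
    · exact h (octWhite_inj hij)
    · exact octWhite_ne_middle _ hij.symm
    · exact octWhite_ne_middle _ hij.symm
    · exact h (octWhite_inj hij).symm
    · exact octWhite_ne_middle _ hij
  black_inj := by
    intro i j hij
    fin_cases i <;> fin_cases j <;> simp at hij ⊢
    · exact hb2 (octBlack_inj hij).symm
    · exact absurd (octBlack_inj hij) (by decide)
    · exact hb2 (octBlack_inj hij)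
    · exact hb0 (octBlack_inj hij)
    · exact absurd (octBlack_inj hij) (by decide)
    · exact hb0 (octBlack_inj hij).symm
  adj := by
    intro i j hij
    fin_cases i <;> fin_cases j <;> simp at hij ⊢
    · exact octAdj _ _ h1
    · exact octAdj _ _ h0
    · exact middleAdj _ (Or.inr rfl)
    · exact middleAdj _ (Or.inl rfl)
    · exact octAdj _ _ h3
    · exact octAdj _ _ h2

/-- The hexagon completing the upper half `b_0 w_0 b_1 w_1 b_2` of the octagon. -/
def upperHexagon : Hexagon B8 :=
  mkHexagon 0 1 1 (by decide) (by decide) (by decide) (by decide) (by decide) (by decide)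
    (by decide)

/-- The hexagon completing the lower half `b_0 w_3 b_3 w_2 b_2` of the octagon. -/
def lowerHexagon : Hexagon B8 :=
  mkHexagon 3 2 3 (by decide) (by decide) (by decide) (by decide) (by decide) (by decide)
    (by decide)

/-- The map `h^φ`: the upper and the lower half plane are developed into the upper and the lower
apartment. These are glued along the two sectors of the edges at `middle`, which receive the two
halves of the inner region of the network; the eight outer regions go to the eight sectors of the
octagon. -/
def universalMap (x : ℂ) : UniversalBuilding :=
  if 0 ≤ x.im then upperHexagon.chart (develop x) else lowerHexagon.chart (develop x)

end BNR

end

namespace BNR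

/-! ## Fibres of the spectral cover -/

section Fibre

variable {x : ℂ} {s s' : Fin 3 → ℂ}

/-! Write P for `primitive`, and call x a tie if Re P takes the same value on two of the three
sheets over x (`IsTie`). The extended network and the preimage of the singular set are both shown to
be the set of ties; the first claim then follows because the network is part of the extended
network.

Network side. For the roots p, q, r over x one has P(p) - P(q) = r (p - q)^3 / 4, and along a (p,
q)-trajectory this difference moves vertically upwards in the complex plane. It is zero at branch
points and additive at collisions, so every line consists of ties. Conversely, in the coordinate v =
4 - r^2 a tie means that v^4 - 4 v^3 is real and nonnegative. This locus splits into explicit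
branches (`level_cases`). Those with r not imaginary can be traversed from v = 0, a branch point
(`supports_primary`). If r is imaginary, so is x: beyond the collision points x lies on a line
emitted by one of them (`supports_secondary`), and between them on the backward collision line.

Building side. With white vertices as points and black vertices as lines, `B8` is a projective
plane: it has no squares, any two vertices of one colour have a common neighbour, and there are
quadrangles. Hence every vertex has at least three neighbours, whereas an apartment contains only
two sectors at a vertex. So the singular points are those not interior to a sector, that is, those
of white or black mass zero (`mem_singularSet_iff`). In apartment coordinates this says that two
coordinates coincide.

Harmonic maps. Locally the coordinates of h are Re P on the three sheets plus constants. The masses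
of h, which do not depend on the apartment, determine these constants (`Develops.unique`), so they
form a locally constant function on the spectral curve minus a countable set. The curve is a plane
with coordinate p, so this complement is connected; the constants are all equal, and since they sum
to zero they vanish. Thus every harmonic map has the masses of `develop`
(`IsHarmonicPhiMap.mass_eq`), and its singular preimage is the tie set.

Harmonicity of `universalMap` needs an argument only on the real axis. Between the branch points the
image is near the ray of the middle vertex, which both apartments contain. On the two outer rays a
third apartment contains the sectors met on either side. -/

theorem IsFibre.sum (h : IsFibre x s) : s 0 + s 1 + s 2 = 0 := by
  linear_combination (h 1 + h (-1) - 2 * h 0) / 2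

theorem IsFibre.pairs (h : IsFibre x s) : s 0 * s 1 + s 0 * s 2 + s 1 * s 2 = -3 := by
  linear_combination (h (-1) - h 1) / 2

theorem IsFibre.prod (h : IsFibre x s) : s 0 * s 1 * s 2 = -x := by
  linear_combination h 0

theorem isFibre_of_symm (h1 : s 0 + s 1 + s 2 = 0)
    (h2 : s 0 * s 1 + s 0 * s 2 + s 1 * s 2 = -3) (h3 : s 0 * s 1 * s 2 = -x) : IsFibre x s :=
  fun p => by linear_combination p ^ 2 * h1 - p * h2 + h3

theorem IsFibre.over (h : IsFibre x s) (i : Fin 3) : Over x (s i) := by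
  unfold Over
  rw [h (s i)]
  fin_cases i <;> simp

theorem IsFibre.exists_eq (h : IsFibre x s) {p : ℂ} (hp : Over x p) : ∃ i, s i = p := by
  unfold Over at hp
  rw [h p] at hp
  rcases mul_eq_zero.1 hp with hp | hp
  · rcases mul_eq_zero.1 hp with hp | hp
    · exact ⟨0, (sub_eq_zero.1 hp).symm⟩
    · exact ⟨1, (sub_eq_zero.1 hp).symm⟩
  · exact ⟨2, (sub_eq_zero.1 hp).symm⟩

theorem isFibre_iff_prod : IsFibre x s ↔ ∀ p : ℂ, p ^ 3 - 3 * p + x = ∏ i, (p - s i) := by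
  simp only [IsFibre, Fin.prod_univ_three]

theorem IsFibre.comp_perm (h : IsFibre x s) (π : Equiv.Perm (Fin 3)) :
    IsFibre x (fun i => s (π i)) := by
  rw [isFibre_iff_prod] at h ⊢
  intro p
  rw [h p, Equiv.prod_comp π (fun i => p - s i)]

/-- Once one root is matched, the other two are determined up to order by their sum and product; a
transposition moves the matched root to position 0. -/
theorem IsFibre.exists_perm (h : IsFibre x s) (h' : IsFibre x s') :
    ∃ π : Equiv.Perm (Fin 3), ∀ i, s' i = s (π i) := by
  have aux : ∀ t : Fin 3 → ℂ, IsFibre x t → t 0 = s' 0 →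
      ∃ π : Equiv.Perm (Fin 3), ∀ i, s' i = t (π i) := by
    intro t ht h0
    have e : (s' 1 - t 1) * (s' 1 - t 2) = 0 := by
      have e1 := ht.sum
      have e2 := ht.pairs
      have e3 := h'.sum
      have e4 := h'.pairs
      rw [h0] at e1 e2
      linear_combination e2 - e4 + (s' 1 + s' 0) * (e3 - e1) - (s' 0) * (e3 - e1)  - s' 0 * e1 + s' 0 * e3
    rcases mul_eq_zero.1 e with e | e
    · refine ⟨1, fun i => ?_⟩
      fin_cases i
      · exact h0.symm
      · exact sub_eq_zero.1 e
      · change s' 2 = t 2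
        linear_combination h'.sum - ht.sum + h0 - e
    · refine ⟨Equiv.swap 1 2, fun i => ?_⟩
      fin_cases i
      · exact h0.symm
      · exact sub_eq_zero.1 e
      · change s' 2 = t 1
        linear_combination h'.sum - ht.sum + h0 - e
  obtain ⟨k, hk⟩ := h.exists_eq (h'.over 0)
  obtain ⟨π, hπ⟩ := aux _ (h.comp_perm (Equiv.swap 0 k)) (by simpa using hk)
  exact ⟨π.trans (Equiv.swap 0 k), hπ⟩

theorem IsFibre.injective (h : IsFibre x s) (hx : x ∉ branchPoints) : Function.Injective s := by
  have aux : ∀ t : Fin 3 → ℂ, IsFibre x t → t 0 ≠ t 1 := by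
    intro t ht h01
    refine hx ⟨t 0, ht.over 0, ?_⟩
    have e1 := ht.sum
    have e2 := ht.pairs
    rw [← h01] at e1 e2
    linear_combination -e2 + 2 * t 0 * e1
  intro i j hij
  by_contra hne
  obtain ⟨π, h0, h1⟩ : ∃ π : Equiv.Perm (Fin 3), π 0 = i ∧ π 1 = j := by
    revert hne; clear hij; revert i j; decide
  exact aux _ (h.comp_perm π) (by simpa [h0, h1] using hij)

/-- The basic identity: the real part of P can be compared on two sheets using only the third root r
and the difference p - q, whose square is again a function of r by `sq_sub_roots`. -/
theorem primitive_sub {p q r : ℂ} (h1 : p + q + r = 0) (h2 : p * q + p * r + q * r = -3) :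
    primitive p - primitive q = r * (p - q) ^ 3 / 4 := by
  have hr : r = -p - q := by linear_combination h1
  subst hr
  unfold primitive
  linear_combination (p ^ 2 - q ^ 2) / 2 * h2

theorem sq_sub_roots {p q r : ℂ} (h1 : p + q + r = 0) (h2 : p * q + p * r + q * r = -3) :
    (p - q) ^ 2 = 12 - 3 * r ^ 2 := by
  have hr : r = -p - q := by linear_combination h1
  subst hr
  linear_combination -4 * h2

theorem primitive_sum {p q r : ℂ} (h1 : p + q + r = 0) (h2 : p * q + p * r + q * r = -3) :
    primitive p + primitive q + primitive r = 0 := by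
  have hr : r = -p - q := by linear_combination h1
  subst hr
  unfold primitive
  linear_combination (-3 / 2 * (-p ^ 2 - p * q - q ^ 2) + 3 / 2) * h2

theorem IsFibre.primitive_sum (h : IsFibre x s) : ∑ i, primitive (s i) = 0 := by
  rw [Fin.sum_univ_three]
  exact BNR.primitive_sum h.sum h.pairs

theorem exists_third {p q : ℂ} (hp : Over x p) (hq : Over x q) (hne : p ≠ q) :
    p + q + (-(p + q)) = 0 ∧ p * q + p * (-(p + q)) + q * (-(p + q)) = -3 ∧
      IsFibre x ![p, q, -(p + q)] := by
  unfold Over at hp hq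
  have h2 : p * q + p * (-(p + q)) + q * (-(p + q)) = -3 := by
    have : (p - q) * (p * q + p * (-(p + q)) + q * (-(p + q)) + 3) = 0 := by
      linear_combination hq - hp
    rcases mul_eq_zero.1 this with h | h
    · exact absurd (sub_eq_zero.1 h) hne
    · linear_combination h
  refine ⟨by ring, h2, isFibre_of_symm (by simp) (by simpa using h2) ?_⟩
  simp only [Matrix.cons_val]
  linear_combination p * h2 + hp

theorem isFibre_sheet (x : ℂ) : IsFibre x (sheet x) := (exists_sheets x).choose_spec.1

theorem sheet_re_anti (x : ℂ) : (sheet x 1).re ≤ (sheet x 0).re ∧ (sheet x 2).re ≤ (sheet x 1).re :=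
  (exists_sheets x).choose_spec.2

theorem branchPoints_eq : branchPoints = {2, -2} := by
  ext x
  constructor
  · rintro ⟨p, hp, h⟩
    have h1 : (p - 1) * (p + 1) = 0 := by linear_combination h / 3
    unfold Over at hp
    rcases mul_eq_zero.1 h1 with h1 | h1
    · obtain rfl : p = 1 := by linear_combination h1
      left; linear_combination hp
    · obtain rfl : p = -1 := by linear_combination h1
      right; change x = -2; linear_combination hp
  · rintro (rfl | h)
    · exact ⟨1, by unfold Over; norm_num, by norm_num⟩
    · obtain rfl : x = -2 := h
      exact ⟨-1, by unfold Over; norm_num, by norm_num⟩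

end Fibre

/-! ## The primitive along a lift to the spectral curve -/

/-- The primitive of the tautological form has the expected derivative along any continuous lift of
a differentiable curve, even where the lift passes through a ramification point. -/
theorem hasDerivAt_primitive {𝕜 : Type*} [NontriviallyNormedField 𝕜] [NormedAlgebra 𝕜 ℂ]
    {f p : 𝕜 → ℂ} {v : ℂ} {t : 𝕜} (hf : HasDerivAt f v t) (hp : ContinuousAt p t)
    (hover : ∀ᶠ τ in 𝓝 t, Over (f τ) (p τ)) :
    HasDerivAt (fun τ => primitive (p τ)) (p t * v) t := by
  -- With ε the increment of p, the left side is the error of the linear approximation of P and the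
  -- cofactor of `G ε` is the increment of x. So G is their quotient, and it has to tend to zero.
  obtain ⟨G, hG, hGe⟩ : ∃ G : ℂ → ℂ, Filter.Tendsto G (𝓝 0) (𝓝 0) ∧ ∀ᶠ ε in 𝓝 (0 : ℂ),
      ε ^ 2 * ((3 - 3 * p t ^ 2) / 2 - 2 * p t * ε - 3 / 4 * ε ^ 2) =
        G ε * (ε * ((3 - 3 * p t ^ 2) - 3 * p t * ε - ε ^ 2)) := by
    by_cases hA : 3 - 3 * p t ^ 2 = 0
    · have hp0 : 3 * p t ≠ 0 := by
        intro h0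
        have : p t = 0 := by linear_combination h0 / 3
        rw [this] at hA
        norm_num at hA
      refine ⟨fun ε => ε * (2 * p t + 3 / 4 * ε) / (3 * p t + ε), ?_, ?_⟩
      · have : ContinuousAt (fun ε : ℂ => ε * (2 * p t + 3 / 4 * ε) / (3 * p t + ε)) 0 :=
          ContinuousAt.div (by fun_prop) (by fun_prop) (by simpa using hp0)
        simpa [ContinuousAt] using this
      · have : ∀ᶠ ε in 𝓝 (0 : ℂ), 3 * p t + ε ≠ 0 :=
          ContinuousAt.eventually_ne (by fun_prop) (by simpa using hp0)
        filter_upwards [this] with ε hε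
        rw [hA, eq_comm, div_mul_eq_mul_div, div_eq_iff hε]
        ring
    · refine ⟨fun ε => ε * ((3 - 3 * p t ^ 2) / 2 - 2 * p t * ε - 3 / 4 * ε ^ 2) /
        ((3 - 3 * p t ^ 2) - 3 * p t * ε - ε ^ 2), ?_, ?_⟩
      · have : ContinuousAt (fun ε : ℂ => ε * ((3 - 3 * p t ^ 2) / 2 - 2 * p t * ε - 3 / 4 * ε ^ 2) /
          ((3 - 3 * p t ^ 2) - 3 * p t * ε - ε ^ 2)) 0 :=
          ContinuousAt.div (by fun_prop) (by fun_prop) (by simpa using hA)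
        simpa [ContinuousAt] using this
      · have : ∀ᶠ ε in 𝓝 (0 : ℂ), (3 - 3 * p t ^ 2) - 3 * p t * ε - ε ^ 2 ≠ 0 :=
          ContinuousAt.eventually_ne (by fun_prop) (by simpa using hA)
        filter_upwards [this] with ε hε
        rw [eq_comm, div_mul_eq_mul_div, div_eq_iff hε]
        ring
  have hε : Filter.Tendsto (fun τ => p τ - p t) (𝓝 t) (𝓝 0) := by
    simpa using Filter.Tendsto.sub_const hp (p t)
  have h0 : Over (f t) (p t) := hover.self_of_nhds
  have key : ∀ᶠ τ in 𝓝 t, primitive (p τ) - primitive (p t) - p t * (f τ - f t) =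
      G (p τ - p t) * (f τ - f t) := by
    filter_upwards [hover, hε.eventually hGe] with τ h1 h2
    unfold Over at h0 h1
    have e : f τ - f t =
        (p τ - p t) * ((3 - 3 * p t ^ 2) - 3 * p t * (p τ - p t) - (p τ - p t) ^ 2) := by
      linear_combination h1 - h0
    rw [e, ← h2]
    unfold primitive
    ring
  have ho : (fun τ => primitive (p τ) - primitive (p t) - p t * (f τ - f t)) =o[𝓝 t]
      fun τ => τ - t := by
    have h1 : (fun τ => G (p τ - p t)) =o[𝓝 t] fun _ => (1 : ℝ) :=
      (Asymptotics.isLittleO_one_iff ℝ).2 (hG.comp hε)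
    have h2 : (fun τ => f τ - f t) =O[𝓝 t] fun τ => τ - t := hf.isBigO_sub
    have h3 := h1.mul_isBigO h2.norm_right
    simp only [one_mul] at h3
    exact (h3.of_norm_right).congr' (key.mono fun _ h => h.symm) Filter.EventuallyEq.rfl
  have hl := hf.const_mul (p t)
  rw [hasDerivAt_iff_isLittleO] at hl ⊢
  refine (ho.add hl).congr' (Filter.Eventually.of_forall fun τ => ?_) Filter.EventuallyEq.rfl
  simp only
  ring

/-! ## Lines of the network lie on the level curves of the primitive -/

/-- The derivative of P(p) - P(q) along the curve is (p - q) γ', a positive multiple of i; the mean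
value theorem applies to the real and imaginary parts, with only continuity needed at the ends. -/
theorem IsTrajectory.primitive_diff {γ p q : ℝ → ℂ} {T : ℝ} (h : IsTrajectory γ p q T) :
    (primitive (p T) - primitive (q T)).re = (primitive (p 0) - primitive (q 0)).re ∧
    (primitive (p 0) - primitive (q 0)).im < (primitive (p T) - primitive (q T)).im := by
  have hd : ∀ t ∈ Set.Ioo 0 T, ∃ m : ℝ, 0 < m ∧
      HasDerivAt (fun t => primitive (p t) - primitive (q t)) (m * Complex.I) t := by
    intro t ht
    obtain ⟨v, m, hv, hm, e⟩ := h.phase t ht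
    have hn : Set.Icc 0 T ∈ 𝓝 t := Icc_mem_nhds ht.1 ht.2
    have h1 := hasDerivAt_primitive hv (h.cont_p.continuousAt hn)
      (Filter.mem_of_superset hn h.over_p)
    have h2 := hasDerivAt_primitive hv (h.cont_q.continuousAt hn)
      (Filter.mem_of_superset hn h.over_q)
    refine ⟨m, hm, ?_⟩
    rw [← e, sub_mul]
    exact h1.fun_sub h2
  have hc : ContinuousOn (fun t => primitive (p t) - primitive (q t)) (Set.Icc 0 T) := by
    have := h.cont_p
    have := h.cont_q
    unfold primitive
    fun_prop
  constructor
  · obtain ⟨t, ht, e⟩ := exists_deriv_eq_slope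
      (fun t => (primitive (p t) - primitive (q t)).re) h.pos
      (Complex.continuous_re.comp_continuousOn hc) (fun t ht => by
        obtain ⟨m, -, hm⟩ := hd t ht
        exact ((Complex.reCLM.hasFDerivAt.comp_hasDerivAt t hm)).differentiableAt.differentiableWithinAt)
    obtain ⟨m, -, hm⟩ := hd t ht
    erw [((Complex.reCLM.hasFDerivAt.comp_hasDerivAt t hm)).deriv, eq_div_iff (by linarith [h.pos])] at e
    simp at e
    simp only [Complex.sub_re]
    linarith
  · obtain ⟨t, ht, e⟩ := exists_deriv_eq_slope
      (fun t => (primitive (p t) - primitive (q t)).im) h.pos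
      (Complex.continuous_im.comp_continuousOn hc) (fun t ht => by
        obtain ⟨m, -, hm⟩ := hd t ht
        exact ((Complex.imCLM.hasFDerivAt.comp_hasDerivAt t hm)).differentiableAt.differentiableWithinAt)
    obtain ⟨m, hm0, hm⟩ := hd t ht
    erw [((Complex.imCLM.hasFDerivAt.comp_hasDerivAt t hm)).deriv, eq_div_iff (by linarith [h.pos])] at e
    have := mul_pos hm0 h.pos
    simp at e
    simp only [Complex.sub_im]
    linarith

/-- The difference P(p) - P(q) starts at zero on a primary line, and on a secondary one at the sum
of the differences of the two colliding lines. The strict inequality of imaginary parts also records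
that the two roots are distinct. -/
theorem Supports.primitive_diff {x p q : ℂ} (h : Supports x p q) :
    Over x p ∧ Over x q ∧ (primitive p).re = (primitive q).re ∧
      (primitive q).im < (primitive p).im := by
  induction h with
  | primary γ p q T hγ h0 hpq =>
    have hT := Set.right_mem_Icc.2 hγ.pos.le
    obtain ⟨h1, h2⟩ := hγ.primitive_diff
    refine ⟨hγ.over_p T hT, hγ.over_q T hT, ?_, ?_⟩ <;> simp [hpq] at h1 h2 <;> linarith
  | collision γ p q T r hγ _ _ ih1 ih2 =>
    have hT := Set.right_mem_Icc.2 hγ.pos.le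
    obtain ⟨h1, h2⟩ := hγ.primitive_diff
    simp only [Complex.sub_re, Complex.sub_im] at h1 h2
    refine ⟨hγ.over_p T hT, hγ.over_q T hT, ?_, ?_⟩
    · linarith [ih1.2.2.1, ih2.2.2.1]
    · linarith [ih1.2.2.2, ih2.2.2.2]

/-! ## Construction of trajectories -/

theorem re_eq_zero_of_sq_neg {z : ℂ} {a : ℝ} (h : z ^ 2 = a) (ha : a < 0) : z.re = 0 ∧ z.im ≠ 0 := by
  have h1 := congrArg Complex.re h
  have h2 := congrArg Complex.im h
  simp only [pow_two, Complex.mul_re, Complex.mul_im, Complex.ofReal_re, Complex.ofReal_im] at h1 h2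
  have him : z.im ≠ 0 := by
    intro h0
    rw [h0] at h1
    nlinarith [mul_self_nonneg z.re]
  refine ⟨?_, him⟩
  have : z.re * z.im = 0 := by linarith
  exact (mul_eq_zero.1 this).resolve_right him

theorem im_eq_zero_of_sq_pos {z : ℂ} {a : ℝ} (h : z ^ 2 = a) (ha : 0 < a) : z.im = 0 ∧ z.re ≠ 0 := by
  have h1 := congrArg Complex.re h
  have h2 := congrArg Complex.im h
  simp only [pow_two, Complex.mul_re, Complex.mul_im, Complex.ofReal_re, Complex.ofReal_im] at h1 h2
  have hre : z.re ≠ 0 := by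
    intro h0
    rw [h0] at h1
    nlinarith [mul_self_nonneg z.im]
  refine ⟨?_, hre⟩
  have : z.re * z.im = 0 := by linarith
  exact (mul_eq_zero.1 this).resolve_left hre

/-- A square root along a path which stays in an open half plane, with prescribed final value. -/
theorem exists_sqrt_lift {z : ℝ → ℂ} {T : ℝ} (hT : 0 < T) (k : ℂ)
    (hc : ContinuousOn z (Set.Icc 0 T)) (hd : ∀ t ∈ Set.Ioo 0 T, DifferentiableAt ℝ z t)
    (hpos : ∀ t ∈ Set.Ioc 0 T, 0 < (k * z t).re) (h0 : 0 ≤ (k * z 0).re) {ω : ℂ}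
    (hω : ω ^ 2 = z T) :
    ∃ ζ : ℝ → ℂ, ContinuousOn ζ (Set.Icc 0 T) ∧ (∀ t ∈ Set.Ioo 0 T, DifferentiableAt ℝ ζ t) ∧
      (∀ t, ζ t ^ 2 = z t) ∧ ζ T = ω := by
  have hsq : ∀ a : ℂ, Complex.sqrt a ^ 2 = a := fun a => by
    have := Complex.cpow_nat_inv_pow a (n := 2) two_ne_zero
    simpa only [Complex.sqrt, Nat.cast_ofNat] using this
  have hTne : k * z T ≠ 0 := by
    intro h
    have := hpos T ⟨hT, le_rfl⟩
    rw [h] at this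
    simp at this
  have hsne : Complex.sqrt (k * z T) ≠ 0 := by
    intro h
    apply hTne
    rw [← hsq (k * z T), h]
    simp
  -- Multiplication by k moves the path to the right half plane, where the principal root is
  -- regular; the constant factor restores the square and fixes the final value.
  refine ⟨fun t => ω * Complex.sqrt (k * z t) / Complex.sqrt (k * z T), ?_, ?_, ?_, ?_⟩
  · have : ContinuousOn (fun t => Complex.sqrt (k * z t)) (Set.Icc 0 T) := by
      intro t ht
      have hre : 0 ≤ (k * z t).re := by
        rcases ht.1.eq_or_lt with h | h
        · rw [← h]; exact h0
        · exact (hpos t ⟨h, ht.2⟩).le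
      have h1 : ContinuousWithinAt (fun t => k * z t) (Set.Icc 0 T) t :=
        continuousWithinAt_const.mul (hc t ht)
      exact ContinuousAt.comp_continuousWithinAt (f := fun t => k * z t) (g := Complex.sqrt)
        (Complex.continuousAt_sqrt (Or.inl hre)) h1
    fun_prop
  · intro t ht
    have h1 : DifferentiableAt ℝ (fun t => k * z t) t := (hd t ht).const_mul k
    have h2 : DifferentiableAt ℝ Complex.sqrt (k * z t) :=
      (Complex.differentiableAt_sqrt (Or.inl (hpos t ⟨ht.1, ht.2.le⟩))).restrictScalars ℝ
    have h3 := h2.fun_comp' t h1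
    exact (h3.const_mul ω).div_const _
  · intro t
    rw [div_pow, mul_pow, hsq, hsq, hω]
    have hk : k ≠ 0 := left_ne_zero_of_mul hTne
    have hz : z T ≠ 0 := right_ne_zero_of_mul hTne
    field_simp
  · simp only
    rw [mul_div_assoc, div_self hsne, mul_one]

/-- A path in the coordinate `v = 4 - r²`, where `r` is the root which does not belong to the label,
along which `v⁴ - 4 v³` is real and increasing, lifts to a trajectory. -/
theorem exists_trajectory {V : ℝ → ℂ} {S S' : ℝ → ℝ} {T : ℝ} (hT : 0 < T) (k₁ k₂ : ℂ)
    (hVc : ContinuousOn V (Set.Icc 0 T)) (hVd : ∀ t ∈ Set.Ioo 0 T, DifferentiableAt ℝ V t)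
    (hS : ∀ t ∈ Set.Icc 0 T, V t ^ 4 - 4 * V t ^ 3 = S t)
    (hS' : ∀ t ∈ Set.Ioo 0 T, HasDerivAt S (S' t) t ∧ 0 < S' t)
    (hSpos : ∀ t ∈ Set.Ioc 0 T, 0 < S t)
    (h₁ : ∀ t ∈ Set.Icc 0 T, 0 < (k₁ * (4 - V t)).re)
    (h₂ : ∀ t ∈ Set.Ioc 0 T, 0 < (k₂ * (3 * V t)).re) (h₂' : 0 ≤ (k₂ * (3 * V 0)).re)
    {r δ : ℂ} (hr : r ^ 2 = 4 - V T) (hδ : δ ^ 2 = 3 * V T) {w : ℝ} (hw : 0 < w)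
    (hrδ : r * δ ^ 3 = 4 * w * Complex.I) :
    ∃ γ p q : ℝ → ℂ, IsTrajectory γ p q T ∧ γ T = 3 * r - r ^ 3 ∧ p T = (-r + δ) / 2 ∧
      q T = (-r - δ) / 2 ∧ ∃ R Δ : ℂ, R ^ 2 = 4 - V 0 ∧ Δ ^ 2 = 3 * V 0 ∧ γ 0 = 3 * R - R ^ 3 ∧
        p 0 = (-R + Δ) / 2 ∧ q 0 = (-R - Δ) / 2 ∧
        (0 < S 0 → ∃ w' : ℝ, 0 < w' ∧ R * Δ ^ 3 = 4 * w' * Complex.I) := by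
  obtain ⟨R, hRc, hRd, hR, hRT⟩ := exists_sqrt_lift (z := fun t => 4 - V t) hT k₁ (by fun_prop)
    (fun t ht => (hVd t ht).const_sub 4) (fun t ht => h₁ t ⟨ht.1.le, ht.2⟩)
    (h₁ 0 ⟨le_rfl, hT.le⟩).le hr
  obtain ⟨Δ, hΔc, hΔd, hΔ, hΔT⟩ := exists_sqrt_lift (z := fun t => 3 * V t) hT k₂ (by fun_prop)
    (fun t ht => (hVd t ht).const_mul 3) h₂ h₂' hδ
  -- Here R Δ^3 = 4 (P(p) - P(q)), and its square is (4 - v)(3v)^3 = -27 (v^4 - 4 v^3).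
  have hZsq : ∀ t ∈ Set.Icc 0 T, (R t * Δ t ^ 3) ^ 2 = ((-27 * S t : ℝ) : ℂ) := by
    intro t ht
    have : (R t * Δ t ^ 3) ^ 2 = R t ^ 2 * (Δ t ^ 2) ^ 3 := by ring
    push_cast
    rw [this, hR, hΔ, ← hS t ht]
    ring
  -- R Δ^3 is imaginary and does not vanish from t up to T, so its imaginary part keeps the sign
  -- that it has at T.
  have hsign : ∀ t ∈ Set.Icc 0 T, 0 < S t →
      (R t * Δ t ^ 3).re = 0 ∧ 0 < (R t * Δ t ^ 3).im := by
    intro t ht hSt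
    have hpos : ∀ τ ∈ Set.Icc t T, 0 < S τ := by
      intro τ hτ
      rcases (ht.1.trans hτ.1).eq_or_lt with h | h
      · have : t = τ := le_antisymm hτ.1 (h ▸ ht.1)
        exact this ▸ hSt
      · exact hSpos τ ⟨h, hτ.2⟩
    have hne : ∀ τ ∈ Set.Icc t T, (R τ * Δ τ ^ 3).im ≠ 0 := fun τ hτ =>
      (re_eq_zero_of_sq_neg (hZsq τ ⟨ht.1.trans hτ.1, hτ.2⟩) (by linarith [hpos τ hτ])).2
    refine ⟨(re_eq_zero_of_sq_neg (hZsq t ht) (by linarith)).1, ?_⟩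
    by_contra hle
    have hcont : ContinuousOn (fun τ => (R τ * Δ τ ^ 3).im) (Set.Icc t T) := by
      have h1 := hRc.mono (Set.Icc_subset_Icc_left ht.1)
      have h2 := hΔc.mono (Set.Icc_subset_Icc_left ht.1)
      fun_prop
    have h0T : 0 ≤ (R T * Δ T ^ 3).im := by
      rw [hRT, hΔT, hrδ]
      simpa using hw.le
    obtain ⟨τ, hτ, e⟩ := intermediate_value_Icc ht.2 hcont ⟨not_lt.1 hle, h0T⟩
    exact hne τ hτ e
  have hrel : ∀ t, Δ t ^ 2 = 12 - 3 * R t ^ 2 := fun t => by rw [hR, hΔ]; ring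
  have hover : ∀ t, Over (3 * R t - R t ^ 3) ((-R t + Δ t) / 2) ∧
      Over (3 * R t - R t ^ 3) ((-R t - Δ t) / 2) := by
    intro t
    unfold Over
    constructor
    · linear_combination (Δ t - 3 * R t) / 8 * hrel t
    · linear_combination (-Δ t - 3 * R t) / 8 * hrel t
  refine ⟨fun t => 3 * R t - R t ^ 3, fun t => (-R t + Δ t) / 2, fun t => (-R t - Δ t) / 2,
    ⟨hT, by fun_prop, by fun_prop, by fun_prop, fun t _ => (hover t).1, fun t _ => (hover t).2,
      ?_, ?_⟩, by simp only [hRT], by simp only [hRT, hΔT], by simp only [hRT, hΔT],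
      R 0, Δ 0, hR 0, hΔ 0, rfl, rfl, rfl, ?_⟩
  · intro t ht e
    have h0 : Δ t = 0 := by linear_combination e
    have h := (hsign t ⟨ht.1.le, ht.2⟩ (hSpos t ht)).2
    rw [h0] at h
    simp at h
  · intro t ht
    have ht' : t ∈ Set.Icc 0 T := ⟨ht.1.le, ht.2.le⟩
    obtain ⟨hre, him⟩ := hsign t ht' (hSpos t ⟨ht.1, ht.2.le⟩)
    set ω := (R t * Δ t ^ 3).im with hω
    have hz : R t * Δ t ^ 3 = ω * Complex.I := by
      apply Complex.ext <;> simp [hre, ← hω]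
    have hRt := (hRd t ht).hasDerivAt
    have hΔt := (hΔd t ht).hasDerivAt
    set v := deriv R t
    have hγ : HasDerivAt (fun t => 3 * R t - R t ^ 3) (3 * v - 3 * R t ^ 2 * v) t := by
      have := (hRt.const_mul 3).fun_sub (hRt.fun_pow 3)
      simpa using this
    obtain ⟨Z', hZ'⟩ : ∃ Z', HasDerivAt (fun t => R t * Δ t ^ 3) Z' t :=
      ⟨_, hRt.fun_mul (hΔt.fun_pow 3)⟩
    have hn : Set.Icc 0 T ∈ 𝓝 t := Icc_mem_nhds ht.1 ht.2
    -- Differentiating the square: since S increases and R Δ^3 is a positive multiple of i, its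
    -- derivative Z' is one too.
    have hZ2 : 2 * (R t * Δ t ^ 3) * Z' = ((-27 * S' t : ℝ) : ℂ) := by
      have e1 : HasDerivAt (fun t => (R t * Δ t ^ 3) ^ 2) (2 * (R t * Δ t ^ 3) * Z') t := by
        simpa using hZ'.fun_pow 2
      have e2 : HasDerivAt (fun t => ((-27 * S t : ℝ) : ℂ)) ((-27 * S' t : ℝ) : ℂ) t :=
        ((hS' t ht).1.const_mul (-27)).ofReal_comp
      exact e1.unique (e2.congr_of_eventuallyEq (Filter.mem_of_superset hn hZsq))
    have hp := hasDerivAt_primitive hγ (p := fun t => (-R t + Δ t) / 2)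
      (ContinuousOn.continuousAt (by fun_prop) hn) (Filter.Eventually.of_forall fun t => (hover t).1)
    have hq := hasDerivAt_primitive hγ (p := fun t => (-R t - Δ t) / 2)
      (ContinuousOn.continuousAt (by fun_prop) hn) (Filter.Eventually.of_forall fun t => (hover t).2)
    -- Two computations of the derivative of P(p) - P(q) identify (p - q) γ' with Z' / 4.
    have hpq := (hp.fun_sub hq).unique ((hZ'.div_const 4).congr_of_eventuallyEq
      (Filter.Eventually.of_forall fun t => by
        change primitive _ - primitive _ = _
        rw [primitive_sub (r := R t) (by ring) (by linear_combination -hrel t / 4)]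
        ring))
    refine ⟨_, 27 * S' t / (8 * ω), hγ, div_pos (mul_pos (by norm_num) (hS' t ht).2)
      (by positivity), ?_⟩
    rw [sub_mul, hpq]
    have hω0 : (ω : ℂ) ≠ 0 := Complex.ofReal_ne_zero.2 him.ne'
    rw [hz] at hZ2
    push_cast at hZ2 ⊢
    field_simp
    linear_combination -4 * Complex.I * hZ2 + 8 * ω * Z' * Complex.I_sq
  · intro h0
    obtain ⟨hre, him⟩ := hsign 0 ⟨le_rfl, hT.le⟩ h0
    refine ⟨(R 0 * Δ 0 ^ 3).im / 4, by positivity, ?_⟩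
    apply Complex.ext
    · simp [hre]
    · simp; ring

/-! ## The level curves are covered by the extended network -/

/-- The three kinds of points on the level curves, in terms of the root `r` not in the label. -/
theorem level_cases {r δ : ℂ} {w : ℝ} (hδ : δ ^ 2 = 12 - 3 * r ^ 2)
    (hw : r * δ ^ 3 = 4 * w * Complex.I) (hw0 : w ≠ 0) :
    (∃ ρ : ℝ, r = ρ * Complex.I) ∨ (r.im = 0 ∧ 4 < r.re ^ 2) ∨
    ((4 - r ^ 2).im ≠ 0 ∧ 0 < (4 - r ^ 2).re ∧ (4 - r ^ 2).re < 1 ∧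
      (4 - r ^ 2).im ^ 2 * (1 - (4 - r ^ 2).re) = (4 - r ^ 2).re ^ 2 * (3 - (4 - r ^ 2).re)) := by
  set a := (4 - r ^ 2).re with ha
  set b := (4 - r ^ 2).im with hb
  have hv : (4 - r ^ 2) = a + b * Complex.I := (Complex.re_add_im _).symm
  -- The square of the label equation, in the coordinate v = a + bi. The vanishing imaginary part
  -- gives either b = 0 or the cubic curve of the third case.
  have hs : (4 - r ^ 2) ^ 4 - 4 * (4 - r ^ 2) ^ 3 = ((16 * w ^ 2 / 27 : ℝ) : ℂ) := by
    have h1 : (r * δ ^ 3) ^ 2 = r ^ 2 * (δ ^ 2) ^ 3 := by ring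
    rw [hw, hδ] at h1
    push_cast
    linear_combination h1 / 27 - 16 / 27 * w ^ 2 * Complex.I_sq
  have hw2 : 0 < 16 * w ^ 2 / 27 := by positivity
  rw [hv] at hs
  have hre : a ^ 4 - 6 * a ^ 2 * b ^ 2 + b ^ 4 - 4 * (a ^ 3 - 3 * a * b ^ 2) = 16 * w ^ 2 / 27 := by
    have := congrArg Complex.re hs
    simp only [pow_succ, pow_zero, one_mul, Complex.sub_re, Complex.mul_re, Complex.add_re,
      Complex.ofReal_re, Complex.ofReal_im, Complex.I_re, Complex.I_im, Complex.add_im,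
      Complex.mul_im, Complex.re_ofNat, Complex.im_ofNat] at this
    linear_combination this
  have him : b * (a ^ 3 - a * b ^ 2 - 3 * a ^ 2 + b ^ 2) = 0 := by
    have := congrArg Complex.im hs
    simp only [pow_succ, pow_zero, one_mul, Complex.sub_im, Complex.mul_re, Complex.add_re,
      Complex.ofReal_re, Complex.ofReal_im, Complex.I_re, Complex.I_im, Complex.add_im,
      Complex.mul_im, Complex.re_ofNat, Complex.im_ofNat] at this
    linear_combination this / 4
  by_cases hb0 : b = 0
  · rw [hb0] at hre hv
    rw [Complex.ofReal_zero, zero_mul, add_zero] at hv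
    have h1 : 0 < a ^ 2 * (a * (a - 4)) := by
      have : a ^ 2 * (a * (a - 4)) = 16 * w ^ 2 / 27 := by linear_combination hre
      linarith
    have h2 : 0 < a * (a - 4) := pos_of_mul_pos_right h1 (sq_nonneg a)
    have hr2 : r ^ 2 = ((4 - a : ℝ) : ℂ) := by push_cast; linear_combination -hv
    rcases pos_and_pos_or_neg_and_neg_of_mul_pos h2 with ⟨_, h4⟩ | ⟨h4, _⟩
    · left
      refine ⟨r.im, ?_⟩
      have := (re_eq_zero_of_sq_neg hr2 (by linarith)).1
      apply Complex.ext <;> simp [this]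
    · right; left
      have h0 := (im_eq_zero_of_sq_pos hr2 (by linarith)).1
      have := congrArg Complex.re hr2
      simp only [pow_two, Complex.mul_re, h0, Complex.ofReal_re] at this
      exact ⟨h0, by nlinarith⟩
  · right; right
    have hq := (mul_eq_zero.1 him).resolve_left hb0
    have hb2 : b ^ 2 * (1 - a) = a ^ 2 * (3 - a) := by linear_combination hq
    have hpb : 0 < b ^ 2 := by positivity
    -- Eliminating b with the equation of the curve; positivity of the left side confines a to (0,
    -- 2), and the curve then forces a < 1.
    have hid : 16 * w ^ 2 / 27 * (1 - a) ^ 2 = 4 * a ^ 3 * (2 - a) ^ 3 := by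
      rw [← hre]
      linear_combination ((-6 * a ^ 2 + 12 * a) * (1 - a) + b ^ 2 * (1 - a) + a ^ 2 * (3 - a)) * hb2
    have ha1 : a ≠ 1 := by
      intro h
      rw [h] at hb2
      norm_num at hb2
    have h4 : 0 < (a * (2 - a)) ^ 3 := by
      have : 0 < (1 - a) ^ 2 := by
        have : 1 - a ≠ 0 := sub_ne_zero.2 ha1.symm
        positivity
      have := mul_pos hw2 this
      nlinarith
    have h5 : 0 < a * (2 - a) := by
      by_contra h
      have : (a * (2 - a)) ^ 3 ≤ 0 := by
        have := sq_nonneg (a * (2 - a))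
        nlinarith
      linarith
    rcases pos_and_pos_or_neg_and_neg_of_mul_pos h5 with ⟨h6, h7⟩ | ⟨h6, h7⟩
    · refine ⟨hb0, h6, ?_, hb2⟩
      have : 0 < a ^ 2 * (3 - a) := by
        have : 0 < 3 - a := by linarith
        positivity
      rw [← hb2] at this
      linarith [pos_of_mul_pos_right this hpb.le]
    · linarith

theorem branch_of_sq_eq_four {R : ℂ} (h : R ^ 2 = 4) : 3 * R - R ^ 3 ∈ branchPoints :=
  ⟨-R / 2, by unfold Over; linear_combination (-9 / 8 * R) * h, by linear_combination 3 / 4 * h⟩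

/-- Points of the level curves off the imaginary axis lie on lines emitted by branch points. -/
theorem supports_primary {r δ : ℂ} {w : ℝ} (hδ : δ ^ 2 = 12 - 3 * r ^ 2)
    (hrδ : r * δ ^ 3 = 4 * w * Complex.I) (hw : 0 < w) (hr : ¬ ∃ ρ : ℝ, r = ρ * Complex.I) :
    Supports (3 * r - r ^ 3) ((-r + δ) / 2) ((-r - δ) / 2) := by
  -- It is enough to reach v = 4 - r^2 from v = 0, where r = ±2 and the two roots of the label
  -- coincide.
  suffices H : ∃ (V : ℝ → ℂ) (S S' : ℝ → ℝ) (T : ℝ) (k₁ k₂ : ℂ), 0 < T ∧ V 0 = 0 ∧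
      V T = 4 - r ^ 2 ∧ ContinuousOn V (Set.Icc 0 T) ∧
      (∀ t ∈ Set.Ioo 0 T, DifferentiableAt ℝ V t) ∧
      (∀ t ∈ Set.Icc 0 T, V t ^ 4 - 4 * V t ^ 3 = S t) ∧
      (∀ t ∈ Set.Ioo 0 T, HasDerivAt S (S' t) t ∧ 0 < S' t) ∧
      (∀ t ∈ Set.Ioc 0 T, 0 < S t) ∧
      (∀ t ∈ Set.Icc 0 T, 0 < (k₁ * (4 - V t)).re) ∧
      (∀ t ∈ Set.Ioc 0 T, 0 < (k₂ * (3 * V t)).re) by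
    obtain ⟨V, S, S', T, k₁, k₂, hT, hV0, hVT, hVc, hVd, hS, hS', hSp, h1, h2⟩ := H
    obtain ⟨γ, p, q, hγ, e1, e2, e3, R, Δ, hR, hΔ, e4, e5, e6, -⟩ :=
      exists_trajectory hT k₁ k₂ hVc hVd hS hS' hSp h1 h2 (by rw [hV0]; simp)
        (by rw [hVT]; ring) (by rw [hVT, hδ]; ring) hw hrδ
    rw [hV0] at hR hΔ
    have hΔ0 : Δ = 0 := by simpa using hΔ
    rw [← e1, ← e2, ← e3]
    refine Supports.primary γ p q T hγ ?_ ?_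
    · rw [e4]
      exact branch_of_sq_eq_four (by simpa using hR)
    · rw [e5, e6, hΔ0]; ring
  rcases level_cases hδ hrδ hw.ne' with h | ⟨h1, h2⟩ | ⟨hb, ha0, ha1, hab⟩
  · exact absurd h hr
  · have hrr : r ^ 2 = ((r.re ^ 2 : ℝ) : ℂ) := by
      have : r = (r.re : ℂ) := by apply Complex.ext <;> simp [h1]
      rw [this]
      simp
    -- For real r with r^2 > 4 the path runs along the negative real v-axis.
    refine ⟨fun t => -(t : ℂ), fun t => t ^ 4 + 4 * t ^ 3, fun t => 4 * t ^ 3 + 12 * t ^ 2,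
      r.re ^ 2 - 4, 1, -1, by linarith, by simp, ?_, ?_, ?_, ?_, ?_, ?_, ?_, ?_⟩
    · rw [hrr]; push_cast; ring
    · fun_prop
    · intro t _
      exact (Complex.ofRealCLM.differentiableAt (x := t)).neg
    · intro t _; push_cast; ring
    · intro t ht
      have := ht.1
      refine ⟨?_, by positivity⟩
      exact ((hasDerivAt_pow 4 t).fun_add ((hasDerivAt_pow 3 t).const_mul 4)).congr_deriv
        (by push_cast; ring)
    · intro t ht
      have := ht.1
      positivity
    · intro t ht
      have := ht.1
      simp
      linarith
    · intro t ht
      have := ht.1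
      simpa using this
  · set a := (4 - r ^ 2).re with ha
    set b := (4 - r ^ 2).im with hbdef
    obtain ⟨e, he, heb⟩ : ∃ e : ℝ, e ^ 2 = 1 ∧ b = e * |b| := by
      rcases le_total 0 b with h | h
      · exact ⟨1, by norm_num, by rw [abs_of_nonneg h, one_mul]⟩
      · exact ⟨-1, by norm_num, by rw [abs_of_nonpos h]; ring⟩
    -- The curve b^2 (1 - a) = a^2 (3 - a) is parametrized by a = t, with b = t κ(t); the sign e
    -- selects the half of the curve on which the given point lies.
    let κ : ℝ → ℝ := fun t => e * √((3 - t) / (1 - t))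
    have hκ : ∀ t ∈ Set.Icc 0 a, κ t ^ 2 * (1 - t) = 3 - t := by
      intro t ht
      have h1 : 0 < 1 - t := by linarith [ht.2]
      have h3 : 0 < 3 - t := by linarith [ht.2]
      simp only [κ]
      rw [mul_pow, he, Real.sq_sqrt (by positivity)]
      field_simp
    have hκa : a * κ a = b := by
      have h1 : 0 < 1 - a := by linarith
      have : |b| = a * √((3 - a) / (1 - a)) := by
        rw [← sq_eq_sq₀ (abs_nonneg _) (by positivity), sq_abs, mul_pow,
          Real.sq_sqrt (div_nonneg (by linarith) h1.le), mul_div_assoc', eq_div_iff h1.ne', hab]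
      simp only [κ]
      rw [heb, this]
      ring
    have hquot : ∀ t ∈ Set.Icc 0 a, 1 - t ≠ 0 := fun t ht => by linarith [ht.2]
    refine ⟨fun t => t * (1 + κ t * Complex.I), fun t => 4 * (t * (2 - t)) ^ 3 / (1 - t) ^ 2,
      fun t => (12 * (t * (2 - t)) ^ 2 * (2 - 2 * t) * (1 - t) ^ 2 +
        8 * (t * (2 - t)) ^ 3 * (1 - t)) / ((1 - t) ^ 2) ^ 2,
      a, 1, 1, ha0, by simp, ?_, ?_, ?_, ?_, ?_, ?_, ?_, ?_⟩
    · rw [← Complex.re_add_im (4 - r ^ 2), ← ha, ← hbdef, ← hκa]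
      push_cast
      ring
    · have h1 : ContinuousOn κ (Set.Icc 0 a) :=
        continuousOn_const.mul (ContinuousOn.sqrt (ContinuousOn.div (by fun_prop) (by fun_prop) hquot))
      have h2 : ContinuousOn (fun t => (κ t : ℂ)) (Set.Icc 0 a) :=
        Complex.continuous_ofReal.comp_continuousOn h1
      fun_prop
    · intro t ht
      have h1 : 1 - t ≠ 0 := hquot t ⟨ht.1.le, ht.2.le⟩
      have h2 : (3 - t) / (1 - t) ≠ 0 := div_ne_zero (by linarith [ht.2]) h1
      have h3 : DifferentiableAt ℝ κ t := by
        have : DifferentiableAt ℝ (fun t => (3 - t) / (1 - t)) t := by fun_prop (disch := assumption)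
        exact (this.sqrt h2).const_mul e
      have h4 : DifferentiableAt ℝ (fun t => (κ t : ℂ)) t :=
        (Complex.ofRealCLM.differentiableAt (x := κ t)).comp t h3
      have h5 : DifferentiableAt ℝ (fun t : ℝ => (t : ℂ)) t := Complex.ofRealCLM.differentiableAt
      fun_prop
    · intro t ht
      have h1 : (1 - t : ℂ) ≠ 0 := by exact_mod_cast hquot t ht
      have h2 : (κ t : ℂ) ^ 2 * (1 - t) = 3 - t := by exact_mod_cast hκ t ht
      push_cast
      rw [eq_div_iff (pow_ne_zero 2 h1)]
      generalize (κ t : ℂ) = K at h2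
      generalize (t : ℂ) = τ at h1 h2
      have h3 : (1 + K * Complex.I) ^ 3 = 1 - 3 * K ^ 2 + K * (3 - K ^ 2) * Complex.I := by
        linear_combination (3 * K ^ 2 + K ^ 3 * Complex.I) * Complex.I_sq
      have h4 : (τ * (1 + K * Complex.I)) ^ 4 - 4 * (τ * (1 + K * Complex.I)) ^ 3 =
          τ ^ 3 * ((1 - 3 * K ^ 2 + K * (3 - K ^ 2) * Complex.I) *
            (τ - 4 + τ * K * Complex.I)) := by
        rw [← h3]; ring
      rw [h4]
      have h5 : (1 - 3 * K ^ 2 + K * (3 - K ^ 2) * Complex.I) * (1 - τ) =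
          -8 + 2 * τ + K * (-2 * τ) * Complex.I := by
        linear_combination (-3 - K * Complex.I) * h2
      have h6 : (-8 + 2 * τ + K * (-2 * τ) * Complex.I) * ((τ - 4 + τ * K * Complex.I) * (1 - τ)) =
          4 * (2 - τ) ^ 3 := by
        linear_combination (2 * τ ^ 2) * h2 + (-2 * τ ^ 2 * K ^ 2 * (1 - τ)) * Complex.I_sq
      linear_combination τ ^ 3 * h6 + τ ^ 3 * (τ - 4 + τ * K * Complex.I) * (1 - τ) * h5
    · intro t ht
      have h1 : 0 < 1 - t := by linarith [ht.2]
      have h2 : 0 < 2 - t := by linarith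
      have h3 : 0 < 2 - 2 * t := by linarith
      have h4 := ht.1
      refine ⟨?_, by positivity⟩
      have e1 : HasDerivAt (fun t : ℝ => t * (2 - t)) (2 - 2 * t) t := by
        exact ((hasDerivAt_id' t).fun_mul ((hasDerivAt_id' t).const_sub 2)).congr_deriv (by ring)
      have e2 : HasDerivAt (fun t : ℝ => (1 - t) ^ 2) (-(2 * (1 - t))) t := by
        exact (((hasDerivAt_id' t).const_sub 1).fun_pow 2).congr_deriv (by push_cast; ring)
      exact (((e1.fun_pow 3).const_mul 4).fun_div e2 (by positivity)).congr_deriv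
        (by push_cast; ring)
    · intro t ht
      have h1 : 0 < 1 - t := by linarith [ht.2]
      have h2 : 0 < 2 - t := by linarith
      have h4 := ht.1
      positivity
    · intro t ht
      simp
      linarith [ht.2]
    · intro t ht
      simpa using ht.1

/-- The point of the level curves over which all three real parts of the primitive vanish. -/
theorem supports_at_collision {R Δ : ℂ} {c w : ℝ} (hc : 0 < c) (hc2 : c ^ 2 + 2 * c - 2 = 0)
    (hR : R ^ 2 = -c) (hΔ : Δ ^ 2 = 12 - 3 * R ^ 2) (hw : 0 < w)
    (hRΔ : R * Δ ^ 3 = 4 * w * Complex.I) :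
    Supports (3 * R - R ^ 3) ((-R + Δ) / 2) R ∧ Supports (3 * R - R ^ 3) R ((-R - Δ) / 2) := by
  have hRre : R.re = 0 :=
    (re_eq_zero_of_sq_neg (a := -c) (by rw [hR]; push_cast; ring) (by linarith)).1
  have hΔre : Δ.re ≠ 0 :=
    (im_eq_zero_of_sq_pos (a := 12 + 3 * c) (by rw [hΔ, hR]; push_cast; ring) (by linarith)).2
  set p := (-R + Δ) / 2 with hp
  set q := (-R - Δ) / 2 with hq
  have e1 : p + q + R = 0 := by rw [hp, hq]; ring
  have e2 : p * q + p * R + q * R = -3 := by rw [hp, hq]; linear_combination -hΔ / 4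
  -- The quadratic equation for c is exactly the condition P(R) = 0 for R^2 = -c. As the three
  -- values of P sum to zero and P(p) - P(q) = wi, it follows that P(p) = wi/2 and P(q) = -wi/2,
  -- whence the `w / 2` below.
  have hPR : primitive R = 0 := by
    have : (c : ℂ) ^ 2 + 2 * c - 2 = 0 := by exact_mod_cast hc2
    unfold primitive
    linear_combination (3 / 2 - 3 / 4 * R ^ 2 + 3 / 4 * c) * hR - 3 / 4 * this
  have hd := primitive_sub e1 e2
  have hs := primitive_sum e1 e2
  have hpq : p - q = Δ := by rw [hp, hq]; ring
  rw [hpq, hRΔ] at hd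
  have hover : ∀ t, t = p ∨ t = q → 3 * t - t ^ 3 = 3 * R - R ^ 3 := by
    intro t ht
    have : (t - p) * (t - q) = 0 := by rcases ht with rfl | rfl <;> ring
    linear_combination (R - t) * (this + t * e1 - e2 + R * e1)
  constructor
  -- R is imaginary and Δ is real and nonzero, so p and q are off the imaginary axis, and both lines
  -- through the point are primary.
  · have hqre : ¬ ∃ ρ : ℝ, q = ρ * Complex.I := by
      rintro ⟨ρ, h⟩
      have := congrArg Complex.re h
      rw [hq] at this
      simp [hRre] at this
      exact hΔre this
    have := supports_primary (r := q) (δ := p - R) (w := w / 2)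
      (sq_sub_roots (by linear_combination e1) (by linear_combination e2)) (by
        have h := primitive_sub (p := p) (q := R) (r := q) (by linear_combination e1)
          (by linear_combination e2)
        push_cast
        linear_combination -4 * h + 2 * hd + 2 * hs - 6 * hPR) (by linarith) hqre
    convert this using 1
    · exact (hover q (Or.inr rfl)).symm
    · linear_combination e1 / 2
    · linear_combination e1 / 2
  · have hpre : ¬ ∃ ρ : ℝ, p = ρ * Complex.I := by
      rintro ⟨ρ, h⟩
      have := congrArg Complex.re h
      rw [hp] at this
      simp [hRre] at this
      exact hΔre this
    have := supports_primary (r := p) (δ := R - q) (w := w / 2)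
      (sq_sub_roots (by linear_combination e1) (by linear_combination e2)) (by
        have h := primitive_sub (p := R) (q := q) (r := p) (by linear_combination e1)
          (by linear_combination e2)
        push_cast
        linear_combination -4 * h + 2 * hd - 2 * hs + 6 * hPR) (by linarith) hpre
    convert this using 1
    · exact (hover p (Or.inl rfl)).symm
    · linear_combination e1 / 2
    · linear_combination e1 / 2

/-- The lines emitted by the collision points cover the imaginary axis beyond them. -/
theorem supports_secondary {r δ : ℂ} {c ρ w : ℝ} (hc : 0 < c) (hc2 : c ^ 2 + 2 * c - 2 = 0)
    (hr : r = ρ * Complex.I) (hρ : c < ρ ^ 2) (hδ : δ ^ 2 = 12 - 3 * r ^ 2) (hw : 0 < w)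
    (hrδ : r * δ ^ 3 = 4 * w * Complex.I) :
    Supports (3 * r - r ^ 3) ((-r + δ) / 2) ((-r - δ) / 2) := by
  have hr2 : r ^ 2 = -(ρ : ℂ) ^ 2 := by
    rw [hr]; linear_combination (ρ : ℂ) ^ 2 * Complex.I_sq
  obtain ⟨γ, p, q, hγ, e1, e2, e3, R, Δ, hR, hΔ, e4, e5, e6, h⟩ :=
    -- Along the imaginary r-axis v = 4 + ρ^2 is real; the path starts at v = 4 + c, over a
    -- collision point, where S is positive, so the sign of the label is known there too.
    exists_trajectory (V := fun t => 4 + c + t) (S := fun t => (4 + c + t) ^ 4 - 4 * (4 + c + t) ^ 3)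
      (S' := fun t => 4 * (4 + c + t) ^ 3 - 12 * (4 + c + t) ^ 2) (T := ρ ^ 2 - c) (by linarith)
      (-1) 1 (by fun_prop) (fun t _ => (Complex.ofRealCLM.differentiableAt (x := t)).const_add _)
      (fun t _ => by push_cast; ring) (fun t ht => by
        have h0 := ht.1
        constructor
        · have e := (hasDerivAt_id' t).const_add (4 + c)
          exact ((e.fun_pow 4).fun_sub ((e.fun_pow 3).const_mul 4)).congr_deriv
            (by push_cast; ring)
        · have : 4 * (4 + c + t) ^ 3 - 12 * (4 + c + t) ^ 2 = 4 * (4 + c + t) ^ 2 * (1 + c + t) := by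
            ring
          rw [this]
          positivity)
      (fun t ht => by
        have h0 := ht.1
        have : (4 + c + t) ^ 4 - 4 * (4 + c + t) ^ 3 = (4 + c + t) ^ 3 * (c + t) := by ring
        rw [this]
        positivity)
      (fun t ht => by have h0 := ht.1; simp; linarith)
      (fun t ht => by have h0 := ht.1; simp; linarith)
      (by simp; linarith) (r := r) (δ := δ) (by rw [hr2]; push_cast; ring)
      (by rw [hδ, hr2]; push_cast; ring) hw hrδ
  simp only [Complex.ofReal_zero, add_zero] at hR hΔ h
  obtain ⟨w', hw', hRΔ⟩ := h (by
    have : (4 + c) ^ 4 - 4 * (4 + c) ^ 3 = (4 + c) ^ 3 * c := by ring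
    rw [this]
    positivity)
  obtain ⟨h1, h2⟩ := supports_at_collision hc hc2 (by rw [hR]; ring)
    (by rw [hΔ, hR]; ring) hw' hRΔ
  rw [← e1, ← e2, ← e3]
  exact Supports.collision γ p q _ R hγ (by rw [e4, e5]; exact h1) (by rw [e4, e6]; exact h2)

/-! ## The extended network is the tie set -/

/-- Two sheets over `x` have primitives with the same real part; `r` is the root over `x` on the
remaining sheet and `δ` the difference of the two roots. -/
def IsTie (x : ℂ) : Prop :=
  ∃ r δ : ℂ, x = 3 * r - r ^ 3 ∧ δ ^ 2 = 12 - 3 * r ^ 2 ∧ (r * δ ^ 3).re = 0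

/-- By `primitive_sub`, r δ^3 / 4 is the difference of the two primitives. The given δ may be either
square root, which only changes a sign. -/
theorem isTie_iff {x : ℂ} {s : Fin 3 → ℂ} (h : IsFibre x s) :
    IsTie x ↔ ∃ i j, i ≠ j ∧ (primitive (s i)).re = (primitive (s j)).re := by
  constructor
  · rintro ⟨r, δ, hx, hδ, hre⟩
    obtain ⟨k, hk⟩ := h.exists_eq (p := r) (by unfold Over; rw [hx]; ring)
    obtain ⟨π, hπ⟩ : ∃ π : Equiv.Perm (Fin 3), π 2 = k := ⟨Equiv.swap 2 k, by simp⟩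
    have ht := h.comp_perm π
    have h2 : s (π 2) = r := by rw [hπ, hk]
    have e1 := ht.sum
    have e2 := ht.pairs
    refine ⟨π 0, π 1, by simp, ?_⟩
    have hd := primitive_sub e1 e2
    have hsq := sq_sub_roots e1 e2
    simp only [h2] at hd hsq
    rw [← hδ] at hsq
    rw [← sub_eq_zero, ← Complex.sub_re, hd]
    have : (r * (s (π 0) - s (π 1)) ^ 3).re = 0 := by
      rcases sq_eq_sq_iff_eq_or_eq_neg.1 hsq with h | h
      · rw [h, hre]
      · rw [h]
        have : r * (-δ) ^ 3 = -(r * δ ^ 3) := by ring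
        rw [this, Complex.neg_re, hre, neg_zero]
    simp [this]
  · rintro ⟨i, j, hij, he⟩
    obtain ⟨π, h0, h1⟩ : ∃ π : Equiv.Perm (Fin 3), π 0 = i ∧ π 1 = j := by
      clear he; revert i j; decide
    have ht := h.comp_perm π
    have e1 := ht.sum
    have e2 := ht.pairs
    refine ⟨s (π 2), s (π 0) - s (π 1), ?_, sq_sub_roots e1 e2, ?_⟩
    · have := h.over (π 2)
      unfold Over at this
      linear_combination this
    · have hd := primitive_sub e1 e2
      have h4 : s (π 2) * (s (π 0) - s (π 1)) ^ 3 =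
          4 * (primitive (s (π 0)) - primitive (s (π 1))) := by rw [hd]; ring
      simp only [h0, h1] at h4
      rw [h0, h1, h4]
      simp [he]

theorem isTie_of_roots {x p q : ℂ} (hp : Over x p) (hq : Over x q) (hne : p ≠ q)
    (h : (primitive p).re = (primitive q).re) : IsTie x :=
  (isTie_iff (exists_third hp hq hne).2.2).2 ⟨0, 1, by decide, by simpa using h⟩

theorem isTie_of_mem_spectralNetwork {x : ℂ} (hx : x ∈ spectralNetwork) : IsTie x := by
  rcases hx with hx | ⟨p, q, h⟩
  · rw [branchPoints_eq] at hx
    rcases hx with rfl | hx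
    · exact ⟨-2, 0, by norm_num, by norm_num, by norm_num⟩
    · obtain rfl : x = -2 := hx
      exact ⟨2, 0, by norm_num, by norm_num, by norm_num⟩
  · obtain ⟨hp, hq, h1, h2⟩ := h.primitive_diff
    exact isTie_of_roots hp hq (by rintro rfl; exact lt_irrefl _ h2) h1

/-- Over an imaginary x = (3ρ + ρ^3) i there is the imaginary root ρi; then δ^2 = 12 + 3ρ^2 is
positive, δ is real, and r δ^3 is imaginary. -/
theorem isTie_of_re_eq_zero {x : ℂ} (hx : x.re = 0) : IsTie x := by
  obtain ⟨ρ, hρ⟩ : ∃ ρ : ℝ, 3 * ρ + ρ ^ 3 = x.im := by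
    have hc : Continuous fun ρ : ℝ => 3 * ρ + ρ ^ 3 := by fun_prop
    refine mem_range_of_exists_le_of_exists_ge hc ⟨-|x.im|, ?_⟩ ⟨|x.im|, ?_⟩
    · have := abs_nonneg x.im
      have := neg_abs_le x.im
      nlinarith [pow_nonneg (abs_nonneg x.im) 3]
    · have := abs_nonneg x.im
      have := le_abs_self x.im
      nlinarith [pow_nonneg (abs_nonneg x.im) 3]
  have h1 : 0 ≤ 12 + 3 * ρ ^ 2 := by positivity
  refine ⟨ρ * Complex.I, (√(12 + 3 * ρ ^ 2) : ℝ), ?_, ?_, ?_⟩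
  · have : x = (x.im : ℂ) * Complex.I := by apply Complex.ext <;> simp [hx]
    rw [this, ← hρ]
    push_cast
    linear_combination (ρ : ℂ) ^ 3 * Complex.I * Complex.I_sq
  · rw [← Complex.ofReal_pow, Real.sq_sqrt h1]
    push_cast
    linear_combination 3 * (ρ : ℂ) ^ 2 * Complex.I_sq
  · have : (ρ : ℂ) * Complex.I * (√(12 + 3 * ρ ^ 2) : ℝ) ^ 3 =
        ((ρ * (√(12 + 3 * ρ ^ 2)) ^ 3 : ℝ) : ℂ) * Complex.I := by push_cast; ring
    rw [this, Complex.mul_I_re, Complex.ofReal_im, neg_zero]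

/-- The collision points lie on the imaginary axis. -/
theorem re_eq_zero_of_mem_collisionPoints {x : ℂ} (hx : x ∈ collisionPoints) : x.re = 0 := by
  obtain ⟨p, r, q, h1, h2⟩ := hx
  obtain ⟨hp, hr, e1, f1⟩ := h1.primitive_diff
  obtain ⟨-, hq, e2, f2⟩ := h2.primitive_diff
  have hpr : p ≠ r := by rintro rfl; exact lt_irrefl _ f1
  have hrq : r ≠ q := by rintro rfl; exact lt_irrefl _ f2
  have hpq : p ≠ q := by rintro rfl; exact lt_asymm f1 f2
  obtain ⟨s, hs⟩ : ∃ s, s = ![p, r, -(p + r)] := ⟨_, rfl⟩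
  have hfib : IsFibre x s := hs ▸ (exists_third hp hr hpr).2.2
  have h2q : s 2 = q := by
    obtain ⟨i, hi⟩ := hfib.exists_eq hq
    fin_cases i
    · exact absurd (by simpa [hs] using hi) hpq
    · exact absurd (by simpa [hs] using hi) hrq
    · exact hi
  -- The labels of the two lines make all three real parts equal, and they sum to zero.
  have hre : ∀ i, (primitive (s i)).re = 0 := by
    have hsum := congrArg Complex.re hfib.primitive_sum
    rw [Fin.sum_univ_three] at hsum
    have hs0 : s 0 = p := by rw [hs]; rfl
    have hs1 : s 1 = r := by rw [hs]; rfl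
    simp only [Complex.add_re, Complex.zero_re, h2q, hs0, hs1] at hsum
    intro i
    fin_cases i
    · change (primitive (s 0)).re = 0; rw [hs0]; linarith
    · change (primitive (s 1)).re = 0; rw [hs1]; linarith
    · change (primitive (s 2)).re = 0; rw [h2q]; linarith
  have him : ∀ i j, i ≠ j → (primitive (s i)).im ≠ (primitive (s j)).im := by
    have hs0 : s 0 = p := by rw [hs]; rfl
    have hs1 : s 1 = r := by rw [hs]; rfl
    intro i j hij
    fin_cases i <;> fin_cases j <;> simp [h2q, hs0, hs1] at hij ⊢ <;> intro h <;> linarith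
  by_contra hx0
  -- Each of the three roots can play the part of r in `level_cases`. An imaginary root would put x
  -- on the imaginary axis, and a real root of absolute value above 2 has P < 0; only the third case
  -- remains.
  have key : ∀ i, 0 < (4 - s i ^ 2).re ∧ (4 - s i ^ 2).re < 1 := by
    intro i
    obtain ⟨π, hπ⟩ : ∃ π : Equiv.Perm (Fin 3), π 2 = i := ⟨Equiv.swap 2 i, by simp⟩
    have ht := hfib.comp_perm π
    have hd := primitive_sub ht.sum ht.pairs
    set w := (primitive (s (π 0)) - primitive (s (π 1))).im with hw
    have hw0 : w ≠ 0 := by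
      rw [hw, Complex.sub_im]
      exact sub_ne_zero.2 (him _ _ (by simp))
    have hdw : primitive (s (π 0)) - primitive (s (π 1)) = w * Complex.I := by
      apply Complex.ext
      · simp [hre]
      · simp [hw]
    rw [← hπ]
    rcases level_cases (sq_sub_roots ht.sum ht.pairs) (w := w)
      (by linear_combination 4 * hdw - 4 * hd) hw0 with ⟨ρ, h⟩ | ⟨h, h'⟩ | ⟨-, h, h', -⟩
    · exfalso
      apply hx0
      have hov := hfib.over (π 2)
      unfold Over at hov
      have : x = ((3 * ρ + ρ ^ 3 : ℝ) : ℂ) * Complex.I := by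
        rw [h] at hov
        push_cast
        linear_combination hov - (ρ : ℂ) ^ 3 * Complex.I * Complex.I_sq
      rw [this, Complex.mul_I_re, Complex.ofReal_im, neg_zero]
    · exfalso
      have hreal : s (π 2) = ((s (π 2)).re : ℂ) := by apply Complex.ext <;> simp [h]
      have h0 := hre (π 2)
      generalize (s (π 2)).re = ρ at hreal h'
      rw [hreal] at h0
      have : primitive (ρ : ℂ) = ((3 / 2 * ρ ^ 2 - 3 / 4 * ρ ^ 4 + 3 / 2 : ℝ) : ℂ) := by
        unfold primitive; push_cast; ring
      rw [this, Complex.ofReal_re] at h0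
      nlinarith
    · exact ⟨h, h'⟩
  -- The squares of the roots sum to 6, while the three real parts just bounded would sum to less
  -- than 3.
  have hsq : (4 - s 0 ^ 2) + (4 - s 1 ^ 2) + (4 - s 2 ^ 2) = 6 := by
    linear_combination -(s 0 + s 1 + s 2) * hfib.sum + 2 * hfib.pairs
  have := congrArg Complex.re hsq
  simp only [Complex.add_re, Complex.re_ofNat] at this
  linarith [(key 0).2, (key 1).2, (key 2).2]

theorem isTie_of_mem_extendedNetwork {x : ℂ} (hx : x ∈ extendedNetwork) : IsTie x := by
  rcases hx with hx | ⟨c, hc, c', hc', a, b, -, -, -, rfl⟩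
  · exact isTie_of_mem_spectralNetwork hx
  · apply isTie_of_re_eq_zero
    simp [re_eq_zero_of_mem_collisionPoints hc, re_eq_zero_of_mem_collisionPoints hc']

theorem mem_collisionPoints_of_sq {c ρ : ℝ} (hc : 0 < c) (hc2 : c ^ 2 + 2 * c - 2 = 0)
    (hρ : ρ ^ 2 = c) : ((3 * ρ + ρ ^ 3 : ℝ) : ℂ) * Complex.I ∈ collisionPoints := by
  have hρ0 : ρ ≠ 0 := by
    rintro rfl
    simp at hρ
    exact hc.ne hρ
  -- The sign of d orders the label so that its phase is positive; this treats both signs of ρ at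
  -- once.
  obtain ⟨d, hd, hpos⟩ : ∃ d : ℝ, d ^ 2 = 12 + 3 * c ∧ 0 < ρ * d := by
    have h1 : 0 < √(12 + 3 * c) := Real.sqrt_pos.2 (by linarith)
    have h2 : (√(12 + 3 * c)) ^ 2 = 12 + 3 * c := Real.sq_sqrt (by linarith)
    rcases lt_or_gt_of_ne hρ0 with h | h
    · exact ⟨-√(12 + 3 * c), by rw [neg_sq, h2], by nlinarith⟩
    · exact ⟨√(12 + 3 * c), h2, mul_pos h h1⟩
  have hR : ((ρ : ℂ) * Complex.I) ^ 2 = -c := by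
    rw [← hρ]; push_cast; linear_combination (ρ : ℂ) ^ 2 * Complex.I_sq
  obtain ⟨h1, h2⟩ := supports_at_collision (R := ρ * Complex.I) (Δ := d) (w := ρ * d * d ^ 2 / 4) hc
    hc2 hR (by
      rw [hR]
      have : (d : ℂ) ^ 2 = 12 + 3 * c := by exact_mod_cast hd
      rw [this]; ring) (by
      have : d ≠ 0 := by rintro rfl; simp at hpos
      positivity) (by push_cast; ring)
  have e : ((3 * ρ + ρ ^ 3 : ℝ) : ℂ) * Complex.I =
      3 * (ρ * Complex.I) - (ρ * Complex.I) ^ 3 := by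
    push_cast; linear_combination (ρ : ℂ) ^ 3 * Complex.I * Complex.I_sq
  rw [e]
  exact ⟨_, _, _, h1, h2⟩

/-- A nonzero r δ^3 can be made a positive multiple of i by ordering the label, after which the
position of r decides which kind of line passes through x. If it is zero, either r = 0 and x is the
midpoint of the collision segment, or δ = 0 and x is a branch point. -/
theorem mem_extendedNetwork_of_isTie {x : ℂ} (hx : IsTie x) : x ∈ extendedNetwork := by
  obtain ⟨r, δ, hxr, hδ, hre⟩ := hx
  have hnet : ∀ (δ' : ℂ) (w : ℝ), 0 < w → δ' ^ 2 = 12 - 3 * r ^ 2 →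
      r * δ' ^ 3 = 4 * w * Complex.I → x ∈ extendedNetwork := by
    intro δ' w hw hδ' hrδ
    by_cases hi : ∃ ρ : ℝ, r = ρ * Complex.I
    · obtain ⟨ρ, hρ⟩ := hi
      -- The positive root of c^2 + 2c - 2; the collision points lie below r = ±√c i.
      set c : ℝ := √3 - 1 with hcdef
      have h3 : (√3) ^ 2 = 3 := Real.sq_sqrt (by norm_num)
      have hc : 0 < c := by
        have : 1 < √3 := by
          rw [Real.lt_sqrt (by norm_num)]; norm_num
        linarith
      have hc2 : c ^ 2 + 2 * c - 2 = 0 := by rw [hcdef]; linear_combination h3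
      rcases le_or_gt (ρ ^ 2) c with hle | hlt
      · right
        have hk2 : (√c) ^ 2 = c := Real.sq_sqrt hc.le
        set k := √c with hk
        have hk0 : 0 < k := Real.sqrt_pos.2 hc
        have habs : |ρ| ≤ k := by
          rw [← hk2] at hle
          exact abs_le_of_sq_le_sq hle hk0.le
        refine ⟨_, mem_collisionPoints_of_sq hc hc2 hk2, _,
          mem_collisionPoints_of_sq hc hc2 (by rw [neg_sq]; exact hk2 : (-k) ^ 2 = c), ?_⟩
        have hY : 0 < 3 * k + k ^ 3 := by positivity
        have hy : |3 * ρ + ρ ^ 3| ≤ 3 * k + k ^ 3 := by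
          obtain ⟨h1, h2⟩ := abs_le.1 habs
          rw [abs_le]
          constructor <;> nlinarith [sq_nonneg (ρ + k), sq_nonneg (ρ - k), sq_nonneg ρ, sq_nonneg k]
        obtain ⟨hy1, hy2⟩ := abs_le.1 hy
        set Y := 3 * k + k ^ 3 with hYdef
        set y := 3 * ρ + ρ ^ 3 with hydef
        refine ⟨(Y + y) / (2 * Y), (Y - y) / (2 * Y), div_nonneg (by linarith) (by linarith),
          div_nonneg (by linarith) (by linarith), by field_simp; ring, ?_⟩
        have hxy : x = (y : ℂ) * Complex.I := by
          rw [hxr, hρ, hydef]; push_cast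
          linear_combination -(ρ : ℂ) ^ 3 * Complex.I * Complex.I_sq
        have hnY : 3 * -k + (-k) ^ 3 = -Y := by rw [hYdef]; ring
        have hYC : (Y : ℂ) ≠ 0 := by exact_mod_cast hY.ne'
        rw [hxy, hnY]
        simp only [Complex.real_smul]
        push_cast
        field_simp
        ring
      · left; right
        rw [hxr]
        exact ⟨_, _, supports_secondary hc hc2 hρ hlt hδ' hw hrδ⟩
    · left; right
      rw [hxr]
      exact ⟨_, _, supports_primary hδ' hrδ hw hi⟩
  obtain ⟨w, hw⟩ : ∃ w : ℝ, r * δ ^ 3 = 4 * w * Complex.I := by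
    refine ⟨(r * δ ^ 3).im / 4, ?_⟩
    apply Complex.ext
    · simp [hre]
    · simp; ring
  rcases lt_trichotomy w 0 with h | h | h
  · exact hnet (-δ) (-w) (by linarith) (by rw [neg_sq, hδ]) (by
      push_cast; linear_combination -hw)
  · rw [h] at hw
    have h0 : r * δ ^ 3 = 0 := by simpa using hw
    rcases mul_eq_zero.1 h0 with h0 | h0
    · right
      have hx0 : x = 0 := by rw [hxr, h0]; ring
      set c : ℝ := √3 - 1 with hcdef
      have h3 : (√3) ^ 2 = 3 := Real.sq_sqrt (by norm_num)
      have hc : 0 < c := by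
        have : 1 < √3 := by
          rw [Real.lt_sqrt (by norm_num)]; norm_num
        linarith
      have hc2 : c ^ 2 + 2 * c - 2 = 0 := by rw [hcdef]; linear_combination h3
      have hk2 : (√c) ^ 2 = c := Real.sq_sqrt hc.le
      refine ⟨_, mem_collisionPoints_of_sq hc hc2 hk2, _,
        mem_collisionPoints_of_sq hc hc2 (by rw [neg_sq]; exact hk2 : (-√c) ^ 2 = c),
        1 / 2, 1 / 2, by norm_num, by norm_num, by norm_num, ?_⟩
      rw [hx0]
      simp only [Complex.real_smul]
      push_cast
      ring
    · left; left
      have hδ0 : δ = 0 := by simpa using h0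
      rw [hδ0] at hδ
      rw [hxr]
      exact branch_of_sq_eq_four (by linear_combination hδ / 3)
  · exact hnet δ w h hδ hw

theorem mem_extendedNetwork_iff {x : ℂ} : x ∈ extendedNetwork ↔ IsTie x :=
  ⟨isTie_of_mem_extendedNetwork, mem_extendedNetwork_of_isTie⟩

/-! ## Masses of points of a cone -/

/-- The total excess of the largest coordinate over the middle one. -/
def topMass (u : Fin 3 → ℝ) : ℝ := ∑ i, topExcess u i

/-- The total excess of the middle coordinate over the smallest one. -/
def bottomMass (u : Fin 3 → ℝ) : ℝ := ∑ i, bottomExcess u i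

/-- A permutation of three indices preserves or reverses the cyclic order, and the minimum in the
excess does not depend on the order of the other two coordinates. -/
theorem excess_perm {u u' : Fin 3 → ℝ} {π : Equiv.Perm (Fin 3)} (h : ∀ i, u' (π i) = u i)
    (i : Fin 3) : topExcess u' (π i) = topExcess u i ∧ bottomExcess u' (π i) = bottomExcess u i := by
  have hπ : ∀ (π : Equiv.Perm (Fin 3)) (i : Fin 3),
      (π i + 1 = π (i + 1) ∧ π i + 2 = π (i + 2)) ∨
      (π i + 1 = π (i + 2) ∧ π i + 2 = π (i + 1)) := by decide
  unfold topExcess bottomExcess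
  rcases hπ π i with ⟨h1, h2⟩ | ⟨h1, h2⟩
  · rw [h1, h2, h, h, h]
    exact ⟨rfl, rfl⟩
  · rw [h1, h2, h, h, h, min_comm, min_comm (u (i + 2) - u i)]
    exact ⟨rfl, rfl⟩

theorem mass_perm {u u' : Fin 3 → ℝ} {π : Equiv.Perm (Fin 3)} (h : ∀ i, u' (π i) = u i) :
    topMass u' = topMass u ∧ bottomMass u' = bottomMass u := by
  constructor
  · exact (Equiv.sum_comp π (topExcess u')).symm.trans
      (Finset.sum_congr rfl fun i _ => (excess_perm h i).1)
  · exact (Equiv.sum_comp π (bottomExcess u')).symm.trans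
      (Finset.sum_congr rfl fun i _ => (excess_perm h i).2)

theorem exists_sorting (u : Fin 3 → ℝ) :
    ∃ π : Equiv.Perm (Fin 3), u (π 1) ≤ u (π 0) ∧ u (π 2) ≤ u (π 1) := by
  have h := Tuple.monotone_sort (fun i => -u i)
  refine ⟨Tuple.sort (fun i => -u i), ?_, ?_⟩
  · simpa using h (show (0 : Fin 3) ≤ 1 by decide)
  · simpa using h (show (1 : Fin 3) ≤ 2 by decide)

theorem excess_of_sorted {u : Fin 3 → ℝ} (h1 : u 1 ≤ u 0) (h2 : u 2 ≤ u 1) :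
    topExcess u 0 = u 0 - u 1 ∧ topExcess u 1 = 0 ∧ topExcess u 2 = 0 ∧
    bottomExcess u 0 = 0 ∧ bottomExcess u 1 = 0 ∧ bottomExcess u 2 = u 1 - u 2 := by
  refine ⟨?_, ?_, ?_, ?_, ?_, ?_⟩ <;> simp [topExcess, bottomExcess]
  · change max 0 (min (u 0 - u 1) (u 0 - u 2)) = _
    rw [min_eq_left (by linarith), max_eq_right (by linarith)]
  · right; exact h1
  · left; change u 2 ≤ u 0; linarith
  · left; exact h1
  · left; change u 2 ≤ u 1; exact h2
  · rw [min_eq_right (by linarith), max_eq_right (by linarith)]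

theorem mass_of_sorted {u : Fin 3 → ℝ} (h1 : u 1 ≤ u 0) (h2 : u 2 ≤ u 1) :
    topMass u = u 0 - u 1 ∧ bottomMass u = u 1 - u 2 := by
  obtain ⟨e1, e2, e3, e4, e5, e6⟩ := excess_of_sorted h1 h2
  simp [topMass, bottomMass, Fin.sum_univ_three, *]

theorem mass_eq_zero_iff (u : Fin 3 → ℝ) :
    topMass u = 0 ∨ bottomMass u = 0 ↔ ∃ i j, i ≠ j ∧ u i = u j := by
  obtain ⟨π, h1, h2⟩ := exists_sorting u
  obtain ⟨m1, m2⟩ := mass_perm (u := fun i => u (π i)) (u' := u) (π := π) (fun _ => rfl)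
  obtain ⟨n1, n2⟩ := mass_of_sorted (u := fun i => u (π i)) h1 h2
  rw [m1, m2, n1, n2]
  constructor
  · rintro (h | h)
    · exact ⟨π 0, π 1, by simp, by linarith⟩
    · exact ⟨π 1, π 2, by simp, by linarith⟩
  · rintro ⟨i, j, hij, h⟩
    obtain ⟨i, rfl⟩ := π.surjective i
    obtain ⟨j, rfl⟩ := π.surjective j
    have hij' : i ≠ j := fun h => hij (h ▸ rfl)
    fin_cases i <;> fin_cases j <;> simp at hij' h
    · left; linarith
    · left; linarith
    · left; linarith
    · right; linarith
    · left; linarith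
    · right; linarith

/-- The masses determine the point up to the Weyl group, hence its squared norm. This makes a
quadratic function of the coordinates available without reference to an apartment. -/
theorem sum_sq_eq_mass {u : Fin 3 → ℝ} (h : ∑ i, u i = 0) :
    ∑ i, u i ^ 2 = 2 / 3 * (topMass u ^ 2 + topMass u * bottomMass u + bottomMass u ^ 2) := by
  obtain ⟨π, h1, h2⟩ := exists_sorting u
  obtain ⟨m1, m2⟩ := mass_perm (u := fun i => u (π i)) (u' := u) (π := π) (fun _ => rfl)
  obtain ⟨n1, n2⟩ := mass_of_sorted (u := fun i => u (π i)) h1 h2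
  rw [m1, m2, n1, n2, ← Equiv.sum_comp π]
  rw [← Equiv.sum_comp π, Fin.sum_univ_three] at h
  rw [Fin.sum_univ_three]
  linear_combination (u (π 0) + u (π 1) + u (π 2)) / 3 * h

theorem excess_lipschitz {u u' : Fin 3 → ℝ} {M : ℝ} (h : ∀ i, |u i - u' i| ≤ M) (i : Fin 3) :
    |topExcess u i - topExcess u' i| ≤ 2 * M ∧ |bottomExcess u i - bottomExcess u' i| ≤ 2 * M := by
  have h0 := abs_le.1 (h i)
  have h1 := abs_le.1 (h (i + 1))
  have h2 := abs_le.1 (h (i + 2))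
  have aux : ∀ a b a' b' : ℝ, |a - a'| ≤ 2 * M → |b - b'| ≤ 2 * M →
      |max 0 (min a b) - max 0 (min a' b')| ≤ 2 * M := by
    intro a b a' b' ha hb
    have e1 := abs_max_sub_max_le_max 0 (min a b) 0 (min a' b')
    have e2 := abs_min_sub_min_le_max a b a' b'
    have e3 : |(0 : ℝ) - 0| ≤ 2 * M := by simpa using (abs_nonneg _).trans ha
    exact e1.trans (max_le e3 (e2.trans (max_le ha hb)))
  constructor
  · apply aux <;> rw [abs_le] <;> constructor <;> linarith
  · apply aux <;> rw [abs_le] <;> constructor <;> linarith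

theorem abs_coord_le_dist (u u' : Apt) (i : Fin 3) : |u.1 i - u'.1 i| ≤ dist u u' := by
  rw [Subtype.dist_eq, dist_eq_norm, ← Real.norm_eq_abs]
  exact PiLp.norm_apply_le (u.1 - u'.1) i

namespace Cone

variable {G : BipGraph}

/-- The total coefficient of the white vertices. -/
noncomputable def whiteMass (z : Cone G) : ℝ := ∑ᶠ w, z.white w

/-- The total coefficient of the black vertices. -/
noncomputable def blackMass (z : Cone G) : ℝ := ∑ᶠ b, z.black b

theorem whiteMass_eq_zero_iff (z : Cone G) : z.whiteMass = 0 ↔ ∀ w, z.white w = 0 := by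
  constructor
  · intro h w
    by_contra hw
    have : z.whiteMass = z.white w := finsum_eq_single _ w fun w' hne => by
      by_contra h'
      exact hne (z.white_unique w' w h' hw)
    exact hw (this ▸ h)
  · intro h
    simp [whiteMass, h]

theorem blackMass_eq_zero_iff (z : Cone G) : z.blackMass = 0 ↔ ∀ b, z.black b = 0 := by
  constructor
  · intro h w
    by_contra hw
    have : z.blackMass = z.black w := finsum_eq_single _ w fun w' hne => by
      by_contra h'
      exact hne (z.black_unique w' w h' hw)
    exact hw (this ▸ h)
  · intro h
    simp [blackMass, h]

end Cone

/-! ### Masses in the charts of apartments -/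

section Chart

variable {G : BipGraph} (H : Hexagon G)

open Classical in
theorem Hexagon.chart_white (u : Apt) (w : G.White) :
    (H.chart u).white w = ∑ i, if H.white i = w then topExcess u.1 i else 0 := rfl

open Classical in
theorem Hexagon.chart_black (u : Apt) (b : G.Black) :
    (H.chart u).black b = ∑ i, if H.black i = b then bottomExcess u.1 i else 0 := rfl

/-- The hexagon does not enter the right side: masses can be compared across different apartments.
-/
theorem Hexagon.whiteMass_chart (u : Apt) : (H.chart u).whiteMass = topMass u.1 := by
  classical
  unfold Cone.whiteMass Hexagon.chart
  simp only
  rw [finsum_sum_comm]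
  · refine Finset.sum_congr rfl fun i _ => ?_
    rw [finsum_eq_single _ (H.white i) fun w hw => if_neg hw.symm, if_pos rfl]
  · intro i _
    refine (Set.finite_singleton (H.white i)).subset fun w hw => ?_
    by_contra h
    exact hw (if_neg fun e => h e.symm)

theorem Hexagon.blackMass_chart (u : Apt) : (H.chart u).blackMass = bottomMass u.1 := by
  classical
  unfold Cone.blackMass Hexagon.chart
  simp only
  rw [finsum_sum_comm]
  · refine Finset.sum_congr rfl fun i _ => ?_
    rw [finsum_eq_single _ (H.black i) fun w hw => if_neg hw.symm, if_pos rfl]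
  · intro i _
    refine (Set.finite_singleton (H.black i)).subset fun w hw => ?_
    by_contra h
    exact hw (if_neg fun e => h e.symm)

variable {H}

theorem Hexagon.exists_of_white_ne_zero {u : Apt} {w : G.White} (h : (H.chart u).white w ≠ 0) :
    ∃ i, H.white i = w ∧ topExcess u.1 i ≠ 0 := by
  rw [H.chart_white] at h
  obtain ⟨i, -, hi⟩ := Finset.exists_ne_zero_of_sum_ne_zero h
  simp only [ne_eq, ite_eq_right_iff, Classical.not_imp] at hi
  exact ⟨i, hi⟩

theorem Hexagon.exists_of_black_ne_zero {u : Apt} {b : G.Black} (h : (H.chart u).black b ≠ 0) :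
    ∃ i, H.black i = b ∧ bottomExcess u.1 i ≠ 0 := by
  rw [H.chart_black] at h
  obtain ⟨i, -, hi⟩ := Finset.exists_ne_zero_of_sum_ne_zero h
  simp only [ne_eq, ite_eq_right_iff, Classical.not_imp] at hi
  exact ⟨i, hi⟩

/-- Two charts agree where the vertices that support the point correspond to each other. -/
theorem Hexagon.chart_eq_chart {H' : Hexagon G} {u u' : Apt} (π : Equiv.Perm (Fin 3))
    (hu : ∀ i, u'.1 (π i) = u.1 i) (hw : ∀ i, topExcess u.1 i = 0 ∨ H.white i = H'.white (π i))
    (hb : ∀ i, bottomExcess u.1 i = 0 ∨ H.black i = H'.black (π i)) :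
    H.chart u = H'.chart u' := by
  classical
  ext w
  · rw [H.chart_white, H'.chart_white, ← Equiv.sum_comp π
      (fun i => if H'.white i = w then topExcess u'.1 i else 0)]
    refine Finset.sum_congr rfl fun i _ => ?_
    rw [(excess_perm hu i).1]
    rcases hw i with h | h
    · rw [h, ite_self, ite_self]
    · rw [h]
  · rw [H.chart_black, H'.chart_black, ← Equiv.sum_comp π
      (fun i => if H'.black i = w then bottomExcess u'.1 i else 0)]
    refine Finset.sum_congr rfl fun i _ => ?_
    rw [(excess_perm hu i).2]
    rcases hb i with h | h
    · rw [h, ite_self, ite_self]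
    · rw [h]

end Chart

/-! ## Continuity -/

section Continuity

variable {G : BipGraph}

theorem Hexagon.continuous_chart (H : Hexagon G) : Continuous H.chart := by
  refine ⟨fun V hV => Metric.isOpen_iff.2 fun u hu => ?_⟩
  obtain ⟨ε, hε, h⟩ := hV _ hu
  exact ⟨ε, hε, fun u' hu' => h _ ⟨H, u, u', rfl, rfl, by rwa [dist_comm]⟩⟩

/-- Nearness is measured inside a common apartment, so a Lipschitz bound that is uniform over all
charts gives continuity on the cone. -/
theorem continuous_of_near {f : Cone G → ℝ} {C : ℝ}
    (hf : ∀ (H : Hexagon G) (u u' : Apt), |f (H.chart u') - f (H.chart u)| ≤ C * dist u u') :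
    Continuous f := by
  refine ⟨fun V hV z hz => ?_⟩
  obtain ⟨ε, hε, h⟩ := Metric.isOpen_iff.1 hV _ hz
  refine ⟨ε / (|C| + 1), by positivity, ?_⟩
  rintro z' ⟨H, u, u', rfl, rfl, hd⟩
  apply h
  rw [Metric.mem_ball, Real.dist_eq]
  refine (hf H u u').trans_lt ?_
  rw [lt_div_iff₀ (by positivity)] at hd
  have := mul_le_mul_of_nonneg_right (le_abs_self C) (dist_nonneg (x := u) (y := u'))
  have := dist_nonneg (x := u) (y := u')
  linarith

theorem continuous_whiteMass : Continuous (Cone.whiteMass (G := G)) := by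
  refine continuous_of_near (C := 6) fun H u u' => ?_
  rw [H.whiteMass_chart, H.whiteMass_chart, topMass, topMass, ← Finset.sum_sub_distrib]
  refine (Finset.abs_sum_le_sum_abs _ _).trans ((Finset.sum_le_sum fun i _ => (excess_lipschitz
    (fun j => abs_coord_le_dist u' u j) i).1).trans ?_)
  simp only [Finset.sum_const, Finset.card_univ, Fintype.card_fin, nsmul_eq_mul, dist_comm u' u]
  push_cast
  linarith

theorem continuous_blackMass : Continuous (Cone.blackMass (G := G)) := by
  refine continuous_of_near (C := 6) fun H u u' => ?_
  rw [H.blackMass_chart, H.blackMass_chart, bottomMass, bottomMass, ← Finset.sum_sub_distrib]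
  refine (Finset.abs_sum_le_sum_abs _ _).trans ((Finset.sum_le_sum fun i _ => (excess_lipschitz
    (fun j => abs_coord_le_dist u' u j) i).2).trans ?_)
  simp only [Finset.sum_const, Finset.card_univ, Fintype.card_fin, nsmul_eq_mul, dist_comm u' u]
  push_cast
  linarith

theorem continuous_white (w : G.White) : Continuous fun z : Cone G => z.white w := by
  classical
  refine continuous_of_near (C := 6) fun H u u' => ?_
  rw [H.chart_white, H.chart_white, ← Finset.sum_sub_distrib]
  refine (Finset.abs_sum_le_sum_abs _ _).trans ((Finset.sum_le_sum (g := fun _ => 2 * dist u' u)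
    fun i _ => ?_).trans ?_)
  · split_ifs
    · exact (excess_lipschitz (fun j => abs_coord_le_dist u' u j) i).1
    · simp
  · simp only [Finset.sum_const, Finset.card_univ, Fintype.card_fin, nsmul_eq_mul, dist_comm u' u]
    push_cast
    linarith

theorem continuous_black (b : G.Black) : Continuous fun z : Cone G => z.black b := by
  classical
  refine continuous_of_near (C := 6) fun H u u' => ?_
  rw [H.chart_black, H.chart_black, ← Finset.sum_sub_distrib]
  refine (Finset.abs_sum_le_sum_abs _ _).trans ((Finset.sum_le_sum (g := fun _ => 2 * dist u' u)
    fun i _ => ?_).trans ?_)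
  · split_ifs
    · exact (excess_lipschitz (fun j => abs_coord_le_dist u' u j) i).2
    · simp
  · simp only [Finset.sum_const, Finset.card_univ, Fintype.card_fin, nsmul_eq_mul, dist_comm u' u]
    push_cast
    linarith

end Continuity

/-! ## The singular set -/

/-- The point of the standard apartment in the sector `u i ≥ u k ≥ u j` with excess `s` at the top
and `t` at the bottom. -/
noncomputable def sector (i j : Fin 3) (s t : ℝ) : Apt :=
  ⟨WithLp.toLp 2 fun k => (if k = i then s else 0) - (if k = j then t else 0) - (s - t) / 3, by
    fin_cases i <;> fin_cases j <;> simp <;> ring⟩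

theorem continuous_sector (i j : Fin 3) : Continuous fun x : ℝ × ℝ => sector i j x.1 x.2 := by
  refine Continuous.subtype_mk ((PiLp.continuous_toLp 2 _).comp (continuous_pi fun k => ?_)) _
  split_ifs <;> fun_prop

theorem excess_sector {i j : Fin 3} (hij : i ≠ j) {s t : ℝ} (hs : 0 ≤ s) (ht : 0 ≤ t) (k : Fin 3) :
    topExcess (sector i j s t).1 k = (if k = i then s else 0) ∧
    bottomExcess (sector i j s t).1 k = if k = j then t else 0 := by
  obtain ⟨π, h0, h2⟩ : ∃ π : Equiv.Perm (Fin 3), π 0 = i ∧ π 2 = j := by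
    revert i j; decide
  obtain ⟨k, rfl⟩ := π.surjective k
  subst h0 h2
  have hu : ∀ l, (sector (π 0) (π 2) s t).1 (π l) = (sector 0 2 s t).1 l := by
    intro l
    simp [sector]
  obtain ⟨e1, e2⟩ := excess_perm hu k
  rw [e1, e2]
  obtain ⟨f1, f2, f3, f4, f5, f6⟩ := excess_of_sorted (u := (sector 0 2 s t).1)
    (by simp [sector]; linarith) (by simp [sector]; linarith)
  fin_cases k
  · exact ⟨f1.trans (by simp [sector]), f4.trans (by simp)⟩
  · exact ⟨f2.trans (by simp), f5.trans (by simp)⟩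
  · exact ⟨f3.trans (by simp), f6.trans (by simp [sector]; ring)⟩

section Singular

variable {G : BipGraph}

theorem Hexagon.chart_sector (H : Hexagon G) {i j : Fin 3} (hij : i ≠ j) {s t : ℝ} (hs : 0 ≤ s)
    (ht : 0 ≤ t) : (H.chart (sector i j s t)).white (H.white i) = s ∧
      (∀ w, w ≠ H.white i → (H.chart (sector i j s t)).white w = 0) ∧
      (H.chart (sector i j s t)).black (H.black j) = t ∧
      ∀ b, b ≠ H.black j → (H.chart (sector i j s t)).black b = 0 := by
  have hw : ∀ w, w ≠ H.white i → (H.chart (sector i j s t)).white w = 0 := by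
    intro w hne
    by_contra h
    obtain ⟨k, rfl, hk⟩ := exists_of_white_ne_zero h
    rw [(excess_sector hij hs ht k).1] at hk
    exact hk (if_neg (by rintro rfl; exact hne rfl))
  have hb : ∀ w, w ≠ H.black j → (H.chart (sector i j s t)).black w = 0 := by
    intro w hne
    by_contra h
    obtain ⟨k, rfl, hk⟩ := exists_of_black_ne_zero h
    rw [(excess_sector hij hs ht k).2] at hk
    exact hk (if_neg (by rintro rfl; exact hne rfl))
  refine ⟨?_, hw, ?_, hb⟩
  · have h1 : (H.chart (sector i j s t)).whiteMass =
        (H.chart (sector i j s t)).white (H.white i) := finsum_eq_single _ _ hw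
    rw [← h1, H.whiteMass_chart, topMass, Finset.sum_congr rfl
      fun k _ => (excess_sector hij hs ht k).1]
    simp
  · have h1 : (H.chart (sector i j s t)).blackMass =
        (H.chart (sector i j s t)).black (H.black j) := finsum_eq_single _ _ hb
    rw [← h1, H.blackMass_chart, bottomMass, Finset.sum_congr rfl
      fun k _ => (excess_sector hij hs ht k).2]
    simp

theorem Hexagon.eq_chart_sector (H : Hexagon G) {i j : Fin 3} (hij : i ≠ j) (z : Cone G)
    (hw : ∀ w, w ≠ H.white i → z.white w = 0) (hb : ∀ b, b ≠ H.black j → z.black b = 0) :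
    z = H.chart (sector i j (z.white (H.white i)) (z.black (H.black j))) := by
  obtain ⟨e1, e2, e3, e4⟩ := H.chart_sector hij (z.white_nonneg (H.white i))
    (z.black_nonneg (H.black j))
  ext w
  · by_cases h : w = H.white i
    · rw [h, e1]
    · rw [hw w h, e2 w h]
  · by_cases h : w = H.black j
    · rw [h, e3]
    · rw [hb w h, e4 w h]

/-- The interior of a sector is open, since the coefficients are continuous, and it lies in every
apartment that contains the edge. -/
theorem not_mem_singularSet (H : Hexagon G) {i j : Fin 3} (hij : i ≠ j) {z : Cone G}
    (hw : z.white (H.white i) ≠ 0) (hb : z.black (H.black j) ≠ 0) : z ∉ singularSet G := by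
  intro h
  refine h ⟨H, {z | z.white (H.white i) ≠ 0 ∧ z.black (H.black j) ≠ 0}, ?_, ?_⟩
  · exact Filter.inter_mem ((continuous_white _).continuousAt.eventually_ne hw)
      ((continuous_black _).continuousAt.eventually_ne hb)
  · rintro y ⟨h1, h2⟩
    refine ⟨_, (H.eq_chart_sector hij y (fun w hne => ?_) fun b hne => ?_).symm⟩
    · by_contra h'
      exact hne (y.white_unique _ _ h' h1)
    · by_contra h'
      exact hne (y.black_unique _ _ h' h2)

/-- Every neighbourhood of a point on the boundary of a sector contains interior points. -/
theorem exists_interior_mem_nhds (H : Hexagon G) {i j : Fin 3} (hij : i ≠ j) {z : Cone G}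
    (hw : ∀ w, w ≠ H.white i → z.white w = 0) (hb : ∀ b, b ≠ H.black j → z.black b = 0)
    {U : Set (Cone G)} (hU : U ∈ 𝓝 z) :
    ∃ y ∈ U, y.white (H.white i) ≠ 0 ∧ y.black (H.black j) ≠ 0 := by
  have hz := H.eq_chart_sector hij z hw hb
  set s := z.white (H.white i) with hs
  set t := z.black (H.black j) with ht
  have hs0 : 0 ≤ s := z.white_nonneg _
  have ht0 : 0 ≤ t := z.black_nonneg _
  have hc : Continuous fun η : ℝ => H.chart (sector i j (s + η) (t + η)) :=
    H.continuous_chart.comp ((continuous_sector i j).comp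
      (g := fun x : ℝ × ℝ => sector i j x.1 x.2) (f := fun η : ℝ => (s + η, t + η)) (by fun_prop))
  have hU' : U ∈ 𝓝 (H.chart (sector i j (s + 0) (t + 0))) := by
    rw [add_zero, add_zero, ← hz]; exact hU
  have hev : ∀ᶠ η in 𝓝[>] (0 : ℝ), H.chart (sector i j (s + η) (t + η)) ∈ U :=
    (hc.continuousAt.eventually_mem hU').filter_mono nhdsWithin_le_nhds
  obtain ⟨η, hη, hpos⟩ := (hev.and self_mem_nhdsWithin).exists
  have hpos : 0 < η := hpos
  obtain ⟨e1, -, e3, -⟩ := H.chart_sector hij (s := s + η) (t := t + η) (by linarith) (by linarith)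
  exact ⟨_, hη, by rw [e1]; linarith, by rw [e3]; linarith⟩

/-- Every edge lies in a hexagon and every vertex has at least three neighbours. -/
structure BipGraph.IsThick (G : BipGraph) : Prop where
  nonempty_white : Nonempty G.White
  nonempty_black : Nonempty G.Black
  exists_hexagon : ∀ w b, G.Adj w b → ∃ (H : Hexagon G) (i j : Fin 3), i ≠ j ∧ H.white i = w ∧
    H.black j = b
  three_black : ∀ w, ∃ b : Fin 3 → G.Black, Function.Injective b ∧ ∀ k, G.Adj w (b k)
  three_white : ∀ b, ∃ w : Fin 3 → G.White, Function.Injective w ∧ ∀ k, G.Adj (w k) b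

theorem Hexagon.exists_of_mem_apartment {H : Hexagon G} {z : Cone G} (hz : z ∈ H.apartment)
    {w : G.White} {b : G.Black} (hw : z.white w ≠ 0) (hb : z.black b ≠ 0) :
    ∃ i j, i ≠ j ∧ H.white i = w ∧ H.black j = b := by
  obtain ⟨u, rfl⟩ := hz
  obtain ⟨i, hi, hi'⟩ := exists_of_white_ne_zero hw
  obtain ⟨j, hj, hj'⟩ := exists_of_black_ne_zero hb
  exact ⟨i, j, top_ne_bottom u.1 i j hi' hj', hi, hj⟩

/-- A point interior to a sector is regular because its edge lies in a hexagon. A point on a ray, or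
the apex, is in the closure of three sectors at one vertex; an apartment containing a neighbourhood
would contain all three edges, but a vertex of a hexagon has only two neighbours in it. -/
theorem mem_singularSet_iff (hG : G.IsThick) (z : Cone G) :
    z ∈ singularSet G ↔ z.whiteMass = 0 ∨ z.blackMass = 0 := by
  rw [z.whiteMass_eq_zero_iff, z.blackMass_eq_zero_iff]
  constructor
  · intro hz
    by_contra! h
    obtain ⟨⟨w, hw⟩, b, hb⟩ := h
    obtain ⟨H, i, j, hij, rfl, rfl⟩ := hG.exists_hexagon w b (z.adj w b hw hb)
    exact not_mem_singularSet H hij hw hb hz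
  · rintro h ⟨H, U, hU, hUH⟩
    have aux : ∀ w b, G.Adj w b → (∀ w', w' ≠ w → z.white w' = 0) →
        (∀ b', b' ≠ b → z.black b' = 0) → ∃ i j, i ≠ j ∧ H.white i = w ∧ H.black j = b := by
      intro w b hwb h1 h2
      obtain ⟨K, i, j, hij, rfl, rfl⟩ := hG.exists_hexagon w b hwb
      obtain ⟨y, hy, hyw, hyb⟩ := exists_interior_mem_nhds K hij h1 h2 hU
      exact Hexagon.exists_of_mem_apartment (hUH hy) hyw hyb
    rcases h with h | h
    · obtain ⟨b, hb⟩ : ∃ b, ∀ b', b' ≠ b → z.black b' = 0 := by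
        by_cases h0 : ∃ b, z.black b ≠ 0
        · obtain ⟨b, hb⟩ := h0
          refine ⟨b, fun b' hne => ?_⟩
          by_contra h'
          exact hne (z.black_unique _ _ h' hb)
        · push Not at h0
          exact ⟨hG.nonempty_black.some, fun b' _ => h0 b'⟩
      obtain ⟨w, hinj, hadj⟩ := hG.three_white b
      choose i j hij hi hj using fun k => aux (w k) b (hadj k) (fun w' _ => h w') hb
      have hiinj : Function.Injective i := fun k l hkl => hinj (by rw [← hi k, ← hi l, hkl])
      -- Three distinct neighbours exhaust the white vertices of the hexagon, so one of them is
      -- opposite to the black vertex, to which it should be adjacent.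
      obtain ⟨k, hk⟩ := (Finite.injective_iff_surjective.1 hiinj) (j 0)
      exact hij k (hk.trans (H.black_inj ((hj 0).trans (hj k).symm)))
    · obtain ⟨w, hw⟩ : ∃ w, ∀ w', w' ≠ w → z.white w' = 0 := by
        by_cases h0 : ∃ w, z.white w ≠ 0
        · obtain ⟨w, hw⟩ := h0
          refine ⟨w, fun w' hne => ?_⟩
          by_contra h'
          exact hne (z.white_unique _ _ h' hw)
        · push Not at h0
          exact ⟨hG.nonempty_white.some, fun w' _ => h0 w'⟩
      obtain ⟨b, hinj, hadj⟩ := hG.three_black w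
      choose i j hij hi hj using fun k => aux w (b k) (hadj k) hw (fun b' _ => h b')
      have hjinj : Function.Injective j := fun k l hkl => hinj (by rw [← hj k, ← hj l, hkl])
      obtain ⟨k, hk⟩ := (Finite.injective_iff_surjective.1 hjinj) (i 0)
      exact hij k ((H.white_inj ((hi k).trans (hi 0).symm)).trans hk.symm)

end Singular

/-! ## Projective planes are thick -/

namespace BipGraph

/-- There is no cycle of four edges. -/
def NoSquare (G : BipGraph) : Prop :=
  ∀ ⦃a b : G.White⦄ ⦃l m : G.Black⦄, G.Adj a l → G.Adj b l → G.Adj a m → G.Adj b m → a = b ∨ l = m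

/-- Any two white vertices have a common neighbour. -/
def Joins (G : BipGraph) : Prop := ∀ a b : G.White, ∃ l, G.Adj a l ∧ G.Adj b l

/-- There are four white vertices no three of which have a common neighbour. -/
def HasQuadrangle (G : BipGraph) : Prop :=
  ∃ q : Fin 4 → G.White, ∀ l i j k, i ≠ j → i ≠ k → j ≠ k →
    G.Adj (q i) l → G.Adj (q j) l → ¬ G.Adj (q k) l

variable {G : BipGraph}

theorem NoSquare.swap (h : G.NoSquare) : G.swap.NoSquare :=
  fun _ _ _ _ h1 h2 h3 h4 => (h h1 h3 h2 h4).symm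

/-- Projection from a quadrangle point off the line l: the lines joining it to the other three
quadrangle points are distinct and meet l in three distinct points. -/
theorem three_white_of_joins (h : G.NoSquare) (hj : G.Joins) (hm : G.swap.Joins)
    (hq : G.HasQuadrangle) (l : G.Black) :
    ∃ w : Fin 3 → G.White, Function.Injective w ∧ ∀ k, G.Adj (w k) l := by
  obtain ⟨q, hq⟩ := hq
  obtain ⟨i, hi⟩ : ∃ i, ¬ G.Adj (q i) l := by
    by_contra! hall
    exact hq l 0 1 2 (by decide) (by decide) (by decide) (hall 0) (hall 1) (hall 2)
  choose m hm1 hm2 using fun t : Fin 3 => hj (q i) (q (i.succAbove t))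
  choose w hw1 hw2 using fun t : Fin 3 => hm l (m t)
  refine ⟨w, fun s t hst => ?_, hw1⟩
  by_contra hne
  have h1 : G.Adj (w s) (m t) := hst ▸ hw2 t
  rcases h (hw2 s) (hm1 s) h1 (hm1 t) with h2 | h2
  · exact hi (h2 ▸ hw1 s)
  · exact hq (m s) i (i.succAbove s) (i.succAbove t) (Fin.succAbove_ne i s).symm
      (Fin.succAbove_ne i t).symm (fun e => hne (Fin.succAbove_right_injective e)) (hm1 s) (hm2 s)
      (h2 ▸ hm2 t)

/-- A hexagon through the incident pair v, l is a triangle of the plane: v, a second point c of l,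
and a point d off l. The second colour is treated by duality. -/
theorem isThick_of_joins (h : G.NoSquare) (hj : G.Joins) (hm : G.swap.Joins)
    (hq : G.HasQuadrangle) (hq' : G.swap.HasQuadrangle) : G.IsThick where
  nonempty_white := hq.elim fun q _ => ⟨q 0⟩
  nonempty_black := hq'.elim fun q _ => ⟨q 0⟩
  three_white := three_white_of_joins h hj hm hq
  three_black := three_white_of_joins h.swap hm hj hq'
  exists_hexagon := by
    intro v l hvl
    obtain ⟨w, hwinj, hw⟩ := three_white_of_joins h hj hm hq l
    obtain ⟨c, hcv, hcl⟩ : ∃ c, v ≠ c ∧ G.Adj c l := by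
      by_cases h0 : v = w 0
      · exact ⟨w 1, fun e => absurd (hwinj (h0.symm.trans e)) (by decide), hw 1⟩
      · exact ⟨w 0, h0, hw 0⟩
    obtain ⟨q, hq⟩ := hq
    obtain ⟨d, hd⟩ : ∃ d, ¬ G.Adj d l := by
      by_contra! hall
      exact hq l 0 1 2 (by decide) (by decide) (by decide) (hall _) (hall _) (hall _)
    obtain ⟨m, hvm, hdm⟩ := hj v d
    obtain ⟨m', hcm, hdm'⟩ := hj c d
    have hvd : v ≠ d := by rintro rfl; exact hd hvl
    have hcd : c ≠ d := by rintro rfl; exact hd hcl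
    have hml : m ≠ l := by rintro rfl; exact hd hdm
    have hml' : m' ≠ l := by rintro rfl; exact hd hdm'
    have hmm : m' ≠ m := by
      rintro rfl
      rcases h hvl hcl hvm hcm with h | h
      · exact hcv h
      · exact hml h.symm
    refine ⟨⟨![v, c, d], ![m', m, l], ?_, ?_, ?_⟩, 0, 2, by decide, rfl, rfl⟩
    · intro i j hij
      fin_cases i <;> fin_cases j <;> simp_all
    · intro i j hij
      fin_cases i <;> fin_cases j <;> simp_all
    · intro i j hij
      fin_cases i <;> fin_cases j <;> simp_all

/-! ## The completion has no squares -/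

/-- A common neighbour would either close the path to a hexagon or, if it is one of the two middle
black vertices, create a square. -/
theorem NoSquare.not_common_of_openChain (h : G.NoSquare) {a b : G.White} (hab : G.OpenChain a b) :
    ¬ ∃ n, G.Adj a n ∧ G.Adj b n := by
  obtain ⟨c, l, m, hne, hac, hcb, hlm, hal, hcl, hcm, hbm, hno⟩ := hab
  rintro ⟨n, han, hbn⟩
  refine hno ⟨n, ?_, ?_, han, hbn⟩
  · rintro rfl
    rcases h hcl hbn hcm hbm with h | h
    · exact hcb h
    · exact hlm h
  · rintro rfl
    rcases h hal hcl han hcm with h | h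
    · exact hac h
    · exact hlm h

theorem NoSquare.not_common_of_mem (h : G.NoSquare) (s : G.OpenPair) {a b : G.White} (hne : a ≠ b)
    (ha : a ∈ s.1) (hb : b ∈ s.1) : ¬ ∃ n, G.Adj a n ∧ G.Adj b n := by
  obtain ⟨s, c, d, rfl, hcd⟩ := s
  have := h.not_common_of_openChain hcd
  rcases Sym2.mem_iff.1 ha with rfl | rfl <;> rcases Sym2.mem_iff.1 hb with rfl | rfl
  · exact absurd rfl hne
  · exact this
  · exact fun ⟨n, h1, h2⟩ => this ⟨n, h2, h1⟩
  · exact absurd rfl hne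

theorem OpenPair.eq_of_mem {s t : G.OpenPair} {a b : G.White} (hne : a ≠ b) (h1 : a ∈ s.1)
    (h2 : b ∈ s.1) (h3 : a ∈ t.1) (h4 : b ∈ t.1) : s = t :=
  Subtype.ext (((Sym2.mem_and_mem_iff hne).1 ⟨h1, h2⟩).trans
    ((Sym2.mem_and_mem_iff hne).1 ⟨h3, h4⟩).symm)

/-- A square through a new vertex would need a second common neighbour of its two ends. No old one
exists, and a new one is the same vertex because it is indexed by the pair. -/
theorem NoSquare.complete (h : G.NoSquare) : G.complete.NoSquare := by
  rintro (a | s) (b | t) (l | u) (m | v) h1 h2 h3 h4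
  · exact (h h1 h2 h3 h4).imp (congrArg _) (congrArg _)
  · by_cases hab : a = b
    · exact Or.inl (congrArg _ hab)
    · exact absurd ⟨l, h1, h2⟩ (h.not_common_of_mem v hab h3 h4)
  · by_cases hab : a = b
    · exact Or.inl (congrArg _ hab)
    · exact absurd ⟨m, h3, h4⟩ (h.not_common_of_mem u hab h1 h2)
  · by_cases hab : a = b
    · exact Or.inl (congrArg _ hab)
    · exact Or.inr (congrArg _ (OpenPair.eq_of_mem hab h1 h2 h3 h4))
  · by_cases hlm : l = m
    · exact Or.inr (congrArg _ hlm)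
    · exact absurd ⟨a, h1, h3⟩ (h.swap.not_common_of_mem t hlm h2 h4)
  · exact absurd h4 id
  · exact absurd h2 id
  · exact absurd h2 id
  · by_cases hlm : l = m
    · exact Or.inr (congrArg _ hlm)
    · exact absurd ⟨b, h2, h4⟩ (h.swap.not_common_of_mem s hlm h1 h3)
  · exact absurd h3 id
  · exact absurd h1 id
  · exact absurd h1 id
  · by_cases hlm : l = m
    · exact Or.inr (congrArg _ hlm)
    · exact Or.inl (congrArg _ (OpenPair.eq_of_mem (G := G.swap) hlm h1 h3 h2 h4))
  · exact absurd h3 id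
  · exact absurd h1 id
  · exact absurd h1 id

theorem exists_common_complete {a b c : G.White} {l m : G.Black} (hne : a ≠ b) (hac : a ≠ c)
    (hcb : c ≠ b) (hlm : l ≠ m) (h1 : G.Adj a l) (h2 : G.Adj c l) (h3 : G.Adj c m)
    (h4 : G.Adj b m) : ∃ n, G.complete.Adj (.inl a) n ∧ G.complete.Adj (.inl b) n := by
  by_cases h : ∃ n : G.Black, n ≠ l ∧ n ≠ m ∧ G.Adj a n ∧ G.Adj b n
  · obtain ⟨n, -, -, h5, h6⟩ := h
    exact ⟨.inl n, h5, h6⟩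
  · exact ⟨.inr ⟨s(a, b), a, b, rfl, c, l, m, hne, hac, hcb, hlm, h1, h2, h3, h4, h⟩,
      Sym2.mem_mk_left a b, Sym2.mem_mk_right a b⟩

theorem exists_common_complete_swap {a b c : G.Black} {l m : G.White} (hne : a ≠ b) (hac : a ≠ c)
    (hcb : c ≠ b) (hlm : l ≠ m) (h1 : G.Adj l a) (h2 : G.Adj l c) (h3 : G.Adj m c)
    (h4 : G.Adj m b) : ∃ n, G.complete.Adj n (.inl a) ∧ G.complete.Adj n (.inl b) := by
  by_cases h : ∃ n : G.White, n ≠ l ∧ n ≠ m ∧ G.Adj n a ∧ G.Adj n b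
  · obtain ⟨n, -, -, h5, h6⟩ := h
    exact ⟨.inl n, h5, h6⟩
  · exact ⟨.inr ⟨s(a, b), a, b, rfl, c, l, m, hne, hac, hcb, hlm, h1, h2, h3, h4, h⟩,
      Sym2.mem_mk_left a b, Sym2.mem_mk_right a b⟩

end BipGraph

/-! ## The spherical building `𝓑⁸` -/

theorem noSquare_stage (n : ℕ) : (stage n).NoSquare := by
  induction n with
  | zero =>
    -- Two white vertices of the octagon have a common neighbour only if they are consecutive, and
    -- it is then unique.
    have : ∀ a b l : Fin 4, a ≠ b → (l = a ∨ l = a + 1) → (l = b ∨ l = b + 1) →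
      l = if b = a + 1 then b else a := by decide
    intro a b l m h1 h2 h3 h4
    by_cases hab : a = b
    · exact Or.inl hab
    · exact Or.inr ((this a b l hab h1 h2).trans (this a b m hab h3 h4).symm)
  | succ n ih => exact ih.complete

theorem exists_adj_stage (n : ℕ) :
    (∀ w : (stage n).White, ∃ b, (stage n).Adj w b) ∧
      ∀ b : (stage n).Black, ∃ w, (stage n).Adj w b := by
  induction n with
  | zero => exact ⟨fun w => ⟨w, Or.inl rfl⟩, fun b => ⟨b, Or.inl rfl⟩⟩
  | succ n ih =>
    constructor
    · rintro (w | ⟨s, a, b, rfl, h⟩)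
      · exact (ih.1 w).elim fun b hb => ⟨.inl b, hb⟩
      · exact ⟨.inl a, Sym2.mem_mk_left a b⟩
    · rintro (w | ⟨s, a, b, rfl, h⟩)
      · exact (ih.2 w).elim fun b hb => ⟨.inl b, hb⟩
      · exact ⟨.inl a, Sym2.mem_mk_left a b⟩

theorem embWhite_fst_le : ∀ (n : ℕ) (w : (stage n).White), (embWhite n w).1 ≤ n
  | 0, _ => le_rfl
  | n + 1, .inl w => (embWhite_fst_le n w).trans n.le_succ
  | _ + 1, .inr _ => le_rfl

theorem embBlack_fst_le : ∀ (n : ℕ) (b : (stage n).Black), (embBlack n b).1 ≤ n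
  | 0, _ => le_rfl
  | n + 1, .inl w => (embBlack_fst_le n w).trans n.le_succ
  | _ + 1, .inr _ => le_rfl

/-- The first component of an embedded vertex is the stage of its birth, which separates new
vertices from old ones. -/
theorem embWhite_injective (n : ℕ) : Function.Injective (embWhite n) := by
  induction n with
  | zero => exact fun a b h => sigma_mk_injective (β := NewWhite) h
  | succ n ih =>
    rintro (a | s) (b | t) h
    · exact congrArg _ (ih h)
    · have h1 : (embWhite n a).1 = n + 1 := congrArg Sigma.fst h
      have := embWhite_fst_le n a
      omega
    · have h1 : n + 1 = (embWhite n b).1 := congrArg Sigma.fst h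
      have := embWhite_fst_le n b
      omega
    · exact congrArg _ (sigma_mk_injective (β := NewWhite) (i := n + 1) h)

theorem embBlack_injective (n : ℕ) : Function.Injective (embBlack n) := by
  induction n with
  | zero => exact fun a b h => sigma_mk_injective (β := NewBlack) h
  | succ n ih =>
    rintro (a | s) (b | t) h
    · exact congrArg _ (ih h)
    · have h1 : (embBlack n a).1 = n + 1 := congrArg Sigma.fst h
      have := embBlack_fst_le n a
      omega
    · have h1 : n + 1 = (embBlack n b).1 := congrArg Sigma.fst h
      have := embBlack_fst_le n b
      omega
    · exact congrArg _ (sigma_mk_injective (β := NewBlack) (i := n + 1) h)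

theorem exists_lift {n N : ℕ} (h : n ≤ N) (w : (stage n).White) (b : (stage n).Black) :
    ∃ w' b', embWhite N w' = embWhite n w ∧ embBlack N b' = embBlack n b ∧
      ((stage N).Adj w' b' ↔ (stage n).Adj w b) := by
  induction N, h using Nat.le_induction with
  | base => exact ⟨w, b, rfl, rfl, Iff.rfl⟩
  | succ N _ ih =>
    obtain ⟨w', b', h1, h2, h3⟩ := ih
    exact ⟨.inl w', .inl b', h1, h2, h3⟩

/-- A completion step adds no edge between old vertices, so adjacency may be tested at any stage
containing both; this moves questions about the union to a finite stage. -/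
theorem adj_emb_iff {n : ℕ} {w : (stage n).White} {b : (stage n).Black} :
    B8.Adj (embWhite n w) (embBlack n b) ↔ (stage n).Adj w b := by
  constructor
  · rintro ⟨k, w', b', hw, hb, hadj⟩
    obtain ⟨w₁, b₁, h1, h2, h3⟩ := exists_lift (le_max_left n k) w b
    obtain ⟨w₂, b₂, h4, h5, h6⟩ := exists_lift (le_max_right n k) w' b'
    obtain rfl := embWhite_injective _ (h1.trans (hw.symm.trans h4.symm))
    obtain rfl := embBlack_injective _ (h2.trans (hb.symm.trans h5.symm))
    exact h3.1 (h6.2 hadj)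
  · exact fun h => ⟨n, w, b, rfl, rfl, h⟩

theorem exists_emb (w : B8.White) (b : B8.Black) :
    ∃ n, ∀ N, n ≤ N → (∃ w', embWhite N w' = w) ∧ ∃ b', embBlack N b' = b := by
  have h1 : ∃ n w', embWhite n w' = w := by
    obtain ⟨k, w⟩ := w
    cases k with
    | zero => exact ⟨0, w, rfl⟩
    | succ k => exact ⟨k + 1, .inr w, rfl⟩
  have h2 : ∃ n b', embBlack n b' = b := by
    obtain ⟨k, b⟩ := b
    cases k with
    | zero => exact ⟨0, b, rfl⟩
    | succ k => exact ⟨k + 1, .inr b, rfl⟩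
  obtain ⟨n, w', rfl⟩ := h1
  obtain ⟨m, b', rfl⟩ := h2
  refine ⟨max n m, fun N hN => ?_⟩
  obtain ⟨b₀, -⟩ := (exists_adj_stage n).1 w'
  obtain ⟨w₀, -⟩ := (exists_adj_stage m).2 b'
  obtain ⟨w₁, -, h1, -⟩ := exists_lift ((le_max_left n m).trans hN) w' b₀
  obtain ⟨-, b₂, -, h2, -⟩ := exists_lift ((le_max_right n m).trans hN) w₀ b'
  exact ⟨⟨w₁, h1⟩, b₂, h2⟩

theorem noSquare_B8 : B8.NoSquare := by
  intro a b l m h1 h2 h3 h4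
  obtain ⟨n₁, e₁⟩ := exists_emb a l
  obtain ⟨n₂, e₂⟩ := exists_emb b m
  obtain ⟨⟨a, rfl⟩, l, rfl⟩ := e₁ (max n₁ n₂) (le_max_left _ _)
  obtain ⟨⟨b, rfl⟩, m, rfl⟩ := e₂ (max n₁ n₂) (le_max_right _ _)
  rw [adj_emb_iff] at h1 h2 h3 h4
  exact (noSquare_stage _ h1 h2 h3 h4).imp (congrArg _) (congrArg _)

/-- All vertices of the path a - l - c - m - b are present at some stage, and the next one supplies
a common neighbour of its ends. -/
theorem joined_trans_white {a b c : B8.White} (hac : ∃ l, B8.Adj a l ∧ B8.Adj c l)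
    (hcb : ∃ l, B8.Adj c l ∧ B8.Adj b l) : ∃ l, B8.Adj a l ∧ B8.Adj b l := by
  obtain ⟨l, h1, h2⟩ := hac
  obtain ⟨m, h3, h4⟩ := hcb
  by_cases hab : a = b
  · exact ⟨l, h1, hab ▸ h1⟩
  by_cases hac : a = c
  · exact ⟨m, hac ▸ h3, h4⟩
  by_cases hcb : c = b
  · exact ⟨l, h1, hcb ▸ h2⟩
  by_cases hlm : l = m
  · exact ⟨l, h1, hlm ▸ h4⟩
  obtain ⟨n₁, e₁⟩ := exists_emb a l
  obtain ⟨n₂, e₂⟩ := exists_emb b m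
  obtain ⟨n₃, e₃⟩ := exists_emb c m
  obtain ⟨⟨a, rfl⟩, l, rfl⟩ := e₁ (max (max n₁ n₂) n₃) (by simp)
  obtain ⟨⟨b, rfl⟩, m, rfl⟩ := e₂ (max (max n₁ n₂) n₃) (by simp)
  obtain ⟨⟨c, rfl⟩, -⟩ := e₃ (max (max n₁ n₂) n₃) (by simp)
  rw [adj_emb_iff] at h1 h2 h3 h4
  obtain ⟨n, h5, h6⟩ := BipGraph.exists_common_complete (fun h => hab (congrArg _ h))
    (fun h => hac (congrArg _ h)) (fun h => hcb (congrArg _ h)) (fun h => hlm (congrArg _ h))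
    h1 h2 h3 h4
  exact ⟨_, (adj_emb_iff (n := _ + 1)).2 h5, (adj_emb_iff (n := _ + 1)).2 h6⟩

theorem joined_trans_black {a b c : B8.Black} (hac : ∃ l, B8.Adj l a ∧ B8.Adj l c)
    (hcb : ∃ l, B8.Adj l c ∧ B8.Adj l b) : ∃ l, B8.Adj l a ∧ B8.Adj l b := by
  obtain ⟨l, h1, h2⟩ := hac
  obtain ⟨m, h3, h4⟩ := hcb
  by_cases hab : a = b
  · exact ⟨l, h1, hab ▸ h1⟩
  by_cases hac : a = c
  · exact ⟨m, hac ▸ h3, h4⟩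
  by_cases hcb : c = b
  · exact ⟨l, h1, hcb ▸ h2⟩
  by_cases hlm : l = m
  · exact ⟨l, h1, hlm ▸ h4⟩
  obtain ⟨n₁, e₁⟩ := exists_emb l a
  obtain ⟨n₂, e₂⟩ := exists_emb m b
  obtain ⟨n₃, e₃⟩ := exists_emb m c
  obtain ⟨⟨l, rfl⟩, a, rfl⟩ := e₁ (max (max n₁ n₂) n₃) (by simp)
  obtain ⟨⟨m, rfl⟩, b, rfl⟩ := e₂ (max (max n₁ n₂) n₃) (by simp)
  obtain ⟨-, c, rfl⟩ := e₃ (max (max n₁ n₂) n₃) (by simp)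
  rw [adj_emb_iff] at h1 h2 h3 h4
  obtain ⟨n, h5, h6⟩ := BipGraph.exists_common_complete_swap (fun h => hab (congrArg _ h))
    (fun h => hac (congrArg _ h)) (fun h => hcb (congrArg _ h)) (fun h => hlm (congrArg _ h))
    h1 h2 h3 h4
  exact ⟨_, (adj_emb_iff (n := _ + 1)).2 h5, (adj_emb_iff (n := _ + 1)).2 h6⟩

theorem adj_oct_iff {w b : Fin 4} : B8.Adj (octWhite w) (octBlack b) ↔ b = w ∨ b = w + 1 :=
  adj_emb_iff (n := 0)

/-- A new white vertex is glued to an old black one, which has an old white neighbour; transitivity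
then connects it to the base vertex. -/
theorem joined_octWhite (n : ℕ) (w : (stage n).White) :
    ∃ l, B8.Adj (embWhite n w) l ∧ B8.Adj (octWhite 0) l := by
  induction n with
  | zero =>
    have h1 : ∃ l, B8.Adj (octWhite 1) l ∧ B8.Adj (octWhite 0) l :=
      ⟨octBlack 1, adj_oct_iff.2 (by decide), adj_oct_iff.2 (by decide)⟩
    have h2 : ∃ l, B8.Adj (octWhite 2) l ∧ B8.Adj (octWhite 1) l :=
      ⟨octBlack 2, adj_oct_iff.2 (by decide), adj_oct_iff.2 (by decide)⟩
    change Fin 4 at w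
    change ∃ l, B8.Adj (octWhite w) l ∧ B8.Adj (octWhite 0) l
    fin_cases w
    · exact ⟨octBlack 0, adj_oct_iff.2 (by decide), adj_oct_iff.2 (by decide)⟩
    · exact h1
    · exact joined_trans_white h2 h1
    · exact ⟨octBlack 0, adj_oct_iff.2 (by decide), adj_oct_iff.2 (by decide)⟩
  | succ n ih =>
    obtain w | ⟨s, a, b, rfl, h⟩ := w
    · exact ih w
    · obtain ⟨w, hw⟩ := (exists_adj_stage n).2 a
      refine joined_trans_white ⟨embBlack n a, ?_, adj_emb_iff.2 hw⟩ (ih w)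
      exact (adj_emb_iff (n := n + 1) (b := Sum.inl a)).2 (Sym2.mem_mk_left a b)

theorem joined_octBlack (n : ℕ) (b : (stage n).Black) :
    ∃ l, B8.Adj l (embBlack n b) ∧ B8.Adj l (octBlack 0) := by
  induction n with
  | zero =>
    have h1 : ∃ l, B8.Adj l (octBlack 1) ∧ B8.Adj l (octBlack 0) :=
      ⟨octWhite 0, adj_oct_iff.2 (by decide), adj_oct_iff.2 (by decide)⟩
    have h2 : ∃ l, B8.Adj l (octBlack 2) ∧ B8.Adj l (octBlack 1) :=
      ⟨octWhite 1, adj_oct_iff.2 (by decide), adj_oct_iff.2 (by decide)⟩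
    change Fin 4 at b
    change ∃ l, B8.Adj l (octBlack b) ∧ B8.Adj l (octBlack 0)
    fin_cases b
    · exact ⟨octWhite 0, adj_oct_iff.2 (by decide), adj_oct_iff.2 (by decide)⟩
    · exact h1
    · exact joined_trans_black h2 h1
    · exact ⟨octWhite 3, adj_oct_iff.2 (by decide), adj_oct_iff.2 (by decide)⟩
  | succ n ih =>
    obtain w | ⟨s, a, b, rfl, h⟩ := b
    · exact ih w
    · obtain ⟨w, hw⟩ := (exists_adj_stage n).1 a
      refine joined_trans_black ⟨embWhite n a, ?_, adj_emb_iff.2 hw⟩ (ih w)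
      exact (adj_emb_iff (n := n + 1) (w := Sum.inl a)).2 (Sym2.mem_mk_left a b)

theorem joins_B8 : B8.Joins := by
  intro a b
  obtain ⟨n, h⟩ := exists_emb a (octBlack 0)
  obtain ⟨m, h'⟩ := exists_emb b (octBlack 0)
  obtain ⟨⟨a, rfl⟩, -⟩ := h n le_rfl
  obtain ⟨⟨b, rfl⟩, -⟩ := h' m le_rfl
  exact joined_trans_white (joined_octWhite n a)
    ((joined_octWhite m b).imp fun _ h => ⟨h.2, h.1⟩)

theorem joins_swap_B8 : B8.swap.Joins := by
  intro a b
  obtain ⟨n, h⟩ := exists_emb (octWhite 0) a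
  obtain ⟨m, h'⟩ := exists_emb (octWhite 0) b
  obtain ⟨-, a, rfl⟩ := h n le_rfl
  obtain ⟨-, b, rfl⟩ := h' m le_rfl
  exact joined_trans_black (joined_octBlack n a)
    ((joined_octBlack m b).imp fun _ h => ⟨h.2, h.1⟩)

theorem exists_consecutive : ∀ i j k : Fin 4, i ≠ j → i ≠ k → j ≠ k → ∃ a c : Fin 4, c ≠ a ∧
    c ≠ a + 1 ∧ (a = i ∨ a = j ∨ a = k) ∧ (a + 1 = i ∨ a + 1 = j ∨ a + 1 = k) ∧
      (c = i ∨ c = j ∨ c = k) := by decide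

/-- Any three of the four white vertices of the octagon include two consecutive ones. Without
squares, their only common neighbour is the octagon vertex between them, which is not adjacent to a
third. -/
theorem hasQuadrangle_B8 : B8.HasQuadrangle := by
  refine ⟨octWhite, fun l i j k hij hik hjk hi hj hk => ?_⟩
  have hall : ∀ a, (a = i ∨ a = j ∨ a = k) → B8.Adj (octWhite a) l := by
    rintro a (rfl | rfl | rfl) <;> assumption
  obtain ⟨a, c, h1, h2, ha, ha', hc⟩ := exists_consecutive i j k hij hik hjk
  rcases noSquare_B8 (hall _ ha) (hall _ ha') (adj_oct_iff.2 (Or.inr rfl))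
    (adj_oct_iff.2 (Or.inl rfl)) with h | h
  · have := octWhite_inj h
    exact absurd this (by clear * -; revert a; decide)
  · rcases adj_oct_iff.1 (h ▸ hall _ hc) with h | h
    · exact h2 h.symm
    · exact h1 (add_right_cancel h).symm

theorem hasQuadrangle_swap_B8 : B8.swap.HasQuadrangle := by
  refine ⟨octBlack, fun l i j k hij hik hjk hi hj hk => ?_⟩
  have hall : ∀ a, (a = i ∨ a = j ∨ a = k) → B8.Adj l (octBlack a) := by
    rintro a (rfl | rfl | rfl) <;> assumption
  obtain ⟨a, c, h1, h2, ha, ha', hc⟩ := exists_consecutive i j k hij hik hjk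
  rcases noSquare_B8 (hall _ ha) (adj_oct_iff.2 (Or.inl rfl)) (hall _ ha')
    (adj_oct_iff.2 (Or.inr rfl)) with h | h
  · rcases adj_oct_iff.1 (h ▸ hall _ hc) with h | h
    · exact h1 h
    · exact h2 h
  · have := octBlack_inj h
    exact absurd this (by clear * -; revert a; decide)

theorem isThick_B8 : B8.IsThick :=
  BipGraph.isThick_of_joins noSquare_B8 joins_B8 joins_swap_B8 hasQuadrangle_B8
    hasQuadrangle_swap_B8

/-! ## The sheets in order of decreasing real part -/

section Sorted

variable {x : ℂ} {s s' : Fin 3 → ℂ}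

/-- If p - q = iβ, then r^2 = 4 + β^2/3 is real and at least 4, and P(p) - P(q) = r (iβ)^3 / 4 is
imaginary. So whenever the order of two sheets is ambiguous, their developed coordinates agree. -/
theorem re_eq_aux {p q r : ℂ} (h1 : p + q + r = 0) (h2 : p * q + p * r + q * r = -3)
    (hre : p.re = q.re) : r.im = 0 ∧ 4 ≤ r.re ^ 2 ∧ (primitive p).re = (primitive q).re := by
  set β := (p - q).im with hβ
  have hδ : p - q = β * Complex.I := by
    apply Complex.ext
    · simp [hre]
    · simp [hβ]
  have hr2 : r ^ 2 = ((4 + β ^ 2 / 3 : ℝ) : ℂ) := by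
    have := sq_sub_roots h1 h2
    rw [hδ] at this
    push_cast
    linear_combination this / 3 - (β : ℂ) ^ 2 / 3 * Complex.I_sq
  obtain ⟨hrim, -⟩ := im_eq_zero_of_sq_pos hr2 (by positivity)
  refine ⟨hrim, ?_, ?_⟩
  · have := congrArg Complex.re hr2
    simp only [pow_two, Complex.mul_re, hrim, Complex.ofReal_re] at this
    nlinarith [mul_self_nonneg β]
  · have hr : r = (r.re : ℂ) := by apply Complex.ext <;> simp [hrim]
    have hd := primitive_sub h1 h2
    have : primitive p - primitive q = ((-(r.re * β ^ 3) / 4 : ℝ) : ℂ) * Complex.I := by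
      rw [hd, hδ, hr, Complex.ofReal_re]
      push_cast
      linear_combination ((r.re : ℂ) * β ^ 3 * Complex.I / 4) * Complex.I_sq
    have := congrArg Complex.re this
    rw [Complex.mul_I_re, Complex.ofReal_im, neg_zero, Complex.sub_re] at this
    linarith

theorem IsFibre.of_re_eq (h : IsFibre x s) {i j : Fin 3} (hij : i ≠ j)
    (hre : (s i).re = (s j).re) :
    x.im = 0 ∧ 4 ≤ x.re ^ 2 ∧ (primitive (s i)).re = (primitive (s j)).re := by
  obtain ⟨π, rfl, rfl⟩ : ∃ π : Equiv.Perm (Fin 3), π 0 = i ∧ π 1 = j := by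
    clear hre; revert i j; decide
  have ht := h.comp_perm π
  obtain ⟨e1, e2, e3⟩ := re_eq_aux ht.sum ht.pairs hre
  have hr : s (π 2) = ((s (π 2)).re : ℂ) := by apply Complex.ext <;> simp [e1]
  have hx := h.over (π 2)
  unfold Over at hx
  generalize (s (π 2)).re = ρ at hr e2
  have hx' : x = ((3 * ρ - ρ ^ 3 : ℝ) : ℂ) := by
    rw [hr] at hx
    push_cast
    linear_combination hx
  refine ⟨by rw [hx', Complex.ofReal_im], ?_, e3⟩
  rw [hx', Complex.ofReal_re]
  have h1 : 1 ≤ (ρ ^ 2 - 3) ^ 2 := by nlinarith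
  have h2 : (3 * ρ - ρ ^ 3) ^ 2 = ρ ^ 2 * (ρ ^ 2 - 3) ^ 2 := by ring
  rw [h2]
  nlinarith

/-- Two decreasing arrangements of the same three real parts are the same list, even if tied roots
are exchanged. -/
theorem re_eq_of_sorted (h : IsFibre x s) (h' : IsFibre x s') (h1 : (s 1).re ≤ (s 0).re)
    (h2 : (s 2).re ≤ (s 1).re) (h1' : (s' 1).re ≤ (s' 0).re) (h2' : (s' 2).re ≤ (s' 1).re) :
    ∃ π : Equiv.Perm (Fin 3), ∀ i, s' i = s (π i) ∧ (s (π i)).re = (s i).re := by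
  obtain ⟨π, hπ⟩ := h.exists_perm h'
  refine ⟨π, fun i => ⟨hπ i, ?_⟩⟩
  have anti : ∀ f : Fin 3 → ℝ, f 1 ≤ f 0 → f 2 ≤ f 1 → Monotone fun i => -f i := by
    intro f h1 h2
    rw [Fin.monotone_iff_le_succ]
    intro i
    fin_cases i
    · simpa using h1
    · simpa using h2
  have e := Tuple.unique_monotone (f := fun i => -(s i).re) (σ := π) (τ := 1)
    (by
      have := anti (fun i => (s' i).re) h1' h2'
      change Monotone fun i => -(s (π i)).re
      simpa only [hπ] using this) (anti (fun i => (s i).re) h1 h2)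
  have := congrFun e i
  simpa using this

theorem primitive_re_eq_of_sorted (h : IsFibre x s) (h' : IsFibre x s')
    (h1 : (s 1).re ≤ (s 0).re) (h2 : (s 2).re ≤ (s 1).re) (h1' : (s' 1).re ≤ (s' 0).re)
    (h2' : (s' 2).re ≤ (s' 1).re) (i : Fin 3) :
    (primitive (s' i)).re = (primitive (s i)).re := by
  obtain ⟨π, hπ⟩ := re_eq_of_sorted h h' h1 h2 h1' h2'
  rw [(hπ i).1]
  by_cases hi : π i = i
  · rw [hi]
  · exact (h.of_re_eq hi (hπ i).2).2.2

theorem eq_of_sorted (h : IsFibre x s) (h' : IsFibre x s')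
    (h1 : (s 1).re ≤ (s 0).re) (h2 : (s 2).re ≤ (s 1).re) (h1' : (s' 1).re ≤ (s' 0).re)
    (h2' : (s' 2).re ≤ (s' 1).re) (hx : ¬ (x.im = 0 ∧ 4 ≤ x.re ^ 2)) : s' = s := by
  obtain ⟨π, hπ⟩ := re_eq_of_sorted h h' h1 h2 h1' h2'
  funext i
  rw [(hπ i).1]
  by_cases hi : π i = i
  · rw [hi]
  · exact absurd ((h.of_re_eq hi (hπ i).2).imp_right And.left) hx

theorem norm_root_le {p : ℂ} (h : Over x p) : ‖p‖ ≤ ‖x‖ + 2 := by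
  unfold Over at h
  by_contra! hlt
  have h1 : p ^ 3 = 3 * p - x := by linear_combination h
  have h2 : ‖p‖ ^ 3 ≤ 3 * ‖p‖ + ‖x‖ := by
    rw [← norm_pow, h1]
    refine (norm_sub_le _ _).trans ?_
    simp
  nlinarith [norm_nonneg x, norm_nonneg p, mul_pos (show (0 : ℝ) < ‖p‖ by linarith [norm_nonneg x])
    (show 0 < ‖p‖ - 2 by linarith [norm_nonneg x]), sq_nonneg (‖p‖ - 2),
    mul_nonneg (norm_nonneg x) (norm_nonneg p)]

/-- A continuous function of the sorted sheets that takes a single value on the sorted fibres over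
`x₀` is continuous at `x₀`. -/
theorem tendsto_sheet {Y : Type*} [TopologicalSpace Y] {F : (Fin 3 → ℂ) → Y} (hF : Continuous F)
    {x₀ : ℂ} {y₀ : Y} (h : ∀ s, IsFibre x₀ s → (s 1).re ≤ (s 0).re → (s 2).re ≤ (s 1).re →
      F s = y₀) : Filter.Tendsto (fun x => F (sheet x)) (𝓝 x₀) (𝓝 y₀) := by
  -- The roots stay bounded, so along any sequence the sorted fibres subconverge, and the limit is a
  -- sorted fibre over x₀, on which F has the prescribed value.
  refine Filter.tendsto_of_subseq_tendsto fun u hu => ?_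
  obtain ⟨R, hR⟩ := (hu.norm.isBoundedUnder_le).eventually_le
  have hK : IsCompact (Set.pi Set.univ fun _ : Fin 3 => Metric.closedBall (0 : ℂ) (R + 2)) :=
    isCompact_univ_pi fun _ => isCompact_closedBall _ _
  have hev : ∀ᶠ n in Filter.atTop, sheet (u n) ∈
      Set.pi Set.univ fun _ : Fin 3 => Metric.closedBall (0 : ℂ) (R + 2) := by
    filter_upwards [hR] with n hn i _
    rw [mem_closedBall_zero_iff]
    exact (norm_root_le ((isFibre_sheet (u n)).over i)).trans (by linarith)
  obtain ⟨s, -, φ, hφ, hs⟩ := hK.tendsto_subseq' hev.frequently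
  refine ⟨φ, ?_⟩
  have hsi : ∀ i, Filter.Tendsto (fun n => sheet (u (φ n)) i) Filter.atTop (𝓝 (s i)) :=
    fun i => (tendsto_pi_nhds.1 hs) i
  have hre : ∀ i, Filter.Tendsto (fun n => (sheet (u (φ n)) i).re) Filter.atTop (𝓝 (s i).re) :=
    fun i => (Complex.continuous_re.tendsto _).comp (hsi i)
  have hfib : IsFibre x₀ s := by
    intro p
    have h1 : Filter.Tendsto (fun n => p ^ 3 - 3 * p + u (φ n)) Filter.atTop
        (𝓝 (p ^ 3 - 3 * p + x₀)) := (hu.comp hφ.tendsto_atTop).const_add _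
    have h2 : Filter.Tendsto (fun n => (p - sheet (u (φ n)) 0) * (p - sheet (u (φ n)) 1) *
        (p - sheet (u (φ n)) 2)) Filter.atTop (𝓝 ((p - s 0) * (p - s 1) * (p - s 2))) :=
      (((hsi 0).const_sub p).mul ((hsi 1).const_sub p)).mul ((hsi 2).const_sub p)
    exact tendsto_nhds_unique h1 (h2.congr fun n => (isFibre_sheet (u (φ n)) p).symm)
  rw [← h s hfib (le_of_tendsto_of_tendsto' (hre 1) (hre 0) fun n => (sheet_re_anti _).1)
    (le_of_tendsto_of_tendsto' (hre 2) (hre 1) fun n => (sheet_re_anti _).2)]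
  exact (hF.tendsto s).comp hs

theorem continuousAt_sheet (hx : ¬ (x.im = 0 ∧ 4 ≤ x.re ^ 2)) (i : Fin 3) :
    ContinuousAt (fun y => sheet y i) x :=
  tendsto_sheet (F := fun s => s i) (continuous_apply i) fun s hs h1 h2 => by
    rw [eq_of_sorted (isFibre_sheet x) hs (sheet_re_anti x).1 (sheet_re_anti x).2 h1 h2 hx]

theorem develop_apply (x : ℂ) (i : Fin 3) : (develop x).1 i = (primitive (sheet x i)).re := by
  fin_cases i <;> rfl

theorem develop_eq_of_sorted (h : IsFibre x s) (h1 : (s 1).re ≤ (s 0).re)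
    (h2 : (s 2).re ≤ (s 1).re) (i : Fin 3) : (develop x).1 i = (primitive (s i)).re := by
  rw [develop_apply]
  exact primitive_re_eq_of_sorted h (isFibre_sheet x) h1 h2 (sheet_re_anti x).1
    (sheet_re_anti x).2 i

theorem continuous_primitive : Continuous primitive := by
  unfold primitive
  fun_prop

theorem continuous_develop : Continuous develop := by
  rw [continuous_induced_rng]
  have : (Subtype.val ∘ develop) = fun x =>
      WithLp.toLp 2 fun i => (primitive (sheet x i)).re := by
    funext x
    ext i
    exact develop_apply x i
  rw [this]
  refine (PiLp.continuous_toLp 2 _).comp (continuous_pi fun i => ?_)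
  rw [continuous_iff_continuousAt]
  intro x
  refine tendsto_sheet (F := fun s => (primitive (s i)).re) (Complex.continuous_re.comp
    (continuous_primitive.comp (continuous_apply i))) fun s hs h1 h2 => ?_
  exact primitive_re_eq_of_sorted (isFibre_sheet x) hs (sheet_re_anti x).1 (sheet_re_anti x).2
    h1 h2 i

end Sorted

/-! ## Harmonic maps are developed by the primitive -/

/-- Near `x₀` the masses of `h` are those of the real parts of the primitive on the sections `s`
of the spectral cover, shifted by the constants `c`. -/
structure Develops {G : BipGraph} (h : ℂ → Cone G) (x₀ : ℂ) (s : Fin 3 → ℂ → ℂ) (c : Fin 3 → ℝ) :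
    Prop where
  sum_eq_zero : ∑ i, c i = 0
  eventually : ∀ᶠ y in 𝓝 x₀, (∀ i, ContinuousAt (s i) y) ∧ IsFibre y (fun i => s i y) ∧
    (h y).whiteMass = topMass (fun i => (primitive (s i y)).re + c i) ∧
    (h y).blackMass = bottomMass (fun i => (primitive (s i y)).re + c i)

section Develops

variable {G : BipGraph} {h : ℂ → Cone G} {x₀ : ℂ} {s s' : Fin 3 → ℂ → ℂ} {c c' : Fin 3 → ℝ}

theorem Develops.eventually_develops (D : Develops h x₀ s c) : ∀ᶠ y in 𝓝 x₀, Develops h y s c :=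
  (eventually_eventually_nhds.2 D.eventually).mono fun _ hy => ⟨D.sum_eq_zero, hy⟩

theorem hasDerivAt_primitive_section {s : ℂ → ℂ} {y : ℂ} (hc : ContinuousAt s y)
    (hs : ∀ᶠ z in 𝓝 y, Over z (s z)) : HasDerivAt (fun z => primitive (s z)) (s y) y := by
  simpa using hasDerivAt_primitive (hasDerivAt_id y) hc hs

/-- On a ball, θ_i and P on the section s_i have the same derivative, so they differ by a constant;
the constants sum to zero because both sets of coordinates do. -/
theorem exists_develops {U : Set ℂ} (hU : U ∈ 𝓝 x₀) {H : Hexagon G} {g : ℂ → Apt}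
    {s θ : Fin 3 → ℂ → ℂ} (hh : ∀ y ∈ U, h y = H.chart (g y)) (hs : ∀ i, ContinuousOn (s i) U)
    (hf : ∀ y ∈ U, IsFibre y (fun i => s i y)) (hθ : ∀ i, ∀ y ∈ U, HasDerivAt (θ i) (s i y) y)
    (hg : ∀ i, ∀ y ∈ U, (g y).1 i = (θ i y).re) : ∃ c, Develops h x₀ s c := by
  obtain ⟨ε, hε, hB⟩ := Metric.mem_nhds_iff.1 hU
  have hx₀ : x₀ ∈ Metric.ball x₀ ε := Metric.mem_ball_self hε
  have hd : ∀ i, ∀ y ∈ Metric.ball x₀ ε,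
      HasDerivAt (fun z => θ i z - primitive (s i z)) 0 y := by
    intro i y hy
    have hUy : U ∈ 𝓝 y := Filter.mem_of_superset (Metric.isOpen_ball.mem_nhds hy) hB
    have h1 := hasDerivAt_primitive_section ((hs i).continuousAt hUy)
      (Filter.mem_of_superset hUy fun z hz => (hf z hz).over i)
    simpa using (hθ i y (hB hy)).fun_sub h1
  have hconst : ∀ i, ∀ y ∈ Metric.ball x₀ ε,
      θ i y - primitive (s i y) = θ i x₀ - primitive (s i x₀) := by
    intro i y hy
    exact Metric.isOpen_ball.is_const_of_deriv_eq_zero (convex_ball x₀ ε).isPreconnected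
      (f := fun z => θ i z - primitive (s i z))
      (fun z hz => (hd i z hz).differentiableAt.differentiableWithinAt)
      (fun z hz => (hd i z hz).deriv) hy hx₀
  have hgc : ∀ i, ∀ y ∈ Metric.ball x₀ ε, (g y).1 i =
      (primitive (s i y)).re + (θ i x₀ - primitive (s i x₀)).re := by
    intro i y hy
    rw [← hconst i y hy, hg i y (hB hy), Complex.sub_re]
    ring
  refine ⟨fun i => (θ i x₀ - primitive (s i x₀)).re, ?_, ?_⟩
  · have h1 := congrArg Complex.re (hf x₀ (hB hx₀)).primitive_sum
    have h2 := (g x₀).2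
    rw [hg 0 x₀ (hB hx₀), hg 1 x₀ (hB hx₀), hg 2 x₀ (hB hx₀)] at h2
    rw [Fin.sum_univ_three] at h1 ⊢
    simp only [Complex.add_re, Complex.sub_re, Complex.zero_re] at h1 ⊢
    linarith
  · filter_upwards [Metric.isOpen_ball.mem_nhds hx₀] with y hy
    have hUy : U ∈ 𝓝 y := Filter.mem_of_superset (Metric.isOpen_ball.mem_nhds hy) hB
    have e : (g y).1.ofLp = fun i => (primitive (s i y)).re + (θ i x₀ - primitive (s i x₀)).re :=
      funext fun i => hgc i y hy
    refine ⟨fun i => (hs i).continuousAt hUy, hf y (hB hy), ?_, ?_⟩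
    · rw [hh y (hB hy), H.whiteMass_chart, e]
    · rw [hh y (hB hy), H.blackMass_chart, e]

theorem eq_zero_of_re_eventually_const {f : ℂ → ℂ} {f' y : ℂ} {K : ℝ} (hf : HasDerivAt f f' y)
    (hK : ∀ᶠ z in 𝓝 y, (f z).re = K) : f' = 0 := by
  have h1 := Complex.reCLM.hasFDerivAt.comp y hf.complexToReal_fderiv
  have h2 : HasFDerivAt (fun z => (f z).re) (0 : ℂ →L[ℝ] ℝ) y :=
    (hasFDerivAt_const K y).congr_of_eventuallyEq hK
  -- Evaluating the vanishing differential at the conjugate of f' yields |f'|^2 = 0.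
  have h3 := DFunLike.congr_fun (h1.unique h2) (starRingEnd ℂ f')
  simp [Complex.mul_conj] at h3
  simpa using h3

/-- Real linear relations between the roots do not hold on an open set. -/
theorem eq_zero_of_eventually_relation {a b : ℝ} (hs : ∀ᶠ y in 𝓝 x₀, IsFibre y (fun i => s i y))
    (hab : ∀ᶠ y in 𝓝 x₀, a * s 0 y + b * s 1 y = 0) : a = 0 ∧ b = 0 := by
  by_cases hq : a ^ 2 - a * b + b ^ 2 = 0
  · have h1 : (a - b) ^ 2 + a ^ 2 + b ^ 2 = 0 := by linear_combination 2 * hq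
    constructor <;> nlinarith [sq_nonneg (a - b), sq_nonneg a, sq_nonneg b]
  exfalso
  set q := a ^ 2 - a * b + b ^ 2 with hqdef
  -- With the sum and pair relations, a linear relation determines the squares and the product of
  -- the two roots, hence y^2; only two points y are possible.
  have key : ∀ᶠ y in 𝓝 x₀, y ^ 2 = ((27 * (a * b * (a - b)) ^ 2 / q ^ 3 : ℝ) : ℂ) := by
    filter_upwards [hs, hab] with y h1 h2
    have e1 := h1.sum
    have e2 := h1.pairs
    have e3 := h1.prod
    have h3 : s 2 y = -s 0 y - s 1 y := by linear_combination e1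
    simp only [h3] at e2 e3
    generalize s 0 y = p at *
    generalize s 1 y = r at *
    have hqC : (q : ℂ) ≠ 0 := by exact_mod_cast hq
    have hqe : (q : ℂ) = a ^ 2 - a * b + b ^ 2 := by rw [hqdef]; push_cast; ring
    have f1 : (q : ℂ) * r ^ 2 = 3 * a ^ 2 := by
      rw [hqe]; linear_combination (-a ^ 2) * e2 - (a * p - b * r + a * r) * h2
    have f2 : (q : ℂ) * p ^ 2 = 3 * b ^ 2 := by
      rw [hqe]; linear_combination (-b ^ 2) * e2 - (b * r - a * p + b * p) * h2
    have f3 : (q : ℂ) * (p * r) = -3 * (a * b) := by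
      rw [hqe]; linear_combination (a * b) * e2 + (a * r + b * p) * h2
    have f4 : (q : ℂ) ^ 3 * y ^ 2 = 27 * (a * b * (a - b)) ^ 2 := by
      have : y = p * r * (p + r) := by linear_combination e3
      have e : (q : ℂ) ^ 3 * y ^ 2 = (q * (p * r)) ^ 2 * (q * p ^ 2 + q * r ^ 2 + 2 * (q * (p * r))) := by
        rw [this]; ring
      rw [e, f1, f2, f3]
      ring
    push_cast
    rw [eq_div_iff (pow_ne_zero 3 hqC)]
    linear_combination f4
  have hinf := infinite_of_mem_nhds x₀ key
  refine hinf (Set.Finite.subset (Set.toFinite {x₀, -x₀}) fun y hy => ?_)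
  have hy : y ^ 2 = _ := hy
  rw [← key.self_of_nhds] at hy
  exact sq_eq_sq_iff_eq_or_eq_neg.1 hy

/-- Equality of masses gives equality of squared norms. After matching the sections, the terms
quadratic in P cancel, so a real combination of the Re P is constant. Differentiation turns it into
a linear relation between the roots, which must be a multiple of their sum; as the constants of each
development sum to zero, the difference vanishes. -/
theorem Develops.unique (hx₀ : x₀ ∉ branchPoints) (D : Develops h x₀ s c)
    (D' : Develops h x₀ s' c') {i j : Fin 3} (e : s i x₀ = s' j x₀) : c i = c' j := by
  obtain ⟨hc0, hf0, -, -⟩ := D.eventually.self_of_nhds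
  obtain ⟨hc0', hf0', -, -⟩ := D'.eventually.self_of_nhds
  have hinj := hf0.injective hx₀
  obtain ⟨π, hπ⟩ := hf0.exists_perm hf0'
  have heq : ∀ k, ∀ᶠ y in 𝓝 x₀, s' k y = s (π k) y := by
    intro k
    have hne : ∀ l, l ≠ π k → ∀ᶠ y in 𝓝 x₀, s' k y ≠ s l y := by
      intro l hl
      have h0 : s' k x₀ - s l x₀ ≠ 0 :=
        sub_ne_zero.2 fun h => hl (hinj (h.symm.trans (hπ k)))
      filter_upwards [((hc0' k).sub (hc0 l)).eventually_ne h0] with y hy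
      exact sub_ne_zero.1 hy
    have hall : ∀ᶠ y in 𝓝 x₀, ∀ l, l ≠ π k → s' k y ≠ s l y :=
      Filter.eventually_all.2 fun l => by
        by_cases hl : l = π k
        · exact Filter.Eventually.of_forall fun y hn => absurd hl hn
        · exact (hne l hl).mono fun y hy _ => hy
    filter_upwards [hall, D.eventually, D'.eventually] with y h1 h2 h3
    obtain ⟨l, hl⟩ := h2.2.1.exists_eq (h3.2.1.over k)
    by_cases hlk : l = π k
    · rw [← hlk]; exact hl.symm
    · exact absurd hl.symm (h1 l hlk)
  set k : Fin 3 → ℝ := fun l => c l - c' (π.symm l) with hk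
  have hksum : k 0 + k 1 + k 2 = 0 := by
    have h1 := D.sum_eq_zero
    have h2 := D'.sum_eq_zero
    rw [← Equiv.sum_comp π.symm] at h2
    rw [Fin.sum_univ_three] at h1 h2
    simp only [hk]
    linarith
  have hcst : ∀ᶠ y in 𝓝 x₀, (∑ l, (k l : ℂ) * primitive (s l y)).re =
      (∑ l, c' (π.symm l) ^ 2 - ∑ l, c l ^ 2) / 2 := by
    filter_upwards [D.eventually, D'.eventually, Filter.eventually_all.2 heq] with y h1 h2 h3
    have hP := congrArg Complex.re h1.2.1.primitive_sum
    have hP' := congrArg Complex.re h2.2.1.primitive_sum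
    rw [Complex.re_sum] at hP hP' ⊢
    have q1 := sum_sq_eq_mass (u := fun i => (primitive (s i y)).re + c i)
      (by rw [Finset.sum_add_distrib, D.sum_eq_zero, hP]; simp)
    have q2 := sum_sq_eq_mass (u := fun i => (primitive (s' i y)).re + c' i)
      (by rw [Finset.sum_add_distrib, D'.sum_eq_zero, hP']; simp)
    rw [← h1.2.2.1, ← h1.2.2.2] at q1
    rw [← h2.2.2.1, ← h2.2.2.2, ← q1, ← Equiv.sum_comp π.symm] at q2
    simp only [h3, Equiv.apply_symm_apply] at q2
    simp only [Fin.sum_univ_three, Complex.re_ofReal_mul, hk] at q2 ⊢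
    linarith
  have hrel : ∀ᶠ y in 𝓝 x₀, ∑ l, (k l : ℂ) * s l y = 0 := by
    filter_upwards [eventually_eventually_nhds.2 hcst, eventually_eventually_nhds.2 D.eventually]
      with y h1 h2
    refine eq_zero_of_re_eventually_const (HasDerivAt.fun_sum fun l _ => ?_) h1
    exact (hasDerivAt_primitive_section (h2.self_of_nhds.1 l)
      (h2.mono fun z hz => hz.2.1.over l)).const_mul _
  -- Subtracting k 2 times the sum of the roots eliminates the third root.
  obtain ⟨ha, hb⟩ := eq_zero_of_eventually_relation (a := k 0 - k 2) (b := k 1 - k 2)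
    (D.eventually.mono fun y hy => hy.2.1) (by
      filter_upwards [hrel, D.eventually] with y h1 h2
      rw [Fin.sum_univ_three] at h1
      push_cast
      linear_combination h1 - (k 2 : ℂ) * h2.2.1.sum)
  have hk0 : ∀ l, k l = 0 := by
    intro l
    fin_cases l
    · change k 0 = 0; linarith
    · change k 1 = 0; linarith
    · change k 2 = 0; linarith
  have hij : π j = i := (hinj (e.trans (hπ j))).symm
  have := hk0 i
  simp only [hk, ← hij, Equiv.symm_apply_apply] at this
  rw [← hij]
  linarith

end Develops

theorem countable_of_locally_finite {N : Set ℂ} (hN : ∀ x, ∃ V ∈ 𝓝 x, (V ∩ N).Finite) :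
    N.Countable := by
  choose V hV hfin using hN
  obtain ⟨t, ht, hcov⟩ := TopologicalSpace.countable_cover_nhds hV
  refine (ht.biUnion fun x _ => (hfin x).countable).mono fun y hy => ?_
  have : y ∈ ⋃ x ∈ t, V x := hcov ▸ Set.mem_univ y
  simp only [Set.mem_iUnion] at this ⊢
  obtain ⟨x, hx, hyx⟩ := this
  exact ⟨x, hx, hyx, hy⟩

theorem IsFibre.mass_eq_develop {x : ℂ} {s : Fin 3 → ℂ} (hs : IsFibre x s) :
    topMass (fun i => (primitive (s i)).re) = topMass (develop x).1 ∧
      bottomMass (fun i => (primitive (s i)).re) = bottomMass (develop x).1 := by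
  obtain ⟨π, hπ⟩ := hs.exists_perm (isFibre_sheet x)
  have := mass_perm (u := (develop x).1) (u' := fun i => (primitive (s i)).re) (π := π)
    fun i => by rw [develop_apply, hπ i]
  exact this

/-- The masses of a harmonic map are those of the developing map. -/
theorem IsHarmonicPhiMap.mass_eq {G : BipGraph} {h : ℂ → Cone G} (hh : IsHarmonicPhiMap h)
    (x : ℂ) : (h x).whiteMass = topMass (develop x).1 ∧
      (h x).blackMass = bottomMass (develop x).1 := by
  obtain ⟨hcont, N, hN, hloc⟩ := hh
  have hNc : (N ∪ branchPoints).Countable := by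
    refine (countable_of_locally_finite hN).union ?_
    rw [branchPoints_eq]
    exact (Set.toFinite _).countable
  set M := N ∪ branchPoints with hM
  have hdev : ∀ y ∉ M, ∃ s c, Develops h y s c := by
    intro y hy
    obtain ⟨U, hU, H, g, s, θ, h1, h2, h3, h4, h5⟩ := hloc y fun hy' => hy (Or.inl hy')
    exact ⟨s, exists_develops hU h1 h2 h3 h4 h5⟩
  have hnb : ∀ y ∉ M, y ∉ branchPoints := fun y hy hy' => hy (Or.inr hy')
  have key : ∀ y ∉ M, ∀ s c, Develops h y s c → ∀ i, c i = 0 := by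
    -- The spectral curve is the p-plane. Over a countable set of x there are countably many p, and
    -- the complement of a countable set in the plane is connected.
    set E : Set ℂ := {p | 3 * p - p ^ 3 ∈ M} with hE
    have hEc : E.Countable := by
      have : E = ⋃ y ∈ M, {p | 3 * p - p ^ 3 = y} := by ext p; simp [hE]
      rw [this]
      refine hNc.biUnion fun y _ => ?_
      refine ((Set.finite_range (sheet y)).subset fun p hp => ?_).countable
      have hp : 3 * p - p ^ 3 = y := hp
      exact (isFibre_sheet y).exists_eq (by unfold Over; linear_combination -hp)
    have hconn : IsPreconnected Eᶜ :=
      (hEc.isPathConnected_compl_of_one_lt_rank (by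
        rw [Complex.rank_real_complex]; norm_num)).isConnected.isPreconnected
    have hval : ∀ p : (Eᶜ : Set ℂ), ∃ (c : ℝ) (s : Fin 3 → ℂ → ℂ) (c' : Fin 3 → ℝ) (i : Fin 3),
        Develops h (3 * p.1 - p.1 ^ 3) s c' ∧ s i (3 * p.1 - p.1 ^ 3) = p.1 ∧ c = c' i := by
      intro p
      obtain ⟨s, c', D⟩ := hdev _ p.2
      obtain ⟨i, hi⟩ := D.eventually.self_of_nhds.2.1.exists_eq (p := p.1)
        (by unfold Over; ring)
      exact ⟨c' i, s, c', i, D, hi, rfl⟩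
    choose C hC using hval
    have huniq : ∀ (p : (Eᶜ : Set ℂ)) s c i, Develops h (3 * p.1 - p.1 ^ 3) s c →
        s i (3 * p.1 - p.1 ^ 3) = p.1 → C p = c i := by
      intro p s c i D hi
      obtain ⟨s', c', i', D', hi', hc⟩ := hC p
      rw [hc]
      exact D'.unique (hnb _ p.2) D (hi'.trans hi.symm)
    have hlc : IsLocallyConstant C := by
      rw [IsLocallyConstant.iff_eventually_eq]
      intro p
      obtain ⟨s, c, i, D, hi, hc⟩ := hC p
      have hx : Filter.Tendsto (fun p' : (Eᶜ : Set ℂ) => 3 * p'.1 - p'.1 ^ 3) (𝓝 p)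
          (𝓝 (3 * p.1 - p.1 ^ 3)) := by
        have : Continuous fun p' : (Eᶜ : Set ℂ) => 3 * p'.1 - p'.1 ^ 3 := by fun_prop
        exact this.tendsto p
      obtain ⟨hsc, hfib, -, -⟩ := D.eventually.self_of_nhds
      have hinj := hfib.injective (hnb _ p.2)
      have hne : ∀ᶠ p' : (Eᶜ : Set ℂ) in 𝓝 p, ∀ l, l ≠ i → s l (3 * p'.1 - p'.1 ^ 3) ≠ p'.1 := by
        refine Filter.eventually_all.2 fun l => ?_
        by_cases hl : l = i
        · exact Filter.Eventually.of_forall fun _ hn => absurd hl hn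
        have h1 : Filter.Tendsto (fun p' : (Eᶜ : Set ℂ) => s l (3 * p'.1 - p'.1 ^ 3) - p'.1) (𝓝 p)
            (𝓝 (s l (3 * p.1 - p.1 ^ 3) - p.1)) :=
          ((hsc l).tendsto.comp hx).sub (continuous_subtype_val.tendsto p)
        have h0 : s l (3 * p.1 - p.1 ^ 3) - p.1 ≠ 0 :=
          sub_ne_zero.2 fun h => hl (hinj (h.trans hi.symm))
        filter_upwards [h1.eventually_ne h0] with p' hp' _
        exact sub_ne_zero.1 hp'
      filter_upwards [hne, hx.eventually D.eventually_develops] with p' h1 h2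
      obtain ⟨l, hl⟩ := h2.eventually.self_of_nhds.2.1.exists_eq (p := p'.1)
        (by unfold Over; ring)
      have hli : l = i := by
        by_contra hli
        exact h1 l hli hl
      rw [hc]
      exact huniq p' s c i h2 (hli ▸ hl)
    have : PreconnectedSpace (Eᶜ : Set ℂ) := Subtype.preconnectedSpace hconn
    intro y hy s c D
    have hfib := D.eventually.self_of_nhds.2.1
    have hmem : ∀ i, 3 * s i y - s i y ^ 3 = y := by
      intro i
      have := hfib.over i
      unfold Over at this
      linear_combination -this
    have hval : ∀ i, ∃ p : (Eᶜ : Set ℂ), C p = c i := by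
      intro i
      refine ⟨⟨s i y, fun hs => hy ((hmem i) ▸ hs)⟩, huniq _ s c i ?_ ?_⟩
      · simp only [hmem]; exact D
      · simp only [hmem]
    have hsum := D.sum_eq_zero
    -- The three sheets over y are points of the same connected curve, so the locally constant C
    -- takes a single value on them.
    have heq : ∀ i j, c i = c j := by
      intro i j
      obtain ⟨p, hp⟩ := hval i
      obtain ⟨q, hq⟩ := hval j
      rw [← hp, ← hq]
      exact hlc.apply_eq_of_preconnectedSpace p q
    intro i
    rw [Fin.sum_univ_three, heq 0 i, heq 1 i, heq 2 i] at hsum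
    linarith
  have hon : ∀ y ∈ Mᶜ, (h y).whiteMass = topMass (develop y).1 ∧
      (h y).blackMass = bottomMass (develop y).1 := by
    intro y hy
    obtain ⟨s, c, D⟩ := hdev y hy
    obtain ⟨-, hf, e1, e2⟩ := D.eventually.self_of_nhds
    simp only [key y hy s c D, add_zero] at e1 e2
    rw [e1, e2]
    exact hf.mass_eq_develop
  have hdense : Dense Mᶜ := hNc.dense_compl ℝ
  -- Rewriting the masses of `develop` as masses in a fixed chart makes their continuity available,
  -- so the equality extends from the dense complement of M.
  have hdc : ∀ y, topMass (develop y).1 = (upperHexagon.chart (develop y)).whiteMass ∧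
      bottomMass (develop y).1 = (upperHexagon.chart (develop y)).blackMass := fun y =>
    ⟨(upperHexagon.whiteMass_chart _).symm, (upperHexagon.blackMass_chart _).symm⟩
  have hch : Continuous fun y => upperHexagon.chart (develop y) :=
    upperHexagon.continuous_chart.comp continuous_develop
  simp only [hdc] at hon ⊢
  exact ⟨congrFun (Continuous.ext_on hdense (continuous_whiteMass.comp hcont)
      (continuous_whiteMass.comp hch) fun y hy => (hon y hy).1) x,
    congrFun (Continuous.ext_on hdense (continuous_blackMass.comp hcont)
      (continuous_blackMass.comp hch) fun y hy => (hon y hy).2) x⟩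

/-- The inverse image of the singular set under a harmonic map is the extended network. -/
theorem IsHarmonicPhiMap.preimage_singularSet {h : ℂ → UniversalBuilding}
    (hh : IsHarmonicPhiMap h) : h ⁻¹' singularSet B8 = extendedNetwork := by
  ext x
  rw [Set.mem_preimage, mem_singularSet_iff isThick_B8, (hh.mass_eq x).1, (hh.mass_eq x).2,
    mass_eq_zero_iff, mem_extendedNetwork_iff, isTie_iff (isFibre_sheet x)]
  simp only [develop_apply]

/-! ## The universal map is harmonic -/

theorem topExcess_eq_zero {u : Fin 3 → ℝ} {i j : Fin 3} (hij : i ≠ j) (h : u i ≤ u j) :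
    topExcess u i = 0 := by
  have : j = i + 1 ∨ j = i + 2 := by clear h; revert i j; decide
  unfold topExcess
  rcases this with rfl | rfl
  · exact max_eq_left ((min_le_left _ _).trans (by linarith))
  · exact max_eq_left ((min_le_right _ _).trans (by linarith))

theorem bottomExcess_eq_zero {u : Fin 3 → ℝ} {i j : Fin 3} (hij : i ≠ j) (h : u j ≤ u i) :
    bottomExcess u i = 0 := by
  have : j = i + 1 ∨ j = i + 2 := by clear h; revert i j; decide
  unfold bottomExcess
  rcases this with rfl | rfl
  · exact max_eq_left ((min_le_left _ _).trans (by linarith))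
  · exact max_eq_left ((min_le_right _ _).trans (by linarith))

theorem primitive_ofReal (ρ : ℝ) :
    primitive (ρ : ℂ) = ((3 / 2 * ρ ^ 2 - 3 / 4 * ρ ^ 4 + 3 / 2 : ℝ) : ℂ) := by
  unfold primitive; push_cast; ring

theorem primitive_re_neg {p : ℂ} (h : p.im = 0) (h' : 4 ≤ p.re ^ 2) : (primitive p).re < 0 := by
  have hp : p = (p.re : ℂ) := by apply Complex.ext <;> simp [h]
  rw [hp, primitive_ofReal, Complex.ofReal_re]
  nlinarith

/-- The conjugate of a root over a real point is again a root and has the same real part, so it is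
the same root. -/
theorem IsFibre.im_eq_zero {x : ℂ} {s : Fin 3 → ℂ} (h : IsFibre x s) (hx : x.im = 0)
    (hs : ∀ i j, i ≠ j → (s i).re ≠ (s j).re) (i : Fin 3) : (s i).im = 0 := by
  have hconj : Over x (starRingEnd ℂ (s i)) := by
    have h1 := congrArg (starRingEnd ℂ) (h.over i)
    have h2 : starRingEnd ℂ x = x := Complex.conj_eq_iff_im.2 hx
    simp only [map_add, map_sub, map_mul, map_pow, map_zero, h2, Complex.conj_ofNat] at h1
    exact h1
  obtain ⟨j, hj⟩ := h.exists_eq hconj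
  by_cases hij : i = j
  · rw [← hij] at hj
    exact Complex.conj_eq_iff_im.1 hj.symm
  · exact absurd (by rw [hj, Complex.conj_re]) (hs i j hij)

/-- Over the real axis the middle sheet has the largest coordinate. -/
theorem develop_of_im_eq_zero {x : ℂ} (hx : x.im = 0) :
    (develop x).1 0 ≤ (develop x).1 1 ∧ (develop x).1 2 ≤ (develop x).1 1 ∧
      (x.re ^ 2 < 4 → (develop x).1 0 < (develop x).1 1 ∧ (develop x).1 2 < (develop x).1 1) := by
  have h := isFibre_sheet x
  obtain ⟨h10, h21⟩ := sheet_re_anti x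
  simp only [develop_apply]
  generalize sheet x = s at *
  have e1 := h.sum
  have e2 := h.pairs
  have hsum := congrArg Complex.re (primitive_sum e1 e2)
  simp only [Complex.add_re, Complex.zero_re] at hsum
  by_cases h01 : (s 0).re = (s 1).re
  · obtain ⟨f1, f2, f3⟩ := re_eq_aux e1 e2 h01
    have := primitive_re_neg f1 f2
    have := (h.of_re_eq (by decide) h01).2.1
    exact ⟨by linarith, by linarith, fun h => by linarith⟩
  by_cases h12 : (s 1).re = (s 2).re
  · obtain ⟨f1, f2, f3⟩ := re_eq_aux (p := s 1) (q := s 2) (r := s 0) (by linear_combination e1)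
      (by linear_combination e2) h12
    have := primitive_re_neg f1 f2
    have := (h.of_re_eq (by decide) h12).2.1
    exact ⟨by linarith, by linarith, fun h => by linarith⟩
  have l10 := lt_of_le_of_ne h10 (Ne.symm h01)
  have l21 := lt_of_le_of_ne h21 (Ne.symm h12)
  have hreal : ∀ i, s i = ((s i).re : ℂ) := by
    intro i
    have := h.im_eq_zero hx (by
      intro i j hij
      fin_cases i <;> fin_cases j <;> simp at hij ⊢ <;> intro h <;> linarith) i
    apply Complex.ext <;> simp [this]
  have d01 := primitive_sub e1 e2
  have d21 := primitive_sub (p := s 2) (q := s 1) (r := s 0) (by linear_combination e1)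
    (by linear_combination e2)
  have r1 := congrArg Complex.re e1
  simp only [Complex.add_re, Complex.zero_re] at r1
  have c01 : (primitive (s 0)).re - (primitive (s 1)).re =
      (s 2).re * ((s 0).re - (s 1).re) ^ 3 / 4 := by
    have e : primitive (s 0) - primitive (s 1) =
        (((s 2).re * ((s 0).re - (s 1).re) ^ 3 / 4 : ℝ) : ℂ) := by
      push_cast
      rw [d01, ← hreal 0, ← hreal 1, ← hreal 2]
    rw [← Complex.sub_re, e, Complex.ofReal_re]
  have c21 : (primitive (s 2)).re - (primitive (s 1)).re =
      -((s 0).re * ((s 1).re - (s 2).re) ^ 3 / 4) := by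
    have e : primitive (s 2) - primitive (s 1) =
        ((-((s 0).re * ((s 1).re - (s 2).re) ^ 3 / 4) : ℝ) : ℂ) := by
      push_cast
      rw [d21, ← hreal 0, ← hreal 1, ← hreal 2]
      ring
    rw [← Complex.sub_re, e, Complex.ofReal_re]
  -- The real roots are strictly decreasing with sum zero, so the last is negative and the first
  -- positive; this gives the sign of both differences of P.
  have m1 : 0 < -(s 2).re * ((s 0).re - (s 1).re) ^ 3 :=
    mul_pos (by linarith) (pow_pos (by linarith) 3)
  have m2 : 0 < (s 0).re * ((s 1).re - (s 2).re) ^ 3 :=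
    mul_pos (by linarith) (pow_pos (by linarith) 3)
  exact ⟨by linarith, by linarith, fun _ => ⟨by linarith, by linarith⟩⟩

/-- The two apartments agree along the two sectors at the middle vertex. -/
theorem chart_upper_eq_lower {u : Apt} (h0 : u.1 0 ≤ u.1 1) (h2 : u.1 2 ≤ u.1 1) :
    upperHexagon.chart u = lowerHexagon.chart u := by
  refine Hexagon.chart_eq_chart 1 (fun _ => rfl) (fun i => ?_) fun i => ?_
  · fin_cases i
    · exact Or.inl (topExcess_eq_zero (j := 1) (by decide) h0)
    · exact Or.inr rfl
    · exact Or.inl (topExcess_eq_zero (j := 1) (by decide) h2)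
  · fin_cases i
    · exact Or.inr rfl
    · exact Or.inl (bottomExcess_eq_zero (j := 0) (by decide) h0)
    · exact Or.inr rfl

theorem continuous_universalMap : Continuous universalMap := by
  refine Continuous.if_le (upperHexagon.continuous_chart.comp continuous_develop)
    (lowerHexagon.continuous_chart.comp continuous_develop) continuous_const
    Complex.continuous_im fun x hx => ?_
  obtain ⟨h0, h2, -⟩ := develop_of_im_eq_zero hx.symm
  exact chart_upper_eq_lower h0 h2

/-- Local data of a harmonic map, with the primitive as the antiderivative of the sections. -/
theorem exists_local_data {G : BipGraph} {h : ℂ → Cone G} {x₀ : ℂ} (H : Hexagon G)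
    (s : Fin 3 → ℂ → ℂ)
    (hs : ∀ᶠ y in 𝓝 x₀, (∀ i, ContinuousAt (s i) y) ∧ IsFibre y (fun i => s i y))
    (hh : ∀ᶠ y in 𝓝 x₀, ∀ u : Apt, (∀ i, u.1 i = (primitive (s i y)).re) → h y = H.chart u) :
    ∃ U ∈ 𝓝 x₀, ∃ (H : Hexagon G) (g : ℂ → Apt) (s θ : Fin 3 → ℂ → ℂ),
      (∀ y ∈ U, h y = H.chart (g y)) ∧
      (∀ i, ContinuousOn (s i) U) ∧
      (∀ y ∈ U, IsFibre y (fun i => s i y)) ∧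
      (∀ i, ∀ y ∈ U, HasDerivAt (θ i) (s i y) y) ∧
      (∀ i, ∀ y ∈ U, (g y).1 i = (θ i y).re) := by
  have hg : ∀ y, ∃ u : Apt, IsFibre y (fun i => s i y) → ∀ i, u.1 i = (primitive (s i y)).re := by
    intro y
    by_cases hf : IsFibre y (fun i => s i y)
    · refine ⟨⟨WithLp.toLp 2 fun i => (primitive (s i y)).re, ?_⟩, fun _ _ => rfl⟩
      simpa using congrArg Complex.re (BNR.primitive_sum hf.sum hf.pairs)
    · exact ⟨develop 0, fun h => absurd h hf⟩
  choose g hg using hg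
  refine ⟨_, (eventually_eventually_nhds.2 hs).and hh, H, g, s, fun i y => primitive (s i y),
    fun y hy => hy.2 _ (hg y hy.1.self_of_nhds.2),
    fun i y hy => (hy.1.self_of_nhds.1 i).continuousWithinAt,
    fun y hy => hy.1.self_of_nhds.2,
    fun i y hy => hasDerivAt_primitive_section (hy.1.self_of_nhds.1 i)
      (hy.1.mono fun z hz => hz.2.over i), fun i y hy => hg y hy.1.self_of_nhds.2 i⟩

/-! ### Local sections and apartments near the outer real rays -/

theorem exists_section {p₀ : ℂ} (h : 3 - 3 * p₀ ^ 2 ≠ 0) : ∃ σ : ℂ → ℂ, σ (3 * p₀ - p₀ ^ 3) = p₀ ∧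
    ∀ᶠ y in 𝓝 (3 * p₀ - p₀ ^ 3), ContinuousAt σ y ∧ Over y (σ y) := by
  have hd : HasStrictDerivAt (fun p : ℂ => 3 * p - p ^ 3) (3 - 3 * p₀ ^ 2) p₀ :=
    (((hasStrictDerivAt_id p₀).const_mul 3).sub (hasStrictDerivAt_pow 3 p₀)).congr_deriv
      (by push_cast; ring)
  have hf := hd.hasStrictFDerivAt_equiv h
  set e := hf.toOpenPartialHomeomorph (fun p : ℂ => 3 * p - p ^ 3) with he
  have hcoe : ∀ p, e p = 3 * p - p ^ 3 := fun p => rfl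
  have hsrc : p₀ ∈ e.source := hf.mem_toOpenPartialHomeomorph_source
  refine ⟨e.symm, e.left_inv hsrc, ?_⟩
  filter_upwards [e.open_target.mem_nhds (e.map_source hsrc)] with y hy
  refine ⟨e.symm.continuousAt hy, ?_⟩
  have := e.right_inv hy
  rw [hcoe] at this
  unfold Over
  linear_combination -this

theorem isFibre_of_ne {x p q r : ℂ} (hp : Over x p) (hq : Over x q) (hr : Over x r) (hpq : p ≠ q)
    (hpr : p ≠ r) (hqr : q ≠ r) : IsFibre x ![p, q, r] := by
  obtain ⟨-, -, h⟩ := exists_third hp hq hpq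
  obtain ⟨i, hi⟩ := h.exists_eq hr
  fin_cases i
  · exact absurd hi hpr
  · exact absurd hi hqr
  · have : -(p + q) = r := hi
    rwa [this] at h

/-- Sections of the spectral cover near the real points beyond the branch points. -/
theorem exists_ray_sections {ρ : ℝ} (hρ : 4 < ρ ^ 2) : ∃ s : Fin 3 → ℂ → ℂ,
    ∀ᶠ y in 𝓝 (3 * (ρ : ℂ) - (ρ : ℂ) ^ 3), (∀ i, ContinuousAt (s i) y) ∧
      IsFibre y (fun i => s i y) ∧ (s 0 y).im < (s 1 y).im ∧
      4 + 3 * (s 2 y).im ^ 2 < (s 2 y).re ^ 2 ∧ 0 < ρ * (s 2 y).re ∧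
      ρ * (s 0 y).re < ρ * (s 2 y).re ∧ ρ * (s 1 y).re < ρ * (s 2 y).re ∧
      (primitive (s 2 y)).re < (primitive (s 0 y)).re ∧
      (primitive (s 2 y)).re < (primitive (s 1 y)).re := by
  -- The roots other than ρ are the conjugate pair (-ρ ± βi)/2. They have equal real parts, so near
  -- the ray they are labelled by imaginary part, which is continuous across it.
  obtain ⟨β, hβ, hβ2⟩ : ∃ β : ℝ, 0 < β ∧ β ^ 2 = 3 * ρ ^ 2 - 12 :=
    ⟨√(3 * ρ ^ 2 - 12), Real.sqrt_pos.2 (by linarith), Real.sq_sqrt (by linarith)⟩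
  have hβC : (β : ℂ) ^ 2 = 3 * ρ ^ 2 - 12 := by exact_mod_cast hβ2
  set x₀ : ℂ := 3 * (ρ : ℂ) - (ρ : ℂ) ^ 3 with hx₀
  set p : ℂ := (-ρ - β * Complex.I) / 2 with hp
  set q : ℂ := (-ρ + β * Complex.I) / 2 with hq
  have e1 : p + q + ρ = 0 := by rw [hp, hq]; ring
  have e2 : p * q + p * ρ + q * ρ = -3 := by
    rw [hp, hq]; linear_combination (1 / 4 : ℂ) * hβC - (β : ℂ) ^ 2 / 4 * Complex.I_sq
  have hpre : p.re = -ρ / 2 := by simp [hp]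
  have hqre : q.re = -ρ / 2 := by simp [hq]
  have hpim : p.im = -β / 2 := by simp [hp]
  have hqim : q.im = β / 2 := by simp [hq]
  have hfib : IsFibre x₀ ![p, q, (ρ : ℂ)] := by
    refine isFibre_of_symm (by simpa using e1) (by simpa using e2) ?_
    simp only [Matrix.cons_val]
    rw [hx₀]
    linear_combination (ρ : ℂ) * e2 - (ρ : ℂ) ^ 2 * e1
  have hnb : x₀ ∉ branchPoints := by
    rw [branchPoints_eq]
    have hcast : x₀ = ((3 * ρ - ρ ^ 3 : ℝ) : ℂ) := by rw [hx₀]; push_cast; ring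
    have hsq : 4 < (3 * ρ - ρ ^ 3) ^ 2 := by
      have h1 : 1 < (ρ ^ 2 - 3) ^ 2 := by nlinarith
      have h2 : (3 * ρ - ρ ^ 3) ^ 2 = ρ ^ 2 * (ρ ^ 2 - 3) ^ 2 := by ring
      rw [h2]
      nlinarith
    rintro (h | h)
    · rw [hcast] at h
      have : 3 * ρ - ρ ^ 3 = 2 := by exact_mod_cast h
      rw [this] at hsq
      norm_num at hsq
    · rw [hcast, Set.mem_singleton_iff] at h
      have : 3 * ρ - ρ ^ 3 = -2 := by exact_mod_cast h
      rw [this] at hsq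
      norm_num at hsq
  have hinj := hfib.injective hnb
  have hsec : ∀ i, ∃ σ : ℂ → ℂ, σ x₀ = ![p, q, (ρ : ℂ)] i ∧
      ∀ᶠ y in 𝓝 x₀, ContinuousAt σ y ∧ Over y (σ y) := by
    intro i
    have hov := hfib.over i
    have hx : 3 * (![p, q, (ρ : ℂ)] i) - (![p, q, (ρ : ℂ)] i) ^ 3 = x₀ := by
      unfold Over at hov; linear_combination -hov
    have := exists_section (p₀ := ![p, q, (ρ : ℂ)] i) fun h =>
      hnb ⟨_, hov, by linear_combination -h⟩
    rwa [hx] at this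
  choose s hs0 hs using hsec
  have hc : ∀ i, ContinuousAt (s i) x₀ := fun i => (hs i).self_of_nhds.1
  have v0 : s 0 x₀ = p := hs0 0
  have v1 : s 1 x₀ = q := hs0 1
  have v2 : s 2 x₀ = (ρ : ℂ) := hs0 2
  have hre : ∀ i, ContinuousAt (fun y => (s i y).re) x₀ := fun i =>
    Complex.continuous_re.continuousAt.comp (hc i)
  have him : ∀ i, ContinuousAt (fun y => (s i y).im) x₀ := fun i =>
    Complex.continuous_im.continuousAt.comp (hc i)
  have hP : ∀ i, ContinuousAt (fun y => (primitive (s i y)).re) x₀ := fun i =>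
    (Complex.continuous_re.comp continuous_primitive).continuousAt.comp (hc i)
  have hne : ∀ i j, i ≠ j → ∀ᶠ y in 𝓝 x₀, s i y ≠ s j y := by
    intro i j hij
    have h0 : s i x₀ - s j x₀ ≠ 0 := by
      rw [hs0, hs0]
      exact sub_ne_zero.2 fun h => hij (hinj h)
    filter_upwards [((hc i).sub (hc j)).eventually_ne h0] with y hy
    exact sub_ne_zero.1 hy
  obtain ⟨-, -, f3⟩ := re_eq_aux e1 e2 (hpre.trans hqre.symm)
  have f4 := primitive_re_neg (p := ρ) (Complex.ofReal_im ρ) (by rw [Complex.ofReal_re]; linarith)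
  have f5 := congrArg Complex.re (primitive_sum e1 e2)
  simp only [Complex.add_re, Complex.zero_re] at f5
  refine ⟨s, ?_⟩
  filter_upwards [Filter.eventually_all.2 hs, hne 0 1 (by decide), hne 0 2 (by decide),
    hne 1 2 (by decide),
    (him 0).eventually_lt (him 1) (by rw [v0, v1, hpim, hqim]; linarith),
    ContinuousAt.eventually_lt (f := fun y => 4 + 3 * (s 2 y).im ^ 2)
      (g := fun y => (s 2 y).re ^ 2) (continuousAt_const.add (continuousAt_const.mul ((him 2).pow 2)))
      ((hre 2).pow 2) (by simp [v2, hρ]),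
    ContinuousAt.eventually_lt (f := fun _ => (0 : ℝ)) (g := fun y => ρ * (s 2 y).re)
      continuousAt_const (continuousAt_const.mul (hre 2))
      (by rw [v2, Complex.ofReal_re]; nlinarith),
    ContinuousAt.eventually_lt (f := fun y => ρ * (s 0 y).re) (g := fun y => ρ * (s 2 y).re)
      (continuousAt_const.mul (hre 0)) (continuousAt_const.mul (hre 2))
      (by rw [v0, v2, Complex.ofReal_re, hpre]; nlinarith),
    ContinuousAt.eventually_lt (f := fun y => ρ * (s 1 y).re) (g := fun y => ρ * (s 2 y).re)
      (continuousAt_const.mul (hre 1)) (continuousAt_const.mul (hre 2))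
      (by rw [v1, v2, Complex.ofReal_re, hqre]; nlinarith),
    (hP 2).eventually_lt (hP 0) (by rw [v0, v2]; linarith),
    (hP 2).eventually_lt (hP 1) (by rw [v1, v2]; linarith)]
    with y h1 n01 n02 n12 h2 h3 h4 h5 h6 h7 h8
  refine ⟨fun i => (h1 i).1, ?_, h2, h3, h4, h5, h6, h7, h8⟩
  have := isFibre_of_ne (h1 0).2 (h1 1).2 (h1 2).2 n01 n02 n12
  exact this

/-- Crossing the real ray exchanges the order of the two conjugate roots. -/
theorem order_near_ray {x p q r : ℂ} (h1 : p + q + r = 0) (h2 : p * q + p * r + q * r = -3)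
    (hx : Over x r) (hr : r.re < 0) (hr2 : 4 + 3 * r.im ^ 2 < r.re ^ 2) (hpq : p.im < q.im) :
    (0 ≤ x.im → q.re ≤ p.re ∧ (primitive q).re ≤ (primitive p).re) ∧
    (x.im ≤ 0 → p.re ≤ q.re ∧ (primitive p).re ≤ (primitive q).re) := by
  have hsq := sq_sub_roots h1 h2
  have hd : 4 * (primitive p - primitive q) = (p - q) * (12 * r - 3 * r ^ 3) := by
    rw [primitive_sub h1 h2]
    linear_combination r * (p - q) * hsq
  have hx' : x = 3 * r - r ^ 3 := by unfold Over at hx; linear_combination hx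
  have E1 := congrArg Complex.im hsq
  have E2 := congrArg Complex.im hx'
  have E3 := congrArg Complex.re hd
  simp only [pow_succ, pow_zero, one_mul, Complex.sub_re, Complex.sub_im, Complex.mul_re,
    Complex.mul_im, Complex.re_ofNat, Complex.im_ofNat] at E1 E2 E3
  set α := p.re - q.re with hα
  set β := p.im - q.im with hβ
  have hβ0 : β < 0 := by rw [hβ]; linarith
  generalize r.re = ρ at *
  generalize r.im = η at *
  -- With r = ρ + iη and p - q = α + iβ, the sign of Im x fixes that of η, F1 then that of α, and F3
  -- that of the difference of Re P; so both orders switch together.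
  have F1 : α * β = -(3 * ρ * η) := by linear_combination E1 / 2
  have F2 : x.im = η * (3 - 3 * ρ ^ 2 + η ^ 2) := by linear_combination E2
  have F3 : 4 * ((primitive p).re - (primitive q).re) =
      α * (-3 * ρ * (ρ ^ 2 - 4 - 3 * η ^ 2)) - β * (-3 * η * (3 * ρ ^ 2 - 4 - η ^ 2)) := by
    linear_combination E3
  have g1 : 3 - 3 * ρ ^ 2 + η ^ 2 < 0 := by nlinarith [sq_nonneg η]
  have g2 : 0 < -3 * ρ * (ρ ^ 2 - 4 - 3 * η ^ 2) := mul_pos (by linarith) (by linarith)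
  have g3 : 0 < 3 * ρ ^ 2 - 4 - η ^ 2 := by nlinarith [sq_nonneg η]
  constructor
  · intro h
    have hη : η ≤ 0 := by
      by_contra! h0
      rw [F2] at h
      linarith [mul_neg_of_pos_of_neg h0 g1]
    have hα0 : 0 ≤ α := by
      by_contra! h0
      have := mul_pos_of_neg_of_neg h0 hβ0
      have := mul_nonneg_of_nonpos_of_nonpos hr.le hη
      linarith
    have k1 := mul_nonneg hα0 g2.le
    have k2 := mul_nonneg (neg_nonneg.2 hβ0.le)
      (mul_nonneg (by linarith : 0 ≤ -3 * η) g3.le)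
    exact ⟨by linarith, by linarith⟩
  · intro h
    have hη : 0 ≤ η := by
      by_contra! h0
      rw [F2] at h
      linarith [mul_pos_of_neg_of_neg h0 g1]
    have hα0 : α ≤ 0 := by
      by_contra! h0
      have := mul_neg_of_pos_of_neg h0 hβ0
      have := mul_nonpos_of_nonpos_of_nonneg hr.le hη
      linarith
    have k1 := mul_nonneg (neg_nonneg.2 hα0) g2.le
    have k2 := mul_nonneg (neg_nonneg.2 hβ0.le)
      (mul_nonneg (by linarith : 0 ≤ 3 * η) g3.le)
    exact ⟨by linarith, by linarith⟩

theorem universalMap_of_nonneg {x : ℂ} (h : 0 ≤ x.im) :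
    universalMap x = upperHexagon.chart (develop x) := if_pos h

theorem universalMap_of_nonpos {x : ℂ} (h : x.im ≤ 0) :
    universalMap x = lowerHexagon.chart (develop x) := by
  rcases h.lt_or_eq with h | h
  · exact if_neg (not_le.2 h)
  · obtain ⟨h0, h2, -⟩ := develop_of_im_eq_zero h
    rw [universalMap_of_nonneg h.ge, chart_upper_eq_lower h0 h2]

theorem not_adj_one_three :
    ∀ k : Fin 4, ¬((1 = k ∨ 1 = k + 1) ∧ (3 = k ∨ 3 = k + 1)) := by
  decide

/-- A hexagon `b_1 - w_0 - b_0 - w_3 - b_3 - n - b_1`. -/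
theorem exists_rightHexagon : ∃ H : Hexagon B8, H.white 0 = octWhite 0 ∧ H.white 1 = octWhite 3 ∧
    H.black 0 = octBlack 3 ∧ H.black 1 = octBlack 1 ∧ H.black 2 = octBlack 0 := by
  obtain ⟨n, h1, h3⟩ := joins_swap_B8 (octBlack 1) (octBlack 3)
  have h1 : B8.Adj n (octBlack 1) := h1
  have h3 : B8.Adj n (octBlack 3) := h3
  -- The vertices b_1 and b_3 have no common neighbour in the octagon, so the one provided by the
  -- plane differs from its white vertices.
  have hn : ∀ k, octWhite k ≠ n := by
    rintro k rfl
    exact not_adj_one_three k ⟨adj_oct_iff.1 h1, adj_oct_iff.1 h3⟩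
  refine ⟨⟨![octWhite 0, octWhite 3, n], ![octBlack 3, octBlack 1, octBlack 0], ?_, ?_, ?_⟩,
    rfl, rfl, rfl, rfl, rfl⟩
  · have h03 : octWhite 0 ≠ octWhite 3 := fun h => absurd (octWhite_inj h) (by decide)
    intro i j hij
    fin_cases i <;> fin_cases j <;> simp [hn, (hn _).symm, h03, h03.symm] at hij ⊢
  · have h31 : octBlack 3 ≠ octBlack 1 := fun h => absurd (octBlack_inj h) (by decide)
    have h30 : octBlack 3 ≠ octBlack 0 := fun h => absurd (octBlack_inj h) (by decide)
    have h10 : octBlack 1 ≠ octBlack 0 := fun h => absurd (octBlack_inj h) (by decide)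
    intro i j hij
    fin_cases i <;> fin_cases j <;>
      simp [h31, h30, h10, h31.symm, h30.symm, h10.symm] at hij ⊢
  · intro i j hij
    fin_cases i <;> fin_cases j <;> simp [adj_oct_iff, h1, h3] at hij ⊢

/-- A hexagon `b_1 - w_1 - b_2 - w_2 - b_3 - n - b_1`. -/
theorem exists_leftHexagon : ∃ H : Hexagon B8, H.white 1 = octWhite 2 ∧ H.white 2 = octWhite 1 ∧
    H.black 0 = octBlack 2 ∧ H.black 1 = octBlack 1 ∧ H.black 2 = octBlack 3 := by
  obtain ⟨n, h1, h3⟩ := joins_swap_B8 (octBlack 1) (octBlack 3)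
  have h1 : B8.Adj n (octBlack 1) := h1
  have h3 : B8.Adj n (octBlack 3) := h3
  have hn : ∀ k, octWhite k ≠ n := by
    rintro k rfl
    exact not_adj_one_three k ⟨adj_oct_iff.1 h1, adj_oct_iff.1 h3⟩
  refine ⟨⟨![n, octWhite 2, octWhite 1], ![octBlack 2, octBlack 1, octBlack 3], ?_, ?_, ?_⟩,
    rfl, rfl, rfl, rfl, rfl⟩
  · have h03 : octWhite 2 ≠ octWhite 1 := fun h => absurd (octWhite_inj h) (by decide)
    intro i j hij
    fin_cases i <;> fin_cases j <;> simp [hn, (hn _).symm, h03, h03.symm] at hij ⊢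
  · have h31 : octBlack 3 ≠ octBlack 1 := fun h => absurd (octBlack_inj h) (by decide)
    have h32 : octBlack 3 ≠ octBlack 2 := fun h => absurd (octBlack_inj h) (by decide)
    have h12 : octBlack 1 ≠ octBlack 2 := fun h => absurd (octBlack_inj h) (by decide)
    intro i j hij
    fin_cases i <;> fin_cases j <;>
      simp [h31, h32, h12, h31.symm, h32.symm, h12.symm] at hij ⊢
  · intro i j hij
    fin_cases i <;> fin_cases j <;> simp [adj_oct_iff, h1, h3] at hij ⊢

theorem forall_fin_three {P : Fin 3 → Prop} (h0 : P 0) (h1 : P 1) (h2 : P 2) : ∀ i, P i := by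
  intro i
  fin_cases i <;> assumption

theorem primitive_neg (p : ℂ) : primitive (-p) = primitive p := by
  unfold primitive; ring

/-- Near the ray x > 2 the real root is the last sheet and has the smallest coordinate, so the image
is near the ray of b_0. The largest coordinate belongs to section 0 above the axis and to section 1
below it, which leads to the vertices w_0 and w_3 of one hexagon. -/
theorem universalMap_right {H : Hexagon B8} (hw0 : H.white 0 = octWhite 0)
    (hw1 : H.white 1 = octWhite 3) (hb0 : H.black 0 = octBlack 3) (hb1 : H.black 1 = octBlack 1)
    (hb2 : H.black 2 = octBlack 0) {y : ℂ} {s : Fin 3 → ℂ} (hf : IsFibre y s)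
    (him : (s 0).im < (s 1).im) (h2 : (s 2).re < 0) (h2' : 4 + 3 * (s 2).im ^ 2 < (s 2).re ^ 2)
    (h02 : (s 2).re < (s 0).re) (h12 : (s 2).re < (s 1).re)
    (p02 : (primitive (s 2)).re < (primitive (s 0)).re)
    (p12 : (primitive (s 2)).re < (primitive (s 1)).re) {u : Apt}
    (hu : ∀ i, u.1 i = (primitive (s i)).re) : universalMap y = H.chart u := by
  obtain ⟨k1, k2⟩ := order_near_ray hf.sum hf.pairs (hf.over 2) h2 h2' him
  rcases le_total 0 y.im with hy | hy
  · obtain ⟨k3, k4⟩ := k1 hy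
    have hd := develop_eq_of_sorted hf k3 h12.le
    have d10 : (develop y).1 1 ≤ (develop y).1 0 := by rw [hd, hd]; exact k4
    have d20 : (develop y).1 2 ≤ (develop y).1 0 := by rw [hd, hd]; exact p02.le
    rw [universalMap_of_nonneg hy]
    refine Hexagon.chart_eq_chart 1 (fun i => ?_) (forall_fin_three (Or.inr hw0.symm)
      (Or.inl (topExcess_eq_zero (j := 0) (by decide) d10))
      (Or.inl (topExcess_eq_zero (j := 0) (by decide) d20)))
      (forall_fin_three (Or.inl (bottomExcess_eq_zero (j := 1) (by decide) d10))
        (Or.inr hb1.symm) (Or.inr hb2.symm))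
    rw [hd i]
    exact hu i
  · obtain ⟨k3, k4⟩ := k2 hy
    have hd := develop_eq_of_sorted (hf.comp_perm (Equiv.swap 0 1)) k3 h02.le
    have d10 : (develop y).1 1 ≤ (develop y).1 0 := by rw [hd, hd]; exact k4
    have d20 : (develop y).1 2 ≤ (develop y).1 0 := by rw [hd, hd]; exact p12.le
    rw [universalMap_of_nonpos hy]
    refine Hexagon.chart_eq_chart (Equiv.swap 0 1) (fun i => ?_)
      (forall_fin_three (Or.inr hw1.symm)
      (Or.inl (topExcess_eq_zero (j := 0) (by decide) d10))
      (Or.inl (topExcess_eq_zero (j := 0) (by decide) d20)))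
      (forall_fin_three (Or.inl (bottomExcess_eq_zero (j := 1) (by decide) d10))
        (Or.inr hb0.symm) (Or.inr hb2.symm))
    rw [hd i]
    exact hu _

theorem universalMap_left {H : Hexagon B8} (hw1 : H.white 1 = octWhite 2)
    (hw2 : H.white 2 = octWhite 1) (hb0 : H.black 0 = octBlack 2) {y : ℂ} {s : Fin 3 → ℂ}
    (hf : IsFibre y s) (him : (s 2).im < (s 1).im) (h2 : 0 < (s 0).re)
    (h2' : 4 + 3 * (s 0).im ^ 2 < (s 0).re ^ 2)
    (h02 : (s 2).re < (s 0).re) (h12 : (s 1).re < (s 0).re)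
    (p02 : (primitive (s 0)).re < (primitive (s 2)).re)
    (p12 : (primitive (s 0)).re < (primitive (s 1)).re) {u : Apt}
    (hu : ∀ i, u.1 i = (primitive (s i)).re) : universalMap y = H.chart u := by
  -- The symmetry (x, p) ↦ (-x, -p) preserves P and carries the left ray to the right one,
  -- exchanging the half planes.
  obtain ⟨k1, k2⟩ := order_near_ray (x := -y) (p := -s 1) (q := -s 2) (r := -s 0)
    (by linear_combination -hf.sum) (by linear_combination hf.pairs)
    (by have := hf.over 0; unfold Over at this ⊢; linear_combination -this) (by simpa using h2)
    (by simpa using h2') (by simpa using him)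
  simp only [Complex.neg_im, Complex.neg_re, primitive_neg, neg_le_neg_iff, Left.nonneg_neg_iff,
    Left.neg_nonpos_iff] at k1 k2
  rcases le_total 0 y.im with hy | hy
  · obtain ⟨k3, k4⟩ := k2 hy
    have hd := develop_eq_of_sorted hf h12.le k3
    have d12 : (develop y).1 1 ≤ (develop y).1 2 := by rw [hd, hd]; exact k4
    have d02 : (develop y).1 0 ≤ (develop y).1 2 := by rw [hd, hd]; exact p02.le
    have d01 : (develop y).1 0 ≤ (develop y).1 1 := by rw [hd, hd]; exact p12.le
    rw [universalMap_of_nonneg hy]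
    refine Hexagon.chart_eq_chart 1 (fun i => ?_) (forall_fin_three
      (Or.inl (topExcess_eq_zero (j := 2) (by decide) d02))
      (Or.inl (topExcess_eq_zero (j := 2) (by decide) d12)) (Or.inr hw2.symm))
      (forall_fin_three (Or.inr hb0.symm)
        (Or.inl (bottomExcess_eq_zero (j := 0) (by decide) d01))
        (Or.inl (bottomExcess_eq_zero (j := 0) (by decide) d02)))
    rw [hd i]
    exact hu i
  · obtain ⟨k3, k4⟩ := k1 hy
    have hd := develop_eq_of_sorted (hf.comp_perm (Equiv.swap 1 2)) h02.le k3
    have d12 : (develop y).1 1 ≤ (develop y).1 2 := by rw [hd, hd]; exact k4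
    have d02 : (develop y).1 0 ≤ (develop y).1 2 := by rw [hd, hd]; exact p12.le
    have d01 : (develop y).1 0 ≤ (develop y).1 1 := by rw [hd, hd]; exact p02.le
    rw [universalMap_of_nonpos hy]
    refine Hexagon.chart_eq_chart (Equiv.swap 1 2) (fun i => ?_) (forall_fin_three
      (Or.inl (topExcess_eq_zero (j := 2) (by decide) d02))
      (Or.inl (topExcess_eq_zero (j := 2) (by decide) d12)) (Or.inr hw1.symm))
      (forall_fin_three (Or.inr hb0.symm)
        (Or.inl (bottomExcess_eq_zero (j := 0) (by decide) d01))
        (Or.inl (bottomExcess_eq_zero (j := 0) (by decide) d02)))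
    rw [hd i]
    exact hu _

/-- A real point beyond the branch points is below a real root of absolute value above `2`. -/
theorem exists_real_root {x : ℂ} (him : x.im = 0) (hre : 4 < x.re ^ 2) :
    ∃ ρ : ℝ, 4 < ρ ^ 2 ∧ x = 3 * (ρ : ℂ) - (ρ : ℂ) ^ 3 := by
  obtain ⟨ρ, hρ⟩ : ∃ ρ : ℝ, 3 * ρ - ρ ^ 3 = x.re ∧ 4 < ρ ^ 2 := by
    have hc : Continuous fun ρ : ℝ => 3 * ρ - ρ ^ 3 := by fun_prop
    rcases lt_or_ge 2 x.re with h | h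
    · obtain ⟨ρ, hρ, e⟩ := intermediate_value_Icc' (show -x.re - 2 ≤ -2 by linarith)
        hc.continuousOn (show x.re ∈ Set.Icc (3 * (-2) - (-2) ^ 3)
          (3 * (-x.re - 2) - (-x.re - 2) ^ 3) from ⟨by linarith, by
            nlinarith [pow_pos (show 0 < x.re by linarith) 3]⟩)
      refine ⟨ρ, e, ?_⟩
      have h1 : ρ ≠ -2 := by
        rintro rfl
        norm_num at e
        linarith
      have h2 := lt_of_le_of_ne hρ.2 h1
      nlinarith
    · have h' : x.re < -2 := by nlinarith
      obtain ⟨ρ, hρ, e⟩ := intermediate_value_Icc' (show 2 ≤ -x.re + 2 by linarith)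
        hc.continuousOn (show x.re ∈ Set.Icc (3 * (-x.re + 2) - (-x.re + 2) ^ 3)
          (3 * 2 - 2 ^ 3) from ⟨by
            nlinarith [pow_pos (show 0 < -x.re by linarith) 3], by linarith⟩)
      refine ⟨ρ, e, ?_⟩
      have h1 : ρ ≠ 2 := by
        rintro rfl
        norm_num at e
        linarith
      have h2 := lt_of_le_of_ne hρ.1 h1.symm
      nlinarith
  refine ⟨ρ, hρ.2, ?_⟩
  apply Complex.ext
  · rw [← hρ.1]
    have : 3 * (ρ : ℂ) - (ρ : ℂ) ^ 3 = ((3 * ρ - ρ ^ 3 : ℝ) : ℂ) := by push_cast; ring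
    rw [this, Complex.ofReal_re]
  · have : 3 * (ρ : ℂ) - (ρ : ℂ) ^ 3 = ((3 * ρ - ρ ^ 3 : ℝ) : ℂ) := by push_cast; ring
    rw [this, Complex.ofReal_im, him]

theorem eventually_sheet {x : ℂ} (hx : ¬ (x.im = 0 ∧ 4 ≤ x.re ^ 2)) :
    ∀ᶠ y in 𝓝 x, (∀ i, ContinuousAt (fun z => sheet z i) y) ∧ IsFibre y (fun i => sheet y i) := by
  have hcl : IsClosed {y : ℂ | y.im = 0 ∧ 4 ≤ y.re ^ 2} :=
    (isClosed_eq Complex.continuous_im continuous_const).inter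
      (isClosed_le continuous_const (Complex.continuous_re.pow 2))
  filter_upwards [hcl.isOpen_compl.mem_nhds hx] with y hy
  exact ⟨continuousAt_sheet hy, isFibre_sheet y⟩

theorem eq_develop {y : ℂ} {u : Apt} (hu : ∀ i, u.1 i = (primitive (sheet y i)).re) :
    u = develop y := by
  apply Subtype.ext
  ext i
  rw [hu i, develop_apply]

theorem isHarmonicPhiMap_universalMap : IsHarmonicPhiMap universalMap := by
  refine ⟨continuous_universalMap, branchPoints, fun x => ⟨Set.univ, Filter.univ_mem, ?_⟩, ?_⟩
  · rw [branchPoints_eq]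
    exact Set.toFinite _
  intro x hx
  rcases lt_trichotomy x.im 0 with him | him | him
  · refine exists_local_data lowerHexagon (fun i y => sheet y i)
      (eventually_sheet fun h => him.ne h.1) ?_
    filter_upwards [(isOpen_lt Complex.continuous_im continuous_const).mem_nhds him] with y hy u hu
    rw [eq_develop hu]
    exact universalMap_of_nonpos (le_of_lt hy)
  · rcases lt_trichotomy (x.re ^ 2) 4 with hre | hre | hre
    · obtain ⟨-, -, h⟩ := develop_of_im_eq_zero him
      obtain ⟨h0, h2⟩ := h hre
      -- Between the branch points the middle coordinate is strictly the largest, hence also nearby,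
      -- where the two apartments agree; one apartment therefore serves both half planes.
      have hc : ∀ i, Continuous fun y => (develop y).1 i := fun i =>
        (PiLp.continuous_apply 2 _ i).comp (continuous_subtype_val.comp continuous_develop)
      refine exists_local_data upperHexagon (fun i y => sheet y i)
        (eventually_sheet fun h => not_le.2 hre h.2) ?_
      filter_upwards [(isOpen_lt (hc 0) (hc 1)).mem_nhds h0,
        (isOpen_lt (hc 2) (hc 1)).mem_nhds h2] with y hy0 hy2 u hu
      rw [eq_develop hu]
      rcases le_total 0 y.im with hy | hy
      · exact universalMap_of_nonneg hy
      · rw [universalMap_of_nonpos hy, chart_upper_eq_lower (le_of_lt hy0) (le_of_lt hy2)]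
    · exfalso
      apply hx
      rw [branchPoints_eq]
      have : (x.re - 2) * (x.re + 2) = 0 := by linear_combination hre
      rcases mul_eq_zero.1 this with h | h
      · left
        apply Complex.ext
        · simp; linarith
        · simp [him]
      · right
        apply Complex.ext
        · simp; linarith
        · simp [him]
    · obtain ⟨ρ, hρ, rfl⟩ := exists_real_root him hre
      obtain ⟨s, hs⟩ := exists_ray_sections hρ
      rcases lt_or_gt_of_ne (show ρ ≠ 0 by rintro rfl; norm_num at hρ) with h0 | h0
      · obtain ⟨H, hw0, hw1, hb0, hb1, hb2⟩ := exists_rightHexagon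
        refine exists_local_data H s (hs.mono fun y hy => ⟨hy.1, hy.2.1⟩) ?_
        filter_upwards [hs] with y ⟨_, hf, k1, k2, k3, k4, k5, k6, k7⟩ u hu
        exact universalMap_right hw0 hw1 hb0 hb1 hb2 hf k1 (by nlinarith) k2
          ((mul_lt_mul_left_of_neg h0).1 k4) ((mul_lt_mul_left_of_neg h0).1 k5) k6 k7 hu
      · obtain ⟨H, hw1, hw2, hb0, -, -⟩ := exists_leftHexagon
        -- On the left ray the real root is positive and comes first in the order, so it is moved
        -- from index 2 to index 0.
        have hcyc : ∀ y, IsFibre y (fun i => s i y) → IsFibre y (fun i => s (Equiv.swap 0 2 i) y) :=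
          fun y hf => hf.comp_perm (Equiv.swap 0 2)
        refine exists_local_data H (fun i => s (Equiv.swap 0 2 i))
          (hs.mono fun y hy => ⟨fun i => hy.1 _, hcyc y hy.2.1⟩) ?_
        filter_upwards [hs] with y ⟨_, hf, k1, k2, k3, k4, k5, k6, k7⟩ u hu
        exact universalMap_left hw1 hw2 hb0 (hcyc y hf) k1 (pos_of_mul_pos_right k3 h0.le) k2
          ((mul_lt_mul_iff_right₀ h0).1 k4) ((mul_lt_mul_iff_right₀ h0).1 k5) k6 k7 hu
  · refine exists_local_data upperHexagon (fun i y => sheet y i)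
      (eventually_sheet fun h => him.ne' h.1) ?_
    filter_upwards [(isOpen_lt continuous_const Complex.continuous_im).mem_nhds him] with y hy u hu
    rw [eq_develop hu]
    exact universalMap_of_nonneg (le_of_lt hy)

end BNR

theorem mainTheorem4 :
    BNR.IsHarmonicPhiMap BNR.universalMap ∧
    BNR.spectralNetwork ⊆ BNR.universalMap ⁻¹' BNR.singularSet BNR.B8 ∧
    BNR.universalMap ⁻¹' BNR.singularSet BNR.B8 = BNR.extendedNetwork ∧
    ∀ h : ℂ → BNR.UniversalBuilding, BNR.IsHarmonicPhiMap h →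
      BNR.spectralNetwork ⊆ h ⁻¹' BNR.singularSet BNR.B8 ∧
      h ⁻¹' BNR.singularSet BNR.B8 = BNR.extendedNetwork := by
  have key : ∀ h : ℂ → BNR.UniversalBuilding, BNR.IsHarmonicPhiMap h →
      BNR.spectralNetwork ⊆ h ⁻¹' BNR.singularSet BNR.B8 ∧
      h ⁻¹' BNR.singularSet BNR.B8 = BNR.extendedNetwork := fun h hh =>
    ⟨hh.preimage_singularSet ▸ Set.subset_union_left, hh.preimage_singularSet⟩
  obtain ⟨h1, h2⟩ := key _ BNR.isHarmonicPhiMap_universalMap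
  exact ⟨BNR.isHarmonicPhiMap_universalMap, h1, h2, key⟩
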